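/- Let $\mathbb T=\mathbb R/\mathbb Z$, $L^2_c=L^2(\mathbb T,\mathbb C)\times L^2(\mathbb T,\mathbb C)$ with elements $\varphi=(\varphi_-,\varphi_+)$ and Fourier series $\varphi=\sum_{n\in\mathbb Z}(\varphi^-_{2n}e^{-2n\pi i x},\varphi^+_{2n}e^{2n\pi i x})$, let $L^2_r=\{\varphi\in L^2_c:\varphi_-=\overline{\varphi_+}\}$, and put $\langle x\rangle=1+|x|$. Let $\mathcal M$ be the class of all $w:\mathbb Z\to\mathbb R$ with $w_n\ge 1$, $w_n=w_{-n}$, $w_{n+m}\le w_nw_m$, $w_{|n|}\le w_{|n|+1}$ for all $n,m$, and let $\mathcal M^1$ consist of those $w\in\mathcal M$ of the form $w_n=\langle n\rangle v_n$ with $v\in\mathcal M$. Let $t\mapsto w[t]$ be the piecewise linear extension of $w$ to $\mathbb R$. Put $\|\varphi\|_w^2=\sum_n w_{2n}^2(|\varphi^-_{2n}|^2+|\varphi^+_{2n}|^2)$ and $H^w_c=\{\varphi\in L^2_c:\|\varphi\|_w<\infty\}$. For $\varphi\in L^2_c$ let $L(\varphi)=\begin{pmatrix} i&\\&-i\end{pmatrix}\frac{d}{dx}+\begin{pmatrix}&\varphi_-\\\varphi_+&\end{pmatrix}$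 on $[0,2]$ with periodic boundary conditions. Its eigenvalues, listed with algebraic multiplicities and ordered lexicographically (by real part, then imaginary part), form a sequence $\cdots\preceq\lambda_{n-1}^+\preceq\lambda_n^-\preceq\lambda_n^+\preceq\lambda_{n+1}^-\preceq\cdots$, numbered so that $\lambda_n^\pm=n\pi+\ell^2_n$ (that is, $(\lambda_n^\pm-n\pi)_{n}$ is square summable). Put $\gamma_n(\varphi)=\lambda_n^+-\lambda_n^-$. Let $\Delta(\lambda,\varphi)=\operatorname{tr}M(1,\lambda,\varphi)$, where $M$ is the fundamental solution of $L(\varphi)M=\lambda M$, $M(0)=I$, and let $\lambda_n^\bullet=n\pi+\ell^2_n$ be the lexicographically ordered zeros of $\partial_\lambda\Delta$, listed with multiplicities. Let $W\subset L^2_c$ be the union of all open sets $V\subset L^2_c$ that contain a point of $L^2_r$ and for which there are pairwise disjoint closed discs $(U_n)_{n\in\mathbb Z}$ centred on the real axis such that (i) $\lambda_n^\pm(\psi)$ and $\lambda_n^\bullet(\psi)$ lie in the interior of $U_n$ for all $\psi\in V$ and $n\in\mathbb Z$; (ii) for some $c\ge1$, $c^{-1}|m-n|\le\operatorname{dist}(U_n,U_m)\le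 c|m-n|$ for all $m\ne n$; (iii) $U_n=\{|\lambda-n\pi|\le\pi/4\}$ for $|n|$ sufficiently large. **Proposition.** Suppose $\varphi\in H^w_c$ with $w\in\mathcal M^1$. Then for every integer $N\ge0$ with $\langle N\rangle\ge 8\|\varphi\|_w^2$, $$\sum_{|n|\ge N}w_{2n}^2|\gamma_n(\varphi)|^2\le 6\|R_N\varphi\|_w^2+\frac{1152}{\langle N\rangle}\|\varphi\|_w^6,$$ where $R_N\varphi=\sum_{|n|\ge N}(\varphi^-_{2n}e^{-2n\pi i x},\varphi^+_{2n}e^{2n\pi i x})$. If, in addition, $\varphi\in W$, then $$\sum_{n\in\mathbb Z}w_{2n}^2|\gamma_n(\varphi)|^2\le 265\pi^2\,\bigl(w[16\|\varphi\|_w^2]\bigr)^2\,(1+\|\varphi\|_w^2)\,\|\varphi\|_w^2.$$ In particular both series converge. -/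

import Mathlib

open MeasureTheory Filter Topology

noncomputable section

namespace NLS

/-- The phase space `L²(𝕋, ℂ) × L²(𝕋, ℂ)`, `𝕋 = ℝ / ℤ`; an element is written `φ = (φ₋, φ₊)`,
so that `φ₋ = φ.1` and `φ₊ = φ.2`. -/
abbrev L2c : Type :=
  Lp ℂ 2 (AddCircle.haarAddCircle (T := (1 : ℝ))) ×
    Lp ℂ 2 (AddCircle.haarAddCircle (T := (1 : ℝ)))

/-- The states of real type: `φ₋` is the complex conjugate of `φ₊`. -/
def L2r : Set L2c :=
  {φ | ∀ᵐ t ∂(AddCircle.haarAddCircle (T := (1 : ℝ))), φ.1 t = starRingEnd ℂ (φ.2 t)}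

/-- The coefficient `φ⁻₂ₙ` of `e^{-2nπix}` in the Fourier series of `φ₋`. -/
def coeffMinus (φ : L2c) (n : ℤ) : ℂ := fourierCoeff φ.1 (-n)

/-- The coefficient `φ⁺₂ₙ` of `e^{2nπix}` in the Fourier series of `φ₊`. -/
def coeffPlus (φ : L2c) (n : ℤ) : ℂ := fourierCoeff φ.2 n

/-- `⟨x⟩ = 1 + |x|`. -/
def bracket (x : ℝ) : ℝ := 1 + |x|

/-- The class `𝓜` of normalised, submultiplicative, monotone (and symmetric) weights. -/
def weights : Set (ℤ → ℝ) :=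
  {w | (∀ n, 1 ≤ w n) ∧ (∀ n, w n = w (-n)) ∧ (∀ n m, w (n + m) ≤ w n * w m) ∧
    ∀ n, w |n| ≤ w (|n| + 1)}

/-- The subclass `𝓜¹` of the weights that have a linearly growing factor. -/
def weightsOne : Set (ℤ → ℝ) :=
  {w | w ∈ weights ∧ ∃ v ∈ weights, ∀ n : ℤ, w n = bracket n * v n}

/-- The piecewise linear extension `t ↦ w[t]` of a weight to the real line. -/
def weightExt (w : ℤ → ℝ) (t : ℝ) : ℝ :=
  w ⌊t⌋ + (t - ⌊t⌋) * (w (⌊t⌋ + 1) - w ⌊t⌋)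

/-- The summands of the squared `w`-norm. -/
def wTerm (w : ℤ → ℝ) (φ : L2c) (n : ℤ) : ℝ :=
  w (2 * n) ^ 2 * (‖coeffMinus φ n‖ ^ 2 + ‖coeffPlus φ n‖ ^ 2)

/-- The weighted Sobolev space of all `φ` with finite `w`-norm. -/
def Hw (w : ℤ → ℝ) : Set L2c := {φ | Summable (wTerm w φ)}

/-- The `w`-norm (meaningful on `Hw w`). -/
def wNorm (w : ℤ → ℝ) (φ : L2c) : ℝ := √(∑' n : ℤ, wTerm w φ n)

/-- The tail `R_N φ = ∑_{|n| ≥ N} (φ⁻₂ₙ e^{-2nπix}, φ⁺₂ₙ e^{2nπix})` of the Fourier series. -/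
def tail (N : ℕ) (φ : L2c) : L2c :=
  (∑' n : {n : ℤ // (N : ℤ) ≤ |n|}, coeffMinus φ n • fourierLp 2 (-(n : ℤ)),
    ∑' n : {n : ℤ // (N : ℤ) ≤ |n|}, coeffPlus φ n • fourierLp 2 (n : ℤ))

/-- `f` is locally absolutely continuous and `L(φ) f = g` almost everywhere, where
`L(φ) (f₋, f₊) = (i f₋' + φ₋ f₊, -i f₊' + φ₊ f₋)` is the Zakharov-Shabat operator. -/
structure ZSMaps (φ : L2c) (f g : ℝ → ℂ × ℂ) : Prop where
  ac : ∀ a b : ℝ, AbsolutelyContinuousOnInterval f a b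
  eq : ∀ᵐ x : ℝ, ∃ f' : ℂ × ℂ, HasDerivAt f f' x ∧
    Complex.I * f'.1 + φ.1 (x : AddCircle (1 : ℝ)) * (f x).2 = (g x).1 ∧
    -Complex.I * f'.2 + φ.2 (x : AddCircle (1 : ℝ)) * (f x).1 = (g x).2

theorem ZSMaps.zero (φ : L2c) : ZSMaps φ 0 0 := by
  refine ⟨fun a b => ?_, Eventually.of_forall fun x => ⟨0, ?_, by simp, by simp⟩⟩
  · exact ((LipschitzWith.const (0 : ℂ × ℂ)).lipschitzOnWith).absolutelyContinuousOnInterval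
  · exact hasDerivAt_const x (0 : ℂ × ℂ)

theorem ZSMaps.add {φ : L2c} {f g f₁ g₁ : ℝ → ℂ × ℂ} (h : ZSMaps φ f g) (h₁ : ZSMaps φ f₁ g₁) :
    ZSMaps φ (f + f₁) (g + g₁) := by
  refine ⟨fun a b => (h.ac a b).add (h₁.ac a b), ?_⟩
  filter_upwards [h.eq, h₁.eq] with x ⟨d, hd, e, e'⟩ ⟨d₁, hd₁, k, k'⟩
  refine ⟨d + d₁, hd.add hd₁, ?_, ?_⟩
  · simp only [Pi.add_apply, Prod.fst_add, Prod.snd_add]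
    rw [← e, ← k]; ring
  · simp only [Pi.add_apply, Prod.fst_add, Prod.snd_add]
    rw [← e', ← k']; ring

theorem ZSMaps.smul {φ : L2c} {f g : ℝ → ℂ × ℂ} (c : ℂ) (h : ZSMaps φ f g) :
    ZSMaps φ (c • f) (c • g) := by
  refine ⟨fun a b => (h.ac a b).const_smul c, ?_⟩
  filter_upwards [h.eq] with x ⟨d, hd, e, e'⟩
  refine ⟨c • d, hd.const_smul c, ?_, ?_⟩
  · simp only [Pi.smul_apply, Prod.smul_fst, Prod.smul_snd, smul_eq_mul]
    rw [← e]; ring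
  · simp only [Pi.smul_apply, Prod.smul_fst, Prod.smul_snd, smul_eq_mul]
    rw [← e']; ring

/-- `ker (L(φ) - z)ᵏ` for the operator `L(φ)` on the interval `[0, 2]` with periodic boundary
conditions; functions on `[0, 2]` with equal boundary values are read as 2-periodic functions. -/
def rootSpace (φ : L2c) (z : ℂ) : ℕ → Submodule ℂ (ℝ → ℂ × ℂ)
  | 0 => ⊥
  | k + 1 =>
    { carrier := {f | Function.Periodic f 2 ∧ ∃ g ∈ rootSpace φ z k, ZSMaps φ f (z • f + g)}
      zero_mem' := ⟨fun _ => rfl, 0, Submodule.zero_mem _, by simpa using ZSMaps.zero φ⟩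
      add_mem' := by
        rintro f f₁ ⟨hf, g, hg, h⟩ ⟨hf₁, g₁, hg₁, h₁⟩
        refine ⟨hf.add hf₁, g + g₁, Submodule.add_mem _ hg hg₁, ?_⟩
        have e : z • (f + f₁) + (g + g₁) = (z • f + g) + (z • f₁ + g₁) := by
          rw [smul_add]; abel
        rw [e]
        exact h.add h₁
      smul_mem' := by
        rintro c f ⟨hf, g, hg, h⟩
        refine ⟨hf.smul c, c • g, Submodule.smul_mem _ c hg, ?_⟩
        have e : z • (c • f) + c • g = c • (z • f + g) := by
          rw [smul_add, smul_comm]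
        rw [e]
        exact h.smul c }

/-- The algebraic multiplicity of `z` as a periodic eigenvalue of `L(φ)`, i.e. the dimension of
`⋃ₖ ker (L(φ) - z)ᵏ`; it is `0` if `z` is not an eigenvalue. -/
def algMult (φ : L2c) (z : ℂ) : ℕ∞ :=
  Cardinal.toENat (Module.rank ℂ (⨆ k, rootSpace φ z k : Submodule ℂ (ℝ → ℂ × ℂ)))

/-- The lexicographic order on `ℂ`: first by the real part, then by the imaginary part. -/
def LexLE (a b : ℂ) : Prop := a.re < b.re ∨ (a.re = b.re ∧ a.im ≤ b.im)

/-- `(lm n, lp n) = (λₙ⁻, λₙ⁺)` is the periodic spectrum of `φ`: the eigenvalues listed with their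
algebraic multiplicities, lexicographically ordered, and numbered so that `λₙ^± = nπ + ℓ²`. -/
structure IsPeriodicSpectrum (φ : L2c) (lm lp : ℤ → ℂ) : Prop where
  mult : ∀ z : ℂ, {n | lm n = z}.encard + {n | lp n = z}.encard = algMult φ z
  lex_gap : ∀ n, LexLE (lm n) (lp n)
  lex_next : ∀ n, LexLE (lp n) (lm (n + 1))
  asymp_minus : Summable fun n : ℤ => ‖lm n - n * Real.pi‖ ^ 2
  asymp_plus : Summable fun n : ℤ => ‖lp n - n * Real.pi‖ ^ 2

/-- `M` is the fundamental solution of `L(φ) M = z M` with `M(0) = I`. -/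
structure IsFundamentalSolution (φ : L2c) (z : ℂ) (M : ℝ → Matrix (Fin 2) (Fin 2) ℂ) : Prop where
  init : M 0 = 1
  sol : ∀ j : Fin 2, ZSMaps φ (fun x => (M x 0 j, M x 1 j)) (fun x => z • (M x 0 j, M x 1 j))

/-- The discriminant `Δ(z, φ) = tr M(1, z, φ)`. -/
def discriminant (φ : L2c) (z : ℂ) : ℂ :=
  ((Classical.epsilon (IsFundamentalSolution φ z)) 1).trace

/-- `mu n = λₙ^•` are the zeros of the `λ`-derivative of the discriminant: listed with their
multiplicities, lexicographically ordered, and numbered so that `λₙ^• = nπ + ℓ²`. -/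
structure IsCriticalSpectrum (φ : L2c) (mu : ℤ → ℂ) : Prop where
  mult : ∀ z : ℂ, {n | mu n = z}.encard = analyticOrderAt (deriv (discriminant φ)) z
  lex : ∀ n, LexLE (mu n) (mu (n + 1))
  asymp : Summable fun n : ℤ => ‖mu n - n * Real.pi‖ ^ 2

/-- The distance of two sets. -/
def setDist (A B : Set ℂ) : ℝ := sInf (Set.image2 dist A B)

/-- There is a common set of isolating neighbourhoods for all `ψ ∈ V`: disjoint closed discs `Uₙ`
with real centres `ctr n` and radii `rad n`. -/
def HasIsolatingDiscs (V : Set L2c) : Prop :=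
  ∃ ctr rad : ℤ → ℝ, ∃ U : ℤ → Set ℂ,
    (∀ n, 0 < rad n ∧ U n = Metric.closedBall (ctr n : ℂ) (rad n)) ∧
    (∀ m n, m ≠ n → Disjoint (U m) (U n)) ∧
    (∀ ψ ∈ V,
      (∀ lm lp, IsPeriodicSpectrum ψ lm lp → ∀ n, lm n ∈ interior (U n) ∧ lp n ∈ interior (U n)) ∧
      (∀ mu, IsCriticalSpectrum ψ mu → ∀ n, mu n ∈ interior (U n))) ∧
    (∃ c : ℝ, 1 ≤ c ∧ ∀ m n : ℤ, m ≠ n →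
      c⁻¹ * |(m : ℝ) - n| ≤ setDist (U n) (U m) ∧ setDist (U n) (U m) ≤ c * |(m : ℝ) - n|) ∧
    (∃ K : ℕ, ∀ n : ℤ, (K : ℤ) ≤ |n| →
      U n = Metric.closedBall ((n : ℂ) * (Real.pi : ℂ)) (Real.pi / 4))

/-- The complex neighbourhood `W` of `L2r`: the union of all open neighbourhoods of real type
states for which a common set of isolating neighbourhoods exists. -/
def W : Set L2c :=
  {ψ | ∃ φ ∈ L2r, ∃ V : Set L2c, IsOpen V ∧ φ ∈ V ∧ HasIsolatingDiscs V ∧ ψ ∈ V}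

end NLS

end

open MeasureTheory Filter Topology

noncomputable section

set_option linter.unusedSectionVars false

namespace NLS

/-! Expand a 2-periodic `f` as `f₋ = ∑ fm k · e^{-iπkx}`, `f₊ = ∑ fp k · e^{iπkx}`. Then `L(φ) f = z
f` becomes `(z - kπ) fm k = ∑ a (k+l) fp l`, `(z - kπ) fp k = ∑ b (k+l) fm l`, where `a`, `b` are
the coefficients of `φ₋`, `φ₊`. In the strip `|Re z - nπ| ≤ π/2` every factor `z - lπ` with `l ≠ n`
is invertible with inverse at most `(2/π)/|l-n|`, so all modes except the two with index `n` can be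
eliminated (Lyapunov-Schmidt reduction).

The elimination rests on `norm_cv_cv_le`: a single convolution is not small, but the twofold iterate
is of order `‖φ‖²/⟨n⟩` in the sup norm with weight `w (k+n)`. The linear factor of a weight in `𝓜¹`
produces the gain. For `⟨n⟩ ≥ 8‖φ‖²` the iterate contracts by `2/5`. What remains is a 2×2 problem
whose diagonal entries agree (`diag_symm`), so an eigenvalue satisfies `(z - nπ - d)² = h₁ n · h₂
n`, with `h₁ n`, `h₂ n` equal to `a (2n)`, `b (2n)` up to `O(‖φ‖³/(⟨n⟩ w (2n)))`. Since `d` is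
Lipschitz in `z` with constant `0.16`, comparing two eigenvalues of the strip bounds the gap
(`gap_le`). Summing with `∑_{|n|≥N} ⟨n⟩⁻² ≤ 4/⟨N⟩` gives the first estimate.

It remains to know that `λₙ^±` lie in strip `n`. Algebraic multiplicities are counted without
determinants: a fixed point argument gives an operator `Z` on `ℂ²` close to `nπ` and a `ℂ²`-valued
solution of `L(φ) F = Z F` (`exists_planeMap`). Functionals `y ↦ y ∘ F` carry the generalised
eigenspaces of the transpose of `Z` onto the root spaces of `L(φ)`; surjectivity (`dual_eq_zero`) is
a uniqueness statement on `ℂ² × ℂ`. Hence each far strip holds exactly two eigenvalues. As the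
asymptotics fix the numbering near infinity, an inward induction on strips fixes it for all `|n| ≥
N` (`Interlaced.close`).

For the second estimate, take the least admissible `N`. The gaps with `|n| < N` lie in disjoint
discs centred on the real axis, so their sum is at most the distance between `Re λ_{-N}⁻` and `Re
λ_N⁻`, which is at most `(2N + 1/2)π`. -/

/-! ### Cauchy-Schwarz sums over the integers. -/

/-- Cauchy-Schwarz for series of nonnegative terms. -/
theorem summable_mul_and_tsum_le {ι : Type*} {f g : ι → ℝ} (hf : ∀ i, 0 ≤ f i) (hg : ∀ i, 0 ≤ g i)
    (hf2 : Summable fun i => f i ^ 2) (hg2 : Summable fun i => g i ^ 2) :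
    Summable (fun i => f i * g i) ∧
      ∑' i, f i * g i ≤ √(∑' i, f i ^ 2) * √(∑' i, g i ^ 2) := by
  have h2 : (2 : ℝ).HolderConjugate 2 := Real.HolderConjugate.two_two
  have hf3 : Summable fun i => f i ^ (2 : ℝ) := by simpa using hf2
  have hg3 : Summable fun i => g i ^ (2 : ℝ) := by simpa using hg2
  refine ⟨Real.summable_mul_of_Lp_Lq_of_nonneg h2 hf hg hf3 hg3, ?_⟩
  simpa [Real.sqrt_eq_rpow] using Real.inner_le_Lp_mul_Lq_tsum_of_nonneg h2 hf hg hf3 hg3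

/-- The reciprocal distance of two integers, with the value `0` on the diagonal. -/
def invDist (n l : ℤ) : ℝ := |(l : ℝ) - n|⁻¹

theorem invDist_nonneg (n l : ℤ) : 0 ≤ invDist n l := inv_nonneg.2 (abs_nonneg _)

@[simp] theorem invDist_self (n : ℤ) : invDist n n = 0 := by simp [invDist]

theorem one_le_abs_sub {n l : ℤ} (h : l ≠ n) : 1 ≤ |(l : ℝ) - n| := by
  have : (1 : ℤ) ≤ |l - n| := Int.one_le_abs (sub_ne_zero.2 h)
  exact_mod_cast this

theorem invDist_le_one (n l : ℤ) : invDist n l ≤ 1 := by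
  by_cases h : l = n
  · simp [h]
  · exact inv_le_one_of_one_le₀ (one_le_abs_sub h)

theorem bracket_pos (x : ℝ) : 0 < bracket x := by unfold bracket; positivity

theorem one_le_bracket (x : ℝ) : 1 ≤ bracket x := by unfold bracket; linarith [abs_nonneg x]

theorem hasSum_inv_add_one_sq : HasSum (fun k : ℕ => ((k : ℝ) + 1)⁻¹ ^ 2) (Real.pi ^ 2 / 6) := by
  have := (hasSum_nat_add_iff' 1).2 hasSum_zeta_two
  simpa using this

theorem hasSum_inv_add_two_sq :
    HasSum (fun k : ℕ => ((k : ℝ) + 2)⁻¹ ^ 2) (Real.pi ^ 2 / 6 - 1) := by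
  have := (hasSum_nat_add_iff' 2).2 hasSum_zeta_two
  simpa [Finset.sum_range_succ] using this

theorem hasSum_invDist_sq : HasSum (fun l : ℤ => invDist 0 l ^ 2) (Real.pi ^ 2 / 3) := by
  have h1 : HasSum (fun k : ℕ => invDist 0 (k : ℤ) ^ 2) (Real.pi ^ 2 / 6) := by
    have e : (fun k : ℕ => invDist 0 (k : ℤ) ^ 2) = fun k : ℕ => 1 / (k : ℝ) ^ 2 := by
      funext k; simp [invDist]
    rw [e]; exact hasSum_zeta_two
  have h2 : HasSum (fun k : ℕ => invDist 0 (-((k : ℤ) + 1)) ^ 2) (Real.pi ^ 2 / 6) := by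
    have e : (fun k : ℕ => invDist 0 (-((k : ℤ) + 1)) ^ 2) = fun k : ℕ => ((k : ℝ) + 1)⁻¹ ^ 2 := by
      funext k
      have h : |((-((k : ℤ) + 1) : ℤ) : ℝ) - (0 : ℤ)| = (k : ℝ) + 1 := by
        push_cast
        rw [sub_zero, abs_neg, abs_of_nonneg (by positivity)]
      rw [invDist, h]
    rw [e]; exact hasSum_inv_add_one_sq
  have h3 := HasSum.of_nat_of_neg_add_one (f := fun l : ℤ => invDist 0 l ^ 2) h1 h2
  have e : Real.pi ^ 2 / 6 + Real.pi ^ 2 / 6 = Real.pi ^ 2 / 3 := by ring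
  rwa [e] at h3

theorem hasSum_bracket_inv_sq :
    HasSum (fun l : ℤ => (bracket l)⁻¹ ^ 2) (Real.pi ^ 2 / 3 - 1) := by
  have h1 : HasSum (fun k : ℕ => (bracket ((k : ℤ) : ℝ))⁻¹ ^ 2) (Real.pi ^ 2 / 6) := by
    have e : (fun k : ℕ => (bracket ((k : ℤ) : ℝ))⁻¹ ^ 2) = fun k : ℕ => ((k : ℝ) + 1)⁻¹ ^ 2 := by
      funext k
      have h : bracket ((k : ℤ) : ℝ) = k + 1 := by
        simp [bracket, add_comm]
      rw [h]
    rw [e]; exact hasSum_inv_add_one_sq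
  have h2 : HasSum (fun k : ℕ => (bracket ((-((k : ℤ) + 1) : ℤ) : ℝ))⁻¹ ^ 2)
      (Real.pi ^ 2 / 6 - 1) := by
    have e : (fun k : ℕ => (bracket ((-((k : ℤ) + 1) : ℤ) : ℝ))⁻¹ ^ 2) =
        fun k : ℕ => ((k : ℝ) + 2)⁻¹ ^ 2 := by
      funext k
      have h : bracket ((-((k : ℤ) + 1) : ℤ) : ℝ) = k + 2 := by
        unfold bracket
        push_cast
        rw [abs_neg, abs_of_nonneg (by positivity)]
        ring
      rw [h]
    rw [e]; exact hasSum_inv_add_two_sq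
  have h3 := HasSum.of_nat_of_neg_add_one (f := fun l : ℤ => (bracket l)⁻¹ ^ 2) h1 h2
  have e : Real.pi ^ 2 / 6 + (Real.pi ^ 2 / 6 - 1) = Real.pi ^ 2 / 3 - 1 := by ring
  rwa [e] at h3

theorem pi_sq_lt : Real.pi ^ 2 < 9.87 := by
  nlinarith [Real.pi_gt_d2, Real.pi_lt_d4]

variable {β : ℤ → ℝ}

theorem summable_shift {f : ℤ → ℝ} (hf : Summable f) (l : ℤ) : Summable fun m => f (l + m) :=
  (Equiv.addLeft l).summable_iff.2 hf

theorem tsum_shift (f : ℤ → ℝ) (l : ℤ) : ∑' m, f (l + m) = ∑' m, f m :=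
  (Equiv.addLeft l).tsum_eq f

/-- Cauchy-Schwarz against the exact sum `π²/3 - 1` of `⟨·⟩⁻²`, which is less than `1.52²`. -/
theorem sum_mul_bracket_inv (hβ : ∀ j, 0 ≤ β j) (hβ2 : Summable fun j => β j ^ 2) (l n : ℤ) :
    Summable (fun m : ℤ => β (l + m) * (bracket (m + n))⁻¹) ∧
      ∑' m : ℤ, β (l + m) * (bracket (m + n))⁻¹ ≤ 1.52 * √(∑' j, β j ^ 2) := by
  have hb : HasSum (fun m : ℤ => (bracket (m + n))⁻¹ ^ 2) (Real.pi ^ 2 / 3 - 1) := by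
    have := (Equiv.addLeft n).hasSum_iff.2 hasSum_bracket_inv_sq
    convert this using 2 with m
    simp [add_comm]
  obtain ⟨h1, h2⟩ := summable_mul_and_tsum_le (fun m => hβ (l + m))
    (fun m : ℤ => inv_nonneg.2 (bracket_pos (m + n)).le) (summable_shift hβ2 l) hb.summable
  refine ⟨h1, h2.trans ?_⟩
  rw [tsum_shift (fun j => β j ^ 2) l, hb.tsum_eq, mul_comm]
  gcongr
  rw [Real.sqrt_le_left (by norm_num)]
  linarith [pi_sq_lt]

/-- As before, with the sum `π²/3 < 1.82²` of the squared reciprocal distances. -/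
theorem sum_mul_invDist (hβ : ∀ j, 0 ≤ β j) (hβ2 : Summable fun j => β j ^ 2) (l n : ℤ) :
    Summable (fun m : ℤ => β (l + m) * invDist n m) ∧
      ∑' m : ℤ, β (l + m) * invDist n m ≤ 1.82 * √(∑' j, β j ^ 2) := by
  have hb : HasSum (fun m : ℤ => invDist n m ^ 2) (Real.pi ^ 2 / 3) := by
    have := (Equiv.addLeft (-n)).hasSum_iff.2 hasSum_invDist_sq
    convert this using 2 with m
    simp only [Function.comp, Equiv.coe_addLeft, invDist]
    push_cast
    ring_nf
  obtain ⟨h1, h2⟩ := summable_mul_and_tsum_le (fun m => hβ (l + m))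
    (fun m : ℤ => invDist_nonneg n m) (summable_shift hβ2 l) hb.summable
  refine ⟨h1, h2.trans ?_⟩
  rw [tsum_shift (fun j => β j ^ 2) l, hb.tsum_eq, mul_comm]
  gcongr
  rw [Real.sqrt_le_left (by norm_num)]
  linarith [pi_sq_lt]

/-! ### The kernel of the twofold iterate and admissible weights. -/

/-- The majorant of the kernel of the iterated operator, after extraction of the factor
`1 / ⟨n⟩`. -/
def kernelMajorant (n k l m : ℤ) : ℝ :=
  invDist n l * (bracket (m + l))⁻¹ + (bracket (l + k))⁻¹ *
    ((bracket (m + n))⁻¹ + 2 * invDist n m + 2 * (bracket (m + l))⁻¹)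

/-- Weights `u` for which the twofold iterate of the reduced operator is small of order
`1 / ⟨n⟩`. -/
def Admissible (w : ℤ → ℝ) (n : ℤ) (u : ℤ → ℝ) : Prop :=
  (∀ k, 1 ≤ u k) ∧ ∀ k l m, l ≠ n → m ≠ n →
    bracket n * u k * (invDist n l * invDist n m) ≤
      w (k + l) * w (l + m) * u m * kernelMajorant n k l m

/-- Here `A = ⟨l+k⟩`, `B = ⟨m+l⟩`, `C = ⟨m+n⟩`, `L = |l-n|`, `M = |m-n|`, `N = ⟨n⟩`. The fraction
splits as `1/(BC) + 1/(AC) + 1/(AB)`, and each piece absorbs `N` by a different triangle inequality: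
`N ≤ CM`, `N ≤ C + M`, `N ≤ B + L + M`. -/
theorem bracket_mul_le (A B C L M N : ℝ) (hA : 1 ≤ A) (hB : 1 ≤ B) (hC : 1 ≤ C) (hL : 1 ≤ L)
    (hM : 1 ≤ M) (hCM : N ≤ C + M - 0) (hBLM : N ≤ B + L + M) (hCM' : N ≤ C * M) :
    N * ((A + B + C) / (A * B * C)) * (L⁻¹ * M⁻¹) ≤
      L⁻¹ * B⁻¹ + A⁻¹ * (C⁻¹ + 2 * M⁻¹ + 2 * B⁻¹) := by
  have e : N * ((A + B + C) / (A * B * C)) * (L⁻¹ * M⁻¹)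
      = (N / (C * M)) * (L⁻¹ * B⁻¹) + A⁻¹ * L⁻¹ * (N / (C * M)) + A⁻¹ * (N / (B * L * M)) := by
    field_simp
  have h1 : N / (C * M) ≤ 1 := (div_le_one (by positivity)).2 hCM'
  have h2 : N / (C * M) ≤ C⁻¹ + M⁻¹ := by
    rw [div_le_iff₀ (by positivity)]
    have : (C⁻¹ + M⁻¹) * (C * M) = C + M := by field_simp; ring
    linarith
  have h3 : N / (B * L * M) ≤ (L * M)⁻¹ + (B * M)⁻¹ + (B * L)⁻¹ := by
    rw [div_le_iff₀ (by positivity)]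
    have : ((L * M)⁻¹ + (B * M)⁻¹ + (B * L)⁻¹) * (B * L * M) = B + L + M := by field_simp
    linarith
  have i1 : (L * M)⁻¹ ≤ M⁻¹ := inv_anti₀ (by positivity) (by nlinarith)
  have i2 : (B * M)⁻¹ ≤ B⁻¹ := inv_anti₀ (by positivity) (by nlinarith)
  have i3 : (B * L)⁻¹ ≤ B⁻¹ := inv_anti₀ (by positivity) (by nlinarith)
  have i4 : L⁻¹ ≤ 1 := inv_le_one_of_one_le₀ hL
  have j1 : (N / (C * M)) * (L⁻¹ * B⁻¹) ≤ 1 * (L⁻¹ * B⁻¹) := by gcongr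
  have j2 : A⁻¹ * L⁻¹ * (N / (C * M)) ≤ A⁻¹ * (C⁻¹ + M⁻¹) := by
    calc A⁻¹ * L⁻¹ * (N / (C * M)) ≤ A⁻¹ * L⁻¹ * (C⁻¹ + M⁻¹) := by gcongr
      _ ≤ A⁻¹ * 1 * (C⁻¹ + M⁻¹) := by gcongr
      _ = _ := by ring
  have j3 : A⁻¹ * (N / (B * L * M)) ≤ A⁻¹ * (M⁻¹ + 2 * B⁻¹) := by
    gcongr; linarith
  rw [e]
  have : A⁻¹ * (C⁻¹ + 2 * M⁻¹ + 2 * B⁻¹) = A⁻¹ * (C⁻¹ + M⁻¹) + A⁻¹ * (M⁻¹ + 2 * B⁻¹) := by ring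
  linarith

theorem bracket_facts (n k l m : ℤ) (hl : l ≠ n) (hm : m ≠ n) :
    bracket n * ((bracket (l + k) + bracket (m + l) + bracket (m + n)) /
      (bracket (l + k) * bracket (m + l) * bracket (m + n))) * (invDist n l * invDist n m) ≤
      kernelMajorant n k l m := by
  have hM := one_le_abs_sub hm
  have hL := one_le_abs_sub hl
  have t1 : 2 * |(n : ℝ)| ≤ |(m : ℝ) + n| + |(m : ℝ) - n| := by
    have := abs_sub ((m : ℝ) + n) ((m : ℝ) - n)
    have e : (m : ℝ) + n - (m - n) = 2 * n := by ring
    rw [e, abs_mul, abs_two] at this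
    exact this
  have t2 : 2 * |(n : ℝ)| ≤ |(m : ℝ) + l| + |(l : ℝ) - n| + |(m : ℝ) - n| := by
    have h1 := abs_sub ((m : ℝ) + l) ((l : ℝ) - n)
    have h2 := abs_sub ((m : ℝ) + n) ((m : ℝ) - n)
    have e : (m : ℝ) + l - (l - n) = m + n := by ring
    rw [e] at h1
    linarith
  have p := abs_nonneg ((m : ℝ) + n)
  -- `⟨n⟩ ≤ ⟨m+n⟩|m-n|` needs integrality: the product is at least `|m+n| + |m-n| ≥ 2|n|`, which
  -- dominates `1 + |n|` only if `|n| ≥ 1`; for `n = 0` it suffices that the product is at least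
  -- `1`.
  have hint : |(n : ℝ)| = 0 ∨ 1 ≤ |(n : ℝ)| := by
    by_cases h : n = 0
    · left; simp [h]
    · right
      have : (1 : ℤ) ≤ |n| := Int.one_le_abs h
      exact_mod_cast this
  refine bracket_mul_le _ _ _ _ _ _ (one_le_bracket _) (one_le_bracket _) (one_le_bracket _)
    hL hM ?_ ?_ ?_
  · unfold bracket; linarith [abs_nonneg (n : ℝ)]
  · unfold bracket; linarith [abs_nonneg (n : ℝ)]
  · unfold bracket
    rcases hint with h | h
    · rw [h]; nlinarith
    · nlinarith

variable {w : ℤ → ℝ}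

theorem bracket_le_of_weightsOne (hw : w ∈ weightsOne) (k : ℤ) : bracket k ≤ w k := by
  obtain ⟨-, v, hv, e⟩ := hw
  rw [e]
  exact le_mul_of_one_le_right (bracket_pos _).le (hv.1 k)

theorem bracket_add_le (n k l m : ℤ) :
    bracket (k + n) ≤ bracket (l + k) + bracket (m + l) + bracket (m + n) := by
  unfold bracket
  have h1 := abs_sub ((l : ℝ) + k) ((m : ℝ) + l)
  have h2 := abs_add_le (((l : ℝ) + k) - ((m : ℝ) + l)) ((m : ℝ) + n)
  have e : ((l : ℝ) + k) - ((m : ℝ) + l) + ((m : ℝ) + n) = k + n := by ring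
  rw [e] at h2
  linarith

theorem kernelMajorant_nonneg (n k l m : ℤ) : 0 ≤ kernelMajorant n k l m := by
  have h1 := invDist_nonneg n l
  have h2 := invDist_nonneg n m
  have h3 := bracket_pos ((m : ℝ) + l)
  have h4 := bracket_pos ((l : ℝ) + k)
  have h5 := bracket_pos ((m : ℝ) + n)
  unfold kernelMajorant
  positivity

/-- Write `k + n = (k+l) - (l+m) + (m+n)`. The factor `v` is submultiplicative, whereas the linear
factor is subadditive: a sum of three brackets replaces their product, and this quotient is the gain
measured by `bracket_facts`. -/
theorem admissible_shift (hw : w ∈ weightsOne) (n : ℤ) : Admissible w n fun k => w (k + n) := by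
  obtain ⟨hw1, v, hv, e⟩ := hw
  refine ⟨fun k => hw1.1 _, fun k l m hl hm => ?_⟩
  have hb := bracket_facts n k l m hl hm
  have hv1 : v (k + n) ≤ v (k + l) * v (l + m) * v (m + n) := by
    have h1 := hv.2.2.1 (k + l) (-(l + m) + (m + n))
    have h2 := hv.2.2.1 (-(l + m)) (m + n)
    rw [← hv.2.1] at h2
    have e1 : k + l + (-(l + m) + (m + n)) = k + n := by ring
    rw [e1] at h1
    have := hv.1 (k + l)
    nlinarith
  have c1 : bracket ((k + l : ℤ) : ℝ) = bracket (l + k) := by push_cast; rw [add_comm]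
  have c2 : bracket ((l + m : ℤ) : ℝ) = bracket (m + l) := by push_cast; rw [add_comm]
  have c3 : bracket ((m + n : ℤ) : ℝ) = bracket (m + n) := by push_cast; rfl
  have c4 : bracket ((k + n : ℤ) : ℝ) = bracket (k + n) := by push_cast; rfl
  have hv0 : ∀ j, 0 < v j := fun j => zero_lt_one.trans_le (hv.1 j)
  have hA := bracket_pos ((l : ℝ) + k)
  have hB := bracket_pos ((m : ℝ) + l)
  have hC := bracket_pos ((m : ℝ) + n)
  simp only [e]
  rw [c1, c2, c3, c4]
  have hD := mul_nonneg (invDist_nonneg n l) (invDist_nonneg n m)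
  calc bracket n * (bracket (k + n) * v (k + n)) * (invDist n l * invDist n m)
      ≤ bracket n * ((bracket (l + k) + bracket (m + l) + bracket (m + n)) *
          (v (k + l) * v (l + m) * v (m + n))) * (invDist n l * invDist n m) := by
        have := (bracket_pos (n : ℝ)).le
        have := (hv0 (k + n)).le
        have := bracket_add_le n k l m
        gcongr
    _ = (bracket (l + k) * v (k + l) * (bracket (m + l) * v (l + m)) *
          (bracket (m + n) * v (m + n))) * (bracket n * ((bracket (l + k) + bracket (m + l) +
          bracket (m + n)) / (bracket (l + k) * bracket (m + l) * bracket (m + n))) *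
          (invDist n l * invDist n m)) := by
        field_simp
    _ ≤ _ := by
        have := hv0 (k + l)
        have := hv0 (l + m)
        have := hv0 (m + n)
        gcongr

/-- The unweighted sup norm is admissible too. This is what yields uniqueness among merely bounded
solutions and contraction in an ordinary space of bounded functions. -/
theorem admissible_one (hw : w ∈ weightsOne) (n : ℤ) : Admissible w n fun _ => 1 := by
  refine ⟨fun _ => le_rfl, fun k l m hl hm => ?_⟩
  have hb := bracket_facts n k l m hl hm
  have hA := one_le_bracket ((l : ℝ) + k)
  have hB := one_le_bracket ((m : ℝ) + l)
  have hC := one_le_bracket ((m : ℝ) + n)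
  have hA' : bracket (l + k) ≤ w (k + l) := by
    have := bracket_le_of_weightsOne hw (k + l)
    push_cast at this
    rwa [add_comm] at this
  have hB' : bracket (m + l) ≤ w (l + m) := by
    have := bracket_le_of_weightsOne hw (l + m)
    push_cast at this
    rwa [add_comm] at this
  have hD := mul_nonneg (invDist_nonneg n l) (invDist_nonneg n m)
  have hn := (bracket_pos (n : ℝ)).le
  have h1 : 1 ≤ (bracket (l + k) * bracket (m + l)) *
      ((bracket (l + k) + bracket (m + l) + bracket (m + n)) /
      (bracket (l + k) * bracket (m + l) * bracket (m + n))) := by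
    rw [mul_div_assoc', le_div_iff₀ (by positivity)]
    have : 0 < bracket (l + k) * bracket (m + l) := by positivity
    nlinarith
  have hK := kernelMajorant_nonneg n k l m
  calc bracket n * 1 * (invDist n l * invDist n m)
      ≤ bracket n * ((bracket (l + k) * bracket (m + l)) *
      ((bracket (l + k) + bracket (m + l) + bracket (m + n)) /
      (bracket (l + k) * bracket (m + l) * bracket (m + n)))) * (invDist n l * invDist n m) := by
        gcongr
    _ = (bracket (l + k) * bracket (m + l)) * (bracket n * (((bracket (l + k) + bracket (m + l) +
          bracket (m + n)) / (bracket (l + k) * bracket (m + l) * bracket (m + n)))) *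
          (invDist n l * invDist n m)) := by ring
    _ ≤ (bracket (l + k) * bracket (m + l)) * kernelMajorant n k l m := by gcongr
    _ ≤ w (k + l) * w (l + m) * 1 * kernelMajorant n k l m := by
        rw [mul_one]
        have : 0 ≤ w (k + l) := by linarith
        gcongr

/-! ### Discrete convolution operators in weighted sup norms. -/

/-- Square summability of a sequence with respect to a weight. -/
def WSummable (w : ℤ → ℝ) (a : ℤ → ℂ) : Prop := Summable fun j => (w j * ‖a j‖) ^ 2

/-- The weighted `ℓ²` norm of a sequence. -/
def coefNorm (w : ℤ → ℝ) (a : ℤ → ℂ) : ℝ := √(∑' j, (w j * ‖a j‖) ^ 2)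

theorem coefNorm_nonneg (w : ℤ → ℝ) (a : ℤ → ℂ) : 0 ≤ coefNorm w a := Real.sqrt_nonneg _

section operators

variable {X Y E : Type*} [NormedAddCommGroup X] [NormedSpace ℂ X] [NormedAddCommGroup Y]
  [NormedSpace ℂ Y] [CompleteSpace Y] [NormedAddCommGroup E] [NormedSpace ℂ E] [CompleteSpace E]
  {w : ℤ → ℝ} {a b : ℤ → ℂ} {n : ℤ} {c c' M : ℝ}

/-- The discrete operator `(cv a R h)_k = ∑_l a_{k+l} R_l h_l`. -/
def cv (a : ℤ → ℂ) (R : ℤ → X →L[ℂ] Y) (h : ℤ → X) (k : ℤ) : Y := ∑' l, a (k + l) • R l (h l)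

theorem weight_pos (hw : w ∈ weightsOne) (j : ℤ) : 0 < w j :=
  zero_lt_one.trans_le (hw.1.1 j)

theorem norm_term_le {R : ℤ → X →L[ℂ] Y} (hR : ∀ l, ‖R l‖ ≤ c * invDist n l) {h : ℤ → X} {l : ℤ}
    {m : ℝ} (hm : ‖h l‖ ≤ m) (k : ℤ) :
    ‖a (k + l) • R l (h l)‖ ≤ ‖a (k + l)‖ * (c * invDist n l * m) := by
  rw [norm_smul]
  gcongr
  exact ((R l).le_opNorm _).trans (mul_le_mul (hR l) hm (norm_nonneg _)
    ((norm_nonneg _).trans (hR l)))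

theorem norm_le_weight_mul (hw : w ∈ weightsOne) (j : ℤ) : ‖a j‖ ≤ w j * ‖a j‖ :=
  le_mul_of_one_le_left (norm_nonneg _) (hw.1.1 j)

theorem weighted_nonneg (hw : w ∈ weightsOne) (a : ℤ → ℂ) (j : ℤ) : 0 ≤ w j * ‖a j‖ :=
  mul_nonneg (weight_pos hw j).le (norm_nonneg _)

theorem nonneg_of_bound {R : ℤ → X →L[ℂ] Y} (hR : ∀ l, ‖R l‖ ≤ c * invDist n l) : 0 ≤ c := by
  have := (norm_nonneg _).trans (hR (n + 1))
  have e : invDist n (n + 1) = 1 := by simp [invDist]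
  rwa [e, mul_one] at this

theorem cv_summable (hw : w ∈ weightsOne) (ha : WSummable w a) {R : ℤ → X →L[ℂ] Y}
    (hR : ∀ l, ‖R l‖ ≤ c * invDist n l) {h : ℤ → X} (hh : ∀ l, ‖h l‖ ≤ M) (k : ℤ) :
    Summable fun l => a (k + l) • R l (h l) := by
  have h1 := (sum_mul_invDist (weighted_nonneg hw a) ha k n).1
  have hc := nonneg_of_bound hR
  have hM : 0 ≤ M := (norm_nonneg _).trans (hh 0)
  refine Summable.of_norm_bounded (h1.mul_right (c * M)) fun l => ?_
  refine (norm_term_le hR (hh l) k).trans ?_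
  have := norm_le_weight_mul (a := a) hw (k + l)
  have := invDist_nonneg n l
  calc ‖a (k + l)‖ * (c * invDist n l * M) ≤ (w (k + l) * ‖a (k + l)‖) * (c * invDist n l * M) := by
        gcongr
    _ = _ := by ring

theorem norm_cv_le_tsum {R : ℤ → X →L[ℂ] Y} {h : ℤ → X} {k : ℤ} {g : ℤ → ℝ} (hg : Summable g)
    (hle : ∀ l, ‖a (k + l) • R l (h l)‖ ≤ g l) : ‖cv a R h k‖ ≤ ∑' l, g l :=
  tsum_of_norm_bounded hg.hasSum hle

theorem norm_cv_le (hw : w ∈ weightsOne) (ha : WSummable w a) {R : ℤ → X →L[ℂ] Y}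
    (hR : ∀ l, ‖R l‖ ≤ c * invDist n l) {h : ℤ → X} (hh : ∀ l, ‖h l‖ ≤ M) (k : ℤ) :
    ‖cv a R h k‖ ≤ 1.82 * coefNorm w a * (c * M) := by
  have h1 := sum_mul_invDist (weighted_nonneg hw a) ha k n
  have hc := nonneg_of_bound hR
  have hM : 0 ≤ M := (norm_nonneg _).trans (hh 0)
  refine (norm_cv_le_tsum (h1.1.mul_right (c * M)) fun l => ?_).trans ?_
  · refine (norm_term_le hR (hh l) k).trans ?_
    have := norm_le_weight_mul (a := a) hw (k + l)
    have := invDist_nonneg n l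
    calc ‖a (k + l)‖ * (c * invDist n l * M) ≤
          (w (k + l) * ‖a (k + l)‖) * (c * invDist n l * M) := by gcongr
      _ = _ := by ring
  · rw [tsum_mul_right]
    have := h1.2
    unfold coefNorm
    gcongr

/-- The reduced operator reflects the shifted weight. -/
theorem norm_cv_mul_weight_le (hw : w ∈ weightsOne) (ha : WSummable w a) {R : ℤ → X →L[ℂ] Y}
    (hR : ∀ l, ‖R l‖ ≤ c * invDist n l) {h : ℤ → X} (hh : ∀ l, ‖h l‖ * w (l + n) ≤ M) (k : ℤ) :
    ‖cv a R h k‖ * w (k - n) ≤ 1.82 * coefNorm w a * (c * M) := by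
  have h1 := sum_mul_invDist (weighted_nonneg hw a) ha k n
  have hc := nonneg_of_bound hR
  have hM : 0 ≤ M := (mul_nonneg (norm_nonneg _) (weight_pos hw _).le).trans (hh 0)
  rw [← le_div_iff₀ (weight_pos hw _)]
  refine (norm_cv_le_tsum (h1.1.mul_right (c * M / w (k - n))) fun l => ?_).trans ?_
  · have hl : ‖h l‖ ≤ M / w (l + n) := (le_div_iff₀ (weight_pos hw _)).2 (hh l)
    refine (norm_term_le hR hl k).trans ?_
    have p1 := weight_pos hw (k - n)
    have p2 := weight_pos hw (l + n)
    have hsub : w (k - n) ≤ w (k + l) * w (l + n) := by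
      have := hw.1.2.2.1 (k + l) (-(l + n))
      rw [← hw.1.2.1] at this
      have e : k + l + -(l + n) = k - n := by ring
      rwa [e] at this
    have hd := invDist_nonneg n l
    have e1 : ‖a (k + l)‖ * (c * invDist n l * (M / w (l + n))) =
      (‖a (k + l)‖ * (c * invDist n l * M)) / w (l + n) := by ring
    have e2 : w (k + l) * ‖a (k + l)‖ * invDist n l * (c * M / w (k - n)) =
      (w (k + l) * (‖a (k + l)‖ * (c * invDist n l * M))) / w (k - n) := by ring
    rw [e1, e2, div_le_div_iff₀ p2 p1]
    have : 0 ≤ ‖a (k + l)‖ * (c * invDist n l * M) := by positivity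
    nlinarith
  · rw [tsum_mul_right, mul_div_assoc']
    have p1 := weight_pos hw (k - n)
    have := h1.2
    unfold coefNorm
    gcongr

/-- On the critical index the reduced operator gains a factor `1 / ⟨n⟩`. -/
theorem norm_cv_self_le (hw : w ∈ weightsOne) (ha : WSummable w a) {R : ℤ → X →L[ℂ] Y}
    (hR : ∀ l, ‖R l‖ ≤ c * invDist n l) {h : ℤ → X} (hh : ∀ l, ‖h l‖ * w (l + n) ≤ M) :
    ‖cv a R h n‖ ≤ 1.52 * coefNorm w a * (c * M / bracket n) := by
  have h1 := sum_mul_bracket_inv (weighted_nonneg hw a) ha n n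
  have hc := nonneg_of_bound hR
  have hM : 0 ≤ M := (mul_nonneg (norm_nonneg _) (weight_pos hw _).le).trans (hh 0)
  have hn := bracket_pos (n : ℝ)
  refine (norm_cv_le_tsum (h1.1.mul_right (c * M / bracket n)) fun l => ?_).trans ?_
  · have hl : ‖h l‖ ≤ M / w (l + n) := (le_div_iff₀ (weight_pos hw _)).2 (hh l)
    refine (norm_term_le hR hl n).trans ?_
    have hB := one_le_bracket ((l : ℝ) + n)
    have hBw : bracket (l + n) ≤ w (l + n) := by
      have := bracket_le_of_weightsOne hw (l + n)
      push_cast at this; exact this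
    have hBw' : bracket (l + n) ≤ w (n + l) := by rwa [add_comm n l]
    -- For `l ≠ n` this is `⟨n⟩ ≤ ⟨l+n⟩|l-n|`; for `l = n` the left side is `0` by convention. The
    -- weight of `h` supplies one power of `⟨l+n⟩` and the weight of `a` another, which pays for the
    -- summation.
    have key : invDist n l ≤ bracket (l + n) * (bracket n)⁻¹ := by
      by_cases hln : l = n
      · subst hln; simp; positivity
      · have hL := one_le_abs_sub hln
        unfold invDist
        rw [← div_eq_mul_inv, le_div_iff₀ hn, inv_mul_le_iff₀ (by positivity)]
        have t1 : 2 * |(n : ℝ)| ≤ |(l : ℝ) + n| + |(l : ℝ) - n| := by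
          have := abs_sub ((l : ℝ) + n) ((l : ℝ) - n)
          have e : (l : ℝ) + n - (l - n) = 2 * n := by ring
          rw [e, abs_mul, abs_two] at this
          exact this
        have hint : |(n : ℝ)| = 0 ∨ 1 ≤ |(n : ℝ)| := by
          by_cases h : n = 0
          · left; simp [h]
          · right
            have : (1 : ℤ) ≤ |n| := Int.one_le_abs h
            exact_mod_cast this
        have := abs_nonneg ((l : ℝ) + n)
        unfold bracket
        rcases hint with h | h
        · rw [h]; nlinarith
        · nlinarith
    have hB0 : 0 < bracket ((l : ℝ) + n) := by linarith
    have hMw : 0 ≤ M / w (l + n) := div_nonneg hM (weight_pos hw _).le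
    calc ‖a (n + l)‖ * (c * invDist n l * (M / w (l + n)))
        ≤ ‖a (n + l)‖ * (c * (bracket (l + n) * (bracket n)⁻¹) * (M / bracket (l + n))) := by
          gcongr
      _ = bracket (l + n) * ‖a (n + l)‖ * (bracket (l + n))⁻¹ * (c * M / bracket n) := by
          field_simp
      _ ≤ w (n + l) * ‖a (n + l)‖ * (bracket (l + n))⁻¹ * (c * M / bracket n) := by
          gcongr
  · rw [tsum_mul_right]
    have := h1.2
    unfold coefNorm
    gcongr

/-- The inner sum of the twofold iterate, taken term by term in the majorant: `8.2 = 1.52 + 2 · 1.82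
+ 2 · 1.52`. -/
theorem tsum_kernelMajorant_le {α β : ℤ → ℝ} (hα : ∀ j, 0 ≤ α j) (hβ : ∀ j, 0 ≤ β j)
    (hβ2 : Summable fun j => β j ^ 2) (n k l : ℤ) :
    Summable (fun m => α (k + l) * (β (l + m) * kernelMajorant n k l m)) ∧
    ∑' m, α (k + l) * (β (l + m) * kernelMajorant n k l m) ≤
      (α (k + l) * invDist n l * 1.52 + α (k + l) * (bracket (l + k))⁻¹ * 8.2) *
        √(∑' j, β j ^ 2) := by
  have s1 := sum_mul_bracket_inv hβ hβ2 l l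
  have s2 := sum_mul_bracket_inv hβ hβ2 l n
  have s3 := sum_mul_invDist hβ hβ2 l n
  set B := √(∑' j, β j ^ 2)
  have hs := ((((s1.1.hasSum.mul_left (invDist n l)).add (((s2.1.hasSum.add
    (s3.1.hasSum.mul_left 2)).add (s1.1.hasSum.mul_left 2)).mul_left (bracket (l + k))⁻¹)))).mul_left
      (α (k + l))
  have e : (fun m => α (k + l) * (β (l + m) * kernelMajorant n k l m)) = fun m : ℤ =>
      α (k + l) * (invDist n l * (β (l + m) * (bracket (m + l))⁻¹) + (bracket (l + k))⁻¹ *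
      (β (l + m) * (bracket (m + n))⁻¹ + 2 * (β (l + m) * invDist n m) +
        2 * (β (l + m) * (bracket (m + l))⁻¹))) := by
    funext m; unfold kernelMajorant; ring
  rw [e]
  refine ⟨hs.summable, ?_⟩
  rw [hs.tsum_eq]
  have h0 := hα (k + l)
  have h1 := invDist_nonneg n l
  have h2 := bracket_pos ((l : ℝ) + k)
  calc _ ≤ α (k + l) * (invDist n l * (1.52 * B) + (bracket (l + k))⁻¹ *
        (1.52 * B + 2 * (1.82 * B) + 2 * (1.52 * B))) := by
        gcongr
        · exact s1.2
        · exact s2.2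
        · exact s3.2
        · exact s1.2
    _ = α (k + l) * (invDist n l * (1.52 * B) + (bracket (l + k))⁻¹ * (8.2 * B)) := by ring
    _ = _ := by ring

/-- The twofold iterate is small of order `1 / ⟨n⟩` in every admissible supremum norm. -/
theorem norm_cv_cv_le (hw : w ∈ weightsOne) (ha : WSummable w a) (hb : WSummable w b)
    {u : ℤ → ℝ} (hu : Admissible w n u) {R : ℤ → Y →L[ℂ] E} {S : ℤ → X →L[ℂ] Y}
    (hR : ∀ l, ‖R l‖ ≤ c * invDist n l) (hS : ∀ l, ‖S l‖ ≤ c' * invDist n l)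
    {h : ℤ → X} (hh : ∀ l, ‖h l‖ * u l ≤ M) (k : ℤ) :
    ‖cv a R (cv b S h) k‖ * u k ≤ 15.3 * (coefNorm w a * coefNorm w b) * (c * c' * M) / bracket n := by
  set α : ℤ → ℝ := fun j => w j * ‖a j‖ with hα
  set β : ℤ → ℝ := fun j => w j * ‖b j‖ with hβ
  have hα0 : ∀ j, 0 ≤ α j := weighted_nonneg hw a
  have hβ0 : ∀ j, 0 ≤ β j := weighted_nonneg hw b
  have hc := nonneg_of_bound hR
  have hc' := nonneg_of_bound hS
  have hu0 : ∀ j, 0 < u j := fun j => zero_lt_one.trans_le (hu.1 j)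
  have hM : 0 ≤ M := (mul_nonneg (norm_nonneg _) (hu0 0).le).trans (hh 0)
  have hn := bracket_pos (n : ℝ)
  have hK := fun l => tsum_kernelMajorant_le hα0 hβ0 hb n k l
  have hinner : ∀ l, ‖a (k + l)‖ * (c * invDist n l) * ‖cv b S h l‖ ≤
      (α (k + l) * invDist n l * 1.52 + α (k + l) * (bracket (l + k))⁻¹ * 8.2) *
        (coefNorm w b * (c * c' * M / bracket n / u k)) := by
    intro l
    by_cases hl : l = n
    · subst hl
      rw [invDist_self]
      have h2 := bracket_pos ((l : ℝ) + k)
      have := hα0 (k + l)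
      have := coefNorm_nonneg w b
      have := hu0 k
      simp only [mul_zero, zero_mul]
      positivity
    have hc0 : 0 ≤ ‖a (k + l)‖ * (c * invDist n l) := by
      have := invDist_nonneg n l
      positivity
    -- The kernel estimate involves both resolvent factors at once, so the bound for the inner sum
    -- is divided by the outer factor, which therefore has to be nonzero.
    rcases hc0.eq_or_lt with h0 | hpos
    · rw [← h0, zero_mul]
      have h2 := bracket_pos ((l : ℝ) + k)
      have := hα0 (k + l)
      have := coefNorm_nonneg w b
      have := hu0 k
      have := invDist_nonneg n l
      positivity
    have hb1 : ‖cv b S h l‖ ≤ ∑' m, (α (k + l) * (β (l + m) * kernelMajorant n k l m)) *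
        ((c * c' * M / bracket n / u k) / (‖a (k + l)‖ * (c * invDist n l))) := by
      refine norm_cv_le_tsum ((hK l).1.mul_right _) fun m => ?_
      have hm : ‖h m‖ ≤ M / u m := (le_div_iff₀ (hu0 m)).2 (hh m)
      refine (norm_term_le hS hm l).trans ?_
      by_cases hmn : m = n
      · subst hmn
        rw [invDist_self, mul_zero, zero_mul, mul_zero]
        have := kernelMajorant_nonneg m k l m
        have := hα0 (k + l)
        have := hβ0 (l + m)
        have := hu0 k
        positivity
      have hK0 := mul_div_assoc (α (k + l) * (β (l + m) * kernelMajorant n k l m))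
      rw [← hK0, le_div_iff₀ hpos, ← hK0, le_div_iff₀ (hu0 k), ← hK0, le_div_iff₀ hn]
      have hadm := hu.2 k l m hl hmn
      have hum := hu0 m
      have hq : 0 ≤ ‖a (k + l)‖ * ‖b (l + m)‖ * (c * c' * (M / u m)) := by positivity
      have := mul_le_mul_of_nonneg_left hadm hq
      calc _ = ‖a (k + l)‖ * ‖b (l + m)‖ * (c * c' * (M / u m)) *
            (bracket n * u k * (invDist n l * invDist n m)) := by ring
        _ ≤ _ := this
        _ = (‖a (k + l)‖ * ‖b (l + m)‖ * (c * c') * (w (k + l) * w (l + m) *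
            kernelMajorant n k l m)) * (M / u m * u m) := by ring
        _ = (‖a (k + l)‖ * ‖b (l + m)‖ * (c * c') * (w (k + l) * w (l + m) *
            kernelMajorant n k l m)) * M := by rw [div_mul_cancel₀ _ hum.ne']
        _ = _ := by simp only [hα, hβ]; ring
    rw [tsum_mul_right] at hb1
    have hq : 0 ≤ c * c' * M / bracket n / u k := by
      have := hu0 k
      positivity
    calc ‖a (k + l)‖ * (c * invDist n l) * ‖cv b S h l‖
        ≤ ‖a (k + l)‖ * (c * invDist n l) *
          ((∑' m, α (k + l) * (β (l + m) * kernelMajorant n k l m)) *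
          ((c * c' * M / bracket n / u k) / (‖a (k + l)‖ * (c * invDist n l)))) := by gcongr
      _ = (∑' m, α (k + l) * (β (l + m) * kernelMajorant n k l m)) *
          (c * c' * M / bracket n / u k) := by
          rw [mul_left_comm, mul_div_cancel₀ _ hpos.ne']
      _ ≤ _ := by
          rw [← mul_assoc]
          gcongr
          exact (hK l).2
  have s1 := sum_mul_invDist hα0 ha k n
  have s2 := sum_mul_bracket_inv hα0 ha k k
  have hs := ((s1.1.hasSum.mul_right 1.52).add (s2.1.hasSum.mul_right 8.2)).mul_right
    (coefNorm w b * (c * c' * M / bracket n / u k))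
  have hfin : ‖cv a R (cv b S h) k‖ ≤ _ := norm_cv_le_tsum hs.summable fun l =>
    (norm_term_le hR (le_refl ‖cv b S h l‖) k).trans
      ((mul_assoc _ _ _).symm.le.trans (hinner l))
  rw [hs.tsum_eq] at hfin
  rw [← le_div_iff₀ (hu0 k)]
  refine hfin.trans ?_
  -- The outer sum contributes `1.82 · 1.52 + 1.52 · 8.2 < 15.3`.
  have h3 : (∑' m, α (k + m) * invDist n m) * 1.52 + (∑' m : ℤ, α (k + m) * (bracket (m + k))⁻¹) * 8.2
      ≤ 15.3 * coefNorm w a := by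
    have e1 := s1.2
    have e2 := s2.2
    have e3 : √(∑' j, α j ^ 2) = coefNorm w a := rfl
    rw [e3] at e1 e2
    have := coefNorm_nonneg w a
    linarith
  have hq : 0 ≤ coefNorm w b * (c * c' * M / bracket n / u k) := by
    have := hu0 k
    have := coefNorm_nonneg w b
    positivity
  calc _ ≤ 15.3 * coefNorm w a * (coefNorm w b * (c * c' * M / bracket n / u k)) := by gcongr
    _ = _ := by ring

end operators

/-! ### The one-sided reduced equation: solvability, size and dependence on the resolvent. -/

/-- The smallness condition under which the strip number `n` is separated. -/
structure Small (w : ℤ → ℝ) (a b : ℤ → ℂ) (n : ℤ) : Prop where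
  weight : w ∈ weightsOne
  left : WSummable w a
  right : WSummable w b
  small : 8 * (coefNorm w a ^ 2 + coefNorm w b ^ 2) ≤ bracket n

section half

variable {X : Type*} [NormedAddCommGroup X] [NormedSpace ℂ X] [CompleteSpace X]
  {w : ℤ → ℝ} {a b : ℤ → ℂ} {n : ℤ} {M δ : ℝ} {R R' : ℤ → X →L[ℂ] X} {h h' s : ℤ → X}

theorem Small.symm (hs : Small w a b n) : Small w b a n :=
  ⟨hs.weight, hs.right, hs.left, by rw [add_comm]; exact hs.small⟩

theorem Small.mul_le (hs : Small w a b n) : 16 * (coefNorm w a * coefNorm w b) ≤ bracket n := by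
  nlinarith [hs.small, sq_nonneg (coefNorm w a - coefNorm w b)]

/-- Squared, this is `‖a‖² ≤ ⟨n⟩/8 ≤ w (2n)²/8`, and `0.354² > 1/8`. -/
theorem Small.left_le (hs : Small w a b n) : coefNorm w a ≤ 0.354 * w (2 * n) := by
  have h1 := bracket_le_of_weightsOne hs.weight (2 * n)
  have h2 : bracket n ≤ bracket ((2 * n : ℤ) : ℝ) := by
    unfold bracket; push_cast; rw [abs_mul, abs_two]; linarith [abs_nonneg (n : ℝ)]
  have h3 := one_le_bracket ((2 * n : ℤ) : ℝ)
  have h4 := hs.small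
  refine (pow_le_pow_iff_left₀ (coefNorm_nonneg _ _) (by linarith) two_ne_zero).1 ?_
  have h5 : bracket ((2 * n : ℤ) : ℝ) ≤ w (2 * n) ^ 2 := by nlinarith
  rw [mul_pow]
  nlinarith [sq_nonneg (coefNorm w b)]

/-- The size of the resolvent coefficients. -/
def ResBound (n : ℤ) (R : ℤ → X →L[ℂ] X) : Prop := ∀ l, ‖R l‖ ≤ 2 / Real.pi * invDist n l

theorem two_div_pi_lt : 2 / Real.pi < 0.637 := by
  rw [div_lt_iff₀ Real.pi_pos]
  nlinarith [Real.pi_gt_d4]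

theorem two_div_pi_pos : 0 < 2 / Real.pi := by positivity

theorem cv_sub_right (hw : w ∈ weightsOne) (ha : WSummable w a) {c : ℝ}
    (hR : ∀ l, ‖R l‖ ≤ c * invDist n l) {M' : ℝ} (hh : ∀ l, ‖h l‖ ≤ M) (hh' : ∀ l, ‖h' l‖ ≤ M')
    (k : ℤ) : cv a R (fun l => h l - h' l) k = cv a R h k - cv a R h' k := by
  unfold cv
  rw [← (cv_summable hw ha hR hh k).tsum_sub (cv_summable hw ha hR hh' k)]
  simp [smul_sub]

theorem cv_add_right (hw : w ∈ weightsOne) (ha : WSummable w a) {c : ℝ}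
    (hR : ∀ l, ‖R l‖ ≤ c * invDist n l) {M' : ℝ} (hh : ∀ l, ‖h l‖ ≤ M) (hh' : ∀ l, ‖h' l‖ ≤ M')
    (k : ℤ) : cv a R (fun l => h l + h' l) k = cv a R h k + cv a R h' k := by
  unfold cv
  rw [← (cv_summable hw ha hR hh k).tsum_add (cv_summable hw ha hR hh' k)]
  simp [smul_add]

theorem cv_sub_left (hw : w ∈ weightsOne) (ha : WSummable w a) {c c' : ℝ}
    (hR : ∀ l, ‖R l‖ ≤ c * invDist n l) (hR' : ∀ l, ‖R' l‖ ≤ c' * invDist n l)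
    (hh : ∀ l, ‖h l‖ ≤ M) (k : ℤ) :
    cv a (fun l => R l - R' l) h k = cv a R h k - cv a R' h k := by
  unfold cv
  rw [← (cv_summable hw ha hR hh k).tsum_sub (cv_summable hw ha hR' hh k)]
  simp [smul_sub]

/-- The twofold iterate is a contraction by the factor `2 / 5`. -/
theorem Small.norm_cv_cv_le (hs : Small w a b n) {u : ℤ → ℝ} (hu : Admissible w n u)
    (hR : ResBound n R) (hh : ∀ l, ‖h l‖ * u l ≤ M) (k : ℤ) :
    ‖cv a R (cv b R h) k‖ * u k ≤ 0.4 * M := by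
  have h1 := NLS.norm_cv_cv_le hs.weight hs.left hs.right hu hR hR hh k
  refine h1.trans ?_
  have hM : 0 ≤ M := (mul_nonneg (norm_nonneg _) (zero_le_one.trans (hu.1 0))).trans (hh 0)
  have hn := bracket_pos (n : ℝ)
  have := hs.mul_le
  rw [div_le_iff₀ hn]
  have h2 : 2 / Real.pi * (2 / Real.pi) ≤ 0.406 := by
    have := two_div_pi_lt; have := two_div_pi_pos; nlinarith
  have hab := mul_nonneg (coefNorm_nonneg w a) (coefNorm_nonneg w b)
  -- The contraction factor: `15.3 · 0.406 < 6.4 = 0.4 · 16`, and `16‖a‖‖b‖ ≤ ⟨n⟩`.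
  calc 15.3 * (coefNorm w a * coefNorm w b) * (2 / Real.pi * (2 / Real.pi) * M)
      ≤ 15.3 * (coefNorm w a * coefNorm w b) * (0.406 * M) := by gcongr
    _ ≤ 6.4 * (coefNorm w a * coefNorm w b) * M := by nlinarith [mul_nonneg hab hM]
    _ = 0.4 * (16 * (coefNorm w a * coefNorm w b)) * M := by ring
    _ ≤ 0.4 * bracket n * M := by gcongr
    _ = _ := by ring

theorem admissible_unit_bound {u : ℤ → ℝ} (hu : Admissible w n u) (hh : ∀ l, ‖h l‖ * u l ≤ M)
    (l : ℤ) : ‖h l‖ ≤ M :=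
  (le_mul_of_one_le_right (norm_nonneg _) (hu.1 l)).trans (hh l)

/-- Solvability of the reduced equation `h = s + cv a R (cv b R h)` with weighted bounds. -/
theorem Small.exists_fixed (hs : Small w a b n) {u : ℤ → ℝ} (hu : Admissible w n u)
    (hR : ResBound n R) (hS : ∀ l, ‖s l‖ * u l ≤ M) :
    ∃ h : ℤ → X, (∀ l, ‖h l‖ * u l ≤ 5 / 3 * M) ∧ ∀ k, h k = s k + cv a R (cv b R h) k := by
  have hM : 0 ≤ M := (mul_nonneg (norm_nonneg _) (zero_le_one.trans (hu.1 0))).trans (hS 0)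
  have hu1 := admissible_one hs.weight n
  have hcv : ∀ (f : BoundedContinuousFunction ℤ X) k, ‖cv a R (cv b R f) k‖ ≤ 0.4 * ‖f‖ := by
    intro f k
    simpa using hs.norm_cv_cv_le hu1 hR (h := f) (M := ‖f‖)
      (fun l => by simpa using f.norm_coe_le_norm l) k
  have hs1 := admissible_unit_bound hu hS
  let F : BoundedContinuousFunction ℤ X → BoundedContinuousFunction ℤ X := fun f =>
    BoundedContinuousFunction.ofNormedAddCommGroupDiscrete
      (fun k => s k + cv a R (cv b R f) k) (M + 0.4 * ‖f‖)
      fun k => (norm_add_le _ _).trans (add_le_add (hs1 k) (hcv f k))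
  have hFa : ∀ f k, F f k = s k + cv a R (cv b R f) k := fun f k => rfl
  -- The contraction runs in the unweighted sup norm; the weighted bound enters as a closed
  -- invariant set. It is invariant because `1 + 0.4 · 5/3 = 5/3`.
  let S : Set (BoundedContinuousFunction ℤ X) := {f | ∀ l, ‖f l‖ * u l ≤ 5 / 3 * M}
  have hSc : IsClosed S := by
    have : S = ⋂ l, {f | ‖f l‖ * u l ≤ 5 / 3 * M} := by ext; simp [S]
    rw [this]
    refine isClosed_iInter fun l => isClosed_le ?_ continuous_const
    exact ((BoundedContinuousFunction.lipschitz_eval_const l).continuous.norm).mul continuous_const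
  have hmaps : Set.MapsTo F S S := by
    intro f hf k
    rw [hFa]
    have h1 := hs.norm_cv_cv_le hu hR hf k
    have h2 := hS k
    have hk : 0 ≤ u k := zero_le_one.trans (hu.1 k)
    calc _ ≤ (‖s k‖ + ‖cv a R (cv b R f) k‖) * u k := by gcongr; exact norm_add_le _ _
      _ ≤ 5 / 3 * M := by linarith
  have hlip : ∀ f g, dist (F f) (F g) ≤ 0.4 * dist f g := by
    intro f g
    refine (BoundedContinuousFunction.dist_le (by positivity)).2 fun k => ?_
    rw [hFa, hFa, dist_eq_norm, add_sub_add_left_eq_sub]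
    have hbf := fun l => NLS.norm_cv_le hs.weight hs.right hR (h := f) f.norm_coe_le_norm l
    have hbg := fun l => NLS.norm_cv_le hs.weight hs.right hR (h := g) g.norm_coe_le_norm l
    rw [← cv_sub_right hs.weight hs.left hR hbf hbg]
    have e : (fun l => cv b R f l - cv b R g l) = cv b R (f - g : BoundedContinuousFunction ℤ X) := by
      funext l
      rw [← cv_sub_right hs.weight hs.right hR f.norm_coe_le_norm g.norm_coe_le_norm]
      rfl
    rw [e, dist_eq_norm]
    exact hcv _ k
  have hcontr : ContractingWith (2 / 5 : NNReal) (hmaps.restrict F S S) := by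
    refine ⟨by rw [← NNReal.coe_lt_coe]; norm_num, LipschitzWith.of_dist_le_mul fun f g => ?_⟩
    have := hlip f g
    rw [Subtype.dist_eq]
    refine this.trans (le_of_eq ?_)
    rw [Subtype.dist_eq]
    norm_num
  obtain ⟨y, hyS, hy, -⟩ := ContractingWith.exists_fixedPoint' hSc.isComplete hmaps hcontr
    (x := 0) (fun l => by simp; positivity) (edist_ne_top _ _)
  exact ⟨y, hyS, fun k => by rw [← hFa, hy]⟩

theorem eq_zero_of_norm_le_mul {g : ℤ → X} {θ : ℝ} (hθ0 : 0 ≤ θ) (hθ : θ < 1)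
    (hb : ∀ k, ‖g k‖ ≤ M) (hstep : ∀ M', (∀ k, ‖g k‖ ≤ M') → ∀ k, ‖g k‖ ≤ θ * M') (k : ℤ) :
    g k = 0 := by
  have hj : ∀ j : ℕ, ∀ k, ‖g k‖ ≤ θ ^ j * M := by
    intro j
    induction j with
    | zero => simpa using hb
    | succ j ih => intro k; rw [pow_succ', mul_assoc]; exact hstep _ ih k
  have ht : Tendsto (fun j : ℕ => θ ^ j * M) atTop (𝓝 0) := by
    simpa using (tendsto_pow_atTop_nhds_zero_of_lt_one hθ0 hθ).mul_const M
  exact norm_le_zero_iff.1 (ge_of_tendsto' ht fun j => hj j k)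

theorem Small.eq_zero_of_fixed (hs : Small w a b n) (hR : ResBound n R) (hb : ∀ l, ‖h l‖ ≤ M)
    (he : ∀ k, h k = cv a R (cv b R h) k) (k : ℤ) : h k = 0 := by
  refine eq_zero_of_norm_le_mul (θ := 0.4) (by norm_num) (by norm_num) hb (fun M' hM' k => ?_) k
  have := hs.norm_cv_cv_le (admissible_one hs.weight n) hR (h := h) (M := M') (by simpa using hM') k
  rw [← he] at this
  simpa using this

theorem cv_cv_sub (hs : Small w a b n) (hR : ResBound n R) {M' : ℝ} (hh : ∀ l, ‖h l‖ ≤ M)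
    (hh' : ∀ l, ‖h' l‖ ≤ M') (k : ℤ) :
    cv a R (cv b R fun l => h l - h' l) k = cv a R (cv b R h) k - cv a R (cv b R h') k := by
  have hbf := fun l => NLS.norm_cv_le hs.weight hs.right hR hh l
  have hbg := fun l => NLS.norm_cv_le hs.weight hs.right hR hh' l
  rw [← cv_sub_right hs.weight hs.left hR hbf hbg]
  congr 1
  funext l
  exact cv_sub_right hs.weight hs.right hR hh hh' l

/-- The a priori bound for solutions of the reduced equation. -/
theorem Small.bound_of_fixed (hs : Small w a b n) {u : ℤ → ℝ} (hu : Admissible w n u)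
    (hR : ResBound n R) {M' : ℝ} (hb : ∀ l, ‖h l‖ ≤ M') (hS : ∀ l, ‖s l‖ * u l ≤ M)
    (he : ∀ k, h k = s k + cv a R (cv b R h) k) (l : ℤ) : ‖h l‖ * u l ≤ 5 / 3 * M := by
  -- Any bounded solution coincides with the one constructed inside the weighted ball, by uniqueness
  -- in the unweighted norm, and so inherits its bound.
  obtain ⟨g, hg, hge⟩ := hs.exists_fixed hu hR hS
  have hgb := admissible_unit_bound hu hg
  have : ∀ k, h k - g k = 0 := by
    refine hs.eq_zero_of_fixed (h := fun k => h k - g k) (M := M' + 5 / 3 * M) hR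
      (fun l => (norm_sub_le _ _).trans (add_le_add (hb l) (hgb l))) fun k => ?_
    rw [cv_cv_sub hs hR hb hgb, he k, hge k]
    abel
  rw [sub_eq_zero.1 (this l)]
  exact hg l

/-- `h` solves the reduced equation with one-sided data `p`. -/
structure Half (a b : ℤ → ℂ) (n : ℤ) (R : ℤ → X →L[ℂ] X) (p : X) (h : ℤ → X) : Prop where
  bdd : ∃ M, ∀ l, ‖h l‖ ≤ M
  eq : ∀ k, h k = a (k + n) • p + cv a R (cv b R h) k

variable {p : X}

theorem coef_le (ha : WSummable w a) (k : ℤ) : w k * ‖a k‖ ≤ coefNorm w a := by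
  refine Real.le_sqrt_of_sq_le ?_
  exact ha.le_tsum k fun j _ => sq_nonneg _

theorem source_le (ha : WSummable w a) (p : X) (l : ℤ) :
    ‖a (l + n) • p‖ * w (l + n) ≤ coefNorm w a * ‖p‖ := by
  rw [norm_smul]
  have := coef_le ha (l + n)
  have := norm_nonneg p
  nlinarith

theorem Half.exists (hs : Small w a b n) (hR : ResBound n R) (p : X) : ∃ h, Half a b n R p h := by
  obtain ⟨h, hh, he⟩ := hs.exists_fixed (admissible_shift hs.weight n) hR (source_le hs.left p)
  exact ⟨h, ⟨_, admissible_unit_bound (admissible_shift hs.weight n) hh⟩, he⟩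

theorem Half.bound (hh : Half a b n R p h) (hs : Small w a b n) (hR : ResBound n R) (l : ℤ) :
    ‖h l‖ * w (l + n) ≤ 5 / 3 * (coefNorm w a * ‖p‖) := by
  obtain ⟨M, hM⟩ := hh.bdd
  exact hs.bound_of_fixed (admissible_shift hs.weight n) hR hM (source_le hs.left p) hh.eq l

/-- The leading term of the solution on the critical index. -/
theorem Half.lead (hh : Half a b n R p h) (hs : Small w a b n) (hR : ResBound n R) :
    ‖h n - a (2 * n) • p‖ * w (2 * n) ≤
      32 / 3 * (coefNorm w a ^ 2 * coefNorm w b) * ‖p‖ / bracket n := by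
  have h1 := NLS.norm_cv_cv_le hs.weight hs.left hs.right (admissible_shift hs.weight n) hR hR
    (hh.bound hs hR) n
  have e := hh.eq n
  rw [← two_mul] at e h1
  rw [e, add_sub_cancel_left]
  refine h1.trans ?_
  have hn := bracket_pos (n : ℝ)
  have h2 : 2 / Real.pi * (2 / Real.pi) ≤ 0.406 := by
    have := two_div_pi_lt; have := two_div_pi_pos; nlinarith
  have hA := coefNorm_nonneg w a
  have hB := coefNorm_nonneg w b
  have hp := norm_nonneg p
  refine div_le_div_of_nonneg_right ?_ hn.le
  -- The whole deviation from the source term is one application of the twofold iterate, and `15.3 ·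
  -- 0.406 · 5/3 < 32/3`.
  calc _ ≤ 15.3 * (coefNorm w a * coefNorm w b) * (0.406 * (5 / 3 * (coefNorm w a * ‖p‖))) := by
        gcongr
    _ = 15.3 * 0.406 * 5 / 3 * (coefNorm w a ^ 2 * coefNorm w b * ‖p‖) := by ring
    _ ≤ 32 / 3 * (coefNorm w a ^ 2 * coefNorm w b * ‖p‖) := by gcongr; norm_num
    _ = _ := by ring

/-- The diagonal coefficient is small. -/
theorem Half.cross (hh : Half a b n R p h) (hs : Small w a b n) (hR : ResBound n R) :
    ‖cv b R h n‖ ≤ 0.11 * ‖p‖ := by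
  have h1 := norm_cv_self_le hs.weight hs.right hR (hh.bound hs hR)
  refine h1.trans ?_
  have hn := bracket_pos (n : ℝ)
  have hA := coefNorm_nonneg w a
  have hB := coefNorm_nonneg w b
  have hp := norm_nonneg p
  rw [mul_div_assoc', div_le_iff₀ hn]
  have := hs.mul_le
  have := two_div_pi_lt
  calc _ ≤ 1.52 * coefNorm w b * (0.637 * (5 / 3 * (coefNorm w a * ‖p‖))) := by gcongr
    _ = (1.52 * 0.637 * (5 / 3) / 16) * (16 * (coefNorm w a * coefNorm w b)) * ‖p‖ := by ring
    _ ≤ 0.11 * bracket n * ‖p‖ := by gcongr; norm_num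
    _ = _ := by ring

/-- The difference solves the same reduced equation with source `cv a R (cv b (R-R') h') + cv a
(R-R') (cv b R' h')`. Each of these terms is at most `0.426 δ ‖a‖‖p‖` in the weighted norm, and
inverting the equation costs `5/3`; `5/3 · 0.852 = 1.42`. -/
theorem Half.lip (hh : Half a b n R p h) (hh' : Half a b n R' p h') (hs : Small w a b n)
    (hR : ResBound n R) (hR' : ResBound n R') (hδ : 0 ≤ δ)
    (hD : ∀ l, ‖R l - R' l‖ ≤ 0.406 * δ * invDist n l) (l : ℤ) :
    ‖h l - h' l‖ * w (l + n) ≤ 1.42 * δ * (coefNorm w a * ‖p‖) := by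
  obtain ⟨M, hM⟩ := hh.bdd
  obtain ⟨M', hM'⟩ := hh'.bdd
  have hu := admissible_shift hs.weight n
  have hb' := hh'.bound hs hR'
  have hbR' := fun l => NLS.norm_cv_le hs.weight hs.right hR' hM' l
  have hbR := fun l => NLS.norm_cv_le hs.weight hs.right hR hM' l
  have hn := bracket_pos (n : ℝ)
  have hA := coefNorm_nonneg w a
  have hB := coefNorm_nonneg w b
  have hp := norm_nonneg p
  have hml := hs.mul_le
  have hbound : ∀ l, ‖cv a R (cv b (fun l => R l - R' l) h') l +
      cv a (fun l => R l - R' l) (cv b R' h') l‖ * w (l + n) ≤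
      0.852 * δ * (coefNorm w a * ‖p‖) := by
    intro l
    have h1 := NLS.norm_cv_cv_le hs.weight hs.left hs.right hu hR hD hb' l
    have h2 := NLS.norm_cv_cv_le hs.weight hs.left hs.right hu hD hR' hb' l
    have hwl := (weight_pos hs.weight (l + n)).le
    have := two_div_pi_lt
    have := two_div_pi_pos
    have hle : 15.3 * (coefNorm w a * coefNorm w b) *
        (2 / Real.pi * (0.406 * δ) * (5 / 3 * (coefNorm w a * ‖p‖))) / bracket n ≤
        0.426 * δ * (coefNorm w a * ‖p‖) := by
      rw [div_le_iff₀ hn]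
      calc _ ≤ 15.3 * (coefNorm w a * coefNorm w b) *
            (0.637 * (0.406 * δ) * (5 / 3 * (coefNorm w a * ‖p‖))) := by gcongr
        _ = (15.3 * 0.637 * 0.406 * (5 / 3) / 16) * (16 * (coefNorm w a * coefNorm w b)) *
            (δ * (coefNorm w a * ‖p‖)) := by ring
        _ ≤ 0.426 * bracket n * (δ * (coefNorm w a * ‖p‖)) := by gcongr; norm_num
        _ = _ := by ring
    have e : 0.406 * δ * (2 / Real.pi) * (5 / 3 * (coefNorm w a * ‖p‖)) =
      2 / Real.pi * (0.406 * δ) * (5 / 3 * (coefNorm w a * ‖p‖)) := by ring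
    rw [e] at h2
    calc _ ≤ (‖cv a R (cv b (fun l => R l - R' l) h') l‖ +
          ‖cv a (fun l => R l - R' l) (cv b R' h') l‖) * w (l + n) := by
          gcongr; exact norm_add_le _ _
      _ ≤ _ := by linarith
  have := hs.bound_of_fixed hu hR (h := fun l => h l - h' l) (M' := M + M')
    (fun l => (norm_sub_le _ _).trans (add_le_add (hM l) (hM' l))) hbound (fun k => ?_) l
  · refine this.trans ?_
    have : 0 ≤ δ * (coefNorm w a * ‖p‖) := by positivity
    linarith
  · have e1 : cv a R (cv b (fun l => R l - R' l) h') k =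
        cv a R (cv b R h') k - cv a R (cv b R' h') k := by
      rw [← cv_sub_right hs.weight hs.left hR hbR hbR']
      congr 1
      funext l
      exact cv_sub_left hs.weight hs.right hR hR' hM' l
    rw [e1, cv_sub_left hs.weight hs.left hR hR' hbR', cv_cv_sub hs hR hM hM', hh.eq k, hh'.eq k]
    abel

/-- Product rule: varying `h` contributes `0.09` and varying `R` contributes `0.07`. That the total
is far below `1` lets the gap estimate absorb the variation of the diagonal entry. -/
theorem Half.cross_lip (hh : Half a b n R p h) (hh' : Half a b n R' p h') (hs : Small w a b n)
    (hR : ResBound n R) (hR' : ResBound n R') (hδ : 0 ≤ δ)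
    (hD : ∀ l, ‖R l - R' l‖ ≤ 0.406 * δ * invDist n l) :
    ‖cv b R h n - cv b R' h' n‖ ≤ 0.16 * δ * ‖p‖ := by
  obtain ⟨M, hM⟩ := hh.bdd
  obtain ⟨M', hM'⟩ := hh'.bdd
  have e : cv b R h n - cv b R' h' n =
      cv b R (fun l => h l - h' l) n + cv b (fun l => R l - R' l) h' n := by
    rw [cv_sub_right hs.weight hs.right hR hM hM', cv_sub_left hs.weight hs.right hR hR' hM']
    abel
  rw [e]
  refine (norm_add_le _ _).trans ?_
  have h1 := norm_cv_self_le hs.weight hs.right hR (hh.lip hh' hs hR hR' hδ hD)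
  have h2 := norm_cv_self_le hs.weight hs.right hD (hh'.bound hs hR')
  have hn := bracket_pos (n : ℝ)
  have hA := coefNorm_nonneg w a
  have hB := coefNorm_nonneg w b
  have hp := norm_nonneg p
  have hml := hs.mul_le
  have := two_div_pi_lt
  have h1' : 1.52 * coefNorm w b * (2 / Real.pi * (1.42 * δ * (coefNorm w a * ‖p‖)) / bracket n) ≤
      0.09 * δ * ‖p‖ := by
    rw [mul_div_assoc', div_le_iff₀ hn]
    calc _ ≤ 1.52 * coefNorm w b * (0.637 * (1.42 * δ * (coefNorm w a * ‖p‖))) := by gcongr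
      _ = (1.52 * 0.637 * 1.42 / 16) * (16 * (coefNorm w a * coefNorm w b)) * (δ * ‖p‖) := by ring
      _ ≤ 0.09 * bracket n * (δ * ‖p‖) := by gcongr; norm_num
      _ = _ := by ring
  have h2' : 1.52 * coefNorm w b * (0.406 * δ * (5 / 3 * (coefNorm w a * ‖p‖)) / bracket n) ≤
      0.07 * δ * ‖p‖ := by
    rw [mul_div_assoc', div_le_iff₀ hn]
    calc _ = (1.52 * 0.406 * (5 / 3) / 16) * (16 * (coefNorm w a * coefNorm w b)) * (δ * ‖p‖) := by
          ring
      _ ≤ 0.07 * bracket n * (δ * ‖p‖) := by gcongr; norm_num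
      _ = _ := by ring
  linarith

end half

/-! ### The coupled reduced system. -/

section reduced

variable {X : Type*} [NormedAddCommGroup X] [NormedSpace ℂ X] [CompleteSpace X]
  {w : ℤ → ℝ} {a b : ℤ → ℂ} {n : ℤ} {M δ : ℝ} {R R' : ℤ → X →L[ℂ] X} {h h' : ℤ → X}

/-- The reduced system for both components, with data `(pm, pp)` on the critical index. -/
structure Reduced (a b : ℤ → ℂ) (n : ℤ) (R : ℤ → X →L[ℂ] X) (pm pp : X) (hm hp : ℤ → X) :
    Prop where
  bdd : ∃ M, ∀ l, ‖hm l‖ ≤ M ∧ ‖hp l‖ ≤ M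
  eqm : ∀ k, hm k = a (k + n) • pp + cv a R hp k
  eqp : ∀ k, hp k = b (k + n) • pm + cv b R hm k

variable {pm pp : X} {hm hp hm' hp' : ℤ → X}

theorem Reduced.symm (hr : Reduced a b n R pm pp hm hp) : Reduced b a n R pp pm hp hm :=
  ⟨hr.bdd.imp fun _ h l => (h l).symm, hr.eqp, hr.eqm⟩

/-- Superposition. The data `pp` and `pm` each drive a one-sided equation, and a single convolution
transports each solution into the other component. -/
theorem Reduced.of_half {h₁ h₂ : ℤ → X} (hs : Small w a b n) (hR : ResBound n R)
    (H₁ : Half a b n R pp h₁) (H₂ : Half b a n R pm h₂) :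
    Reduced a b n R pm pp (fun k => h₁ k + cv a R h₂ k) (fun k => h₂ k + cv b R h₁ k) := by
  obtain ⟨M₁, hM₁⟩ := H₁.bdd
  obtain ⟨M₂, hM₂⟩ := H₂.bdd
  have b1 := fun l => NLS.norm_cv_le hs.weight hs.right hR hM₁ l
  have b2 := fun l => NLS.norm_cv_le hs.weight hs.left hR hM₂ l
  refine ⟨⟨_, fun l => ⟨(norm_add_le _ _).trans ((add_le_add (hM₁ l) (b2 l)).trans
    (le_max_left _ _)), (norm_add_le _ _).trans ((add_le_add (hM₂ l) (b1 l)).trans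
    (le_max_right _ _))⟩⟩, fun k => ?_, fun k => ?_⟩
  · rw [cv_add_right hs.weight hs.left hR hM₂ b1, H₁.eq k]; abel
  · rw [cv_add_right hs.weight hs.right hR hM₁ b2, H₂.eq k]; abel

theorem Reduced.exists (hs : Small w a b n) (hR : ResBound n R) (pm pp : X) :
    ∃ hm hp, Reduced a b n R pm pp hm hp := by
  obtain ⟨h₁, H₁⟩ := Half.exists hs hR pp
  obtain ⟨h₂, H₂⟩ := Half.exists hs.symm hR pm
  exact ⟨_, _, Reduced.of_half hs hR H₁ H₂⟩

/-- The difference of two solutions has no source; inserting one equation into the other makes it a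
fixed point of the twofold iterate. -/
theorem Reduced.unique_left (hr : Reduced a b n R pm pp hm hp)
    (hr' : Reduced a b n R pm pp hm' hp') (hs : Small w a b n) (hR : ResBound n R) (k : ℤ) :
    hm k = hm' k := by
  obtain ⟨M, hM⟩ := hr.bdd
  obtain ⟨M', hM'⟩ := hr'.bdd
  have e1 : ∀ k, hm k - hm' k = cv a R (fun l => hp l - hp' l) k := fun k => by
    rw [cv_sub_right hs.weight hs.left hR (fun l => (hM l).2) (fun l => (hM' l).2), hr.eqm k,
      hr'.eqm k]; abel
  have e2 : (fun k => hp k - hp' k) = cv b R (fun l => hm l - hm' l) := by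
    funext k
    rw [cv_sub_right hs.weight hs.right hR (fun l => (hM l).1) (fun l => (hM' l).1), hr.eqp k,
      hr'.eqp k]; abel
  refine sub_eq_zero.1 (hs.eq_zero_of_fixed (h := fun k => hm k - hm' k) (M := M + M') hR
    (fun l => (norm_sub_le _ _).trans (add_le_add (hM l).1 (hM' l).1)) (fun k => ?_) k)
  rw [← e2]
  exact e1 k

theorem Reduced.unique_right (hr : Reduced a b n R pm pp hm hp)
    (hr' : Reduced a b n R pm pp hm' hp') (hs : Small w a b n) (hR : ResBound n R) (k : ℤ) :
    hp k = hp' k :=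
  hr.symm.unique_left hr'.symm hs.symm hR k

/-- Solutions of the reduced system decay. -/
theorem Reduced.decay (hr : Reduced a b n R pm pp hm hp) (hs : Small w a b n)
    (hR : ResBound n R) : ∃ C, ∀ l : ℤ, ‖hm l‖ ≤ C * ((bracket (l + n))⁻¹ + (bracket (l - n))⁻¹) := by
  obtain ⟨h₁, H₁⟩ := Half.exists hs hR pp
  obtain ⟨h₂, H₂⟩ := Half.exists hs.symm hR pm
  have b1 := H₁.bound hs hR
  have b2 := norm_cv_mul_weight_le hs.weight hs.left hR (H₂.bound hs.symm hR)
  refine ⟨max (5 / 3 * (coefNorm w a * ‖pp‖)) (1.82 * coefNorm w a * (2 / Real.pi *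
    (5 / 3 * (coefNorm w b * ‖pm‖)))), fun l => ?_⟩
  rw [hr.unique_left (Reduced.of_half hs hR H₁ H₂) hs hR l]
  have hbr1 : bracket (l + n) ≤ w (l + n) := by
    have := bracket_le_of_weightsOne hs.weight (l + n)
    push_cast at this; exact this
  have hbr2 : bracket (l - n) ≤ w (l - n) := by
    have := bracket_le_of_weightsOne hs.weight (l - n)
    push_cast at this; exact this
  have p1 := bracket_pos ((l : ℝ) + n)
  have p2 := bracket_pos ((l : ℝ) - n)
  refine (norm_add_le _ _).trans ?_
  rw [mul_add]
  refine add_le_add ?_ ?_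
  · rw [← div_eq_mul_inv, le_div_iff₀ p1]
    exact (mul_le_mul_of_nonneg_left hbr1 (norm_nonneg _)).trans ((b1 l).trans (le_max_left _ _))
  · rw [← div_eq_mul_inv, le_div_iff₀ p2]
    exact (mul_le_mul_of_nonneg_left hbr2 (norm_nonneg _)).trans ((b2 l).trans (le_max_right _ _))

theorem Half.norm_self_le (hh : Half a b n R pp h) (hs : Small w a b n) (hR : ResBound n R) :
    ‖h n‖ ≤ 0.6 * ‖pp‖ := by
  have h1 := hh.bound hs hR n
  rw [← two_mul] at h1
  have h2 := hs.left_le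
  have hw := weight_pos hs.weight (2 * n)
  have hp := norm_nonneg pp
  refine le_of_mul_le_mul_right (h1.trans ?_) hw
  calc _ ≤ 5 / 3 * (0.354 * w (2 * n) * ‖pp‖) := by gcongr
    _ ≤ 0.6 * ‖pp‖ * w (2 * n) := by
      have := mul_nonneg hp hw.le
      nlinarith

theorem Half.norm_self_lip (hh : Half a b n R pp h) (hh' : Half a b n R' pp h')
    (hs : Small w a b n) (hR : ResBound n R) (hR' : ResBound n R') (hδ : 0 ≤ δ)
    (hD : ∀ l, ‖R l - R' l‖ ≤ 0.406 * δ * invDist n l) : ‖h n - h' n‖ ≤ 0.51 * δ * ‖pp‖ := by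
  have h1 := hh.lip hh' hs hR hR' hδ hD n
  rw [← two_mul] at h1
  have h2 := hs.left_le
  have hw := weight_pos hs.weight (2 * n)
  have hp := norm_nonneg pp
  refine le_of_mul_le_mul_right (h1.trans ?_) hw
  calc _ ≤ 1.42 * δ * (0.354 * w (2 * n) * ‖pp‖) := by gcongr
    _ ≤ 0.51 * δ * ‖pp‖ * w (2 * n) := by
      have := mul_nonneg (mul_nonneg hδ hp) hw.le
      nlinarith

/-- The two one-sided contributions are at most `0.6` and `0.11`. This bound makes the map in
`exists_planeMap` preserve a ball of radius `3/4`. -/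
theorem Reduced.norm_self_le (hr : Reduced a b n R pm pp hm hp) (hs : Small w a b n)
    (hR : ResBound n R) (hpm : ‖pm‖ ≤ 1) (hpp : ‖pp‖ ≤ 1) : ‖hm n‖ ≤ 3 / 4 := by
  obtain ⟨h₁, H₁⟩ := Half.exists hs hR pp
  obtain ⟨h₂, H₂⟩ := Half.exists hs.symm hR pm
  rw [hr.unique_left (Reduced.of_half hs hR H₁ H₂) hs hR n]
  have h1 := H₁.norm_self_le hs hR
  have h2 := H₂.cross hs.symm hR
  refine (norm_add_le _ _).trans ?_
  linarith

/-- The contributions `0.51` and `0.16` stay below `3/4`, which serves as contraction constant in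
`exists_planeMap` and again in `dual_eq_zero_of_small`. -/
theorem Reduced.norm_self_lip (hr : Reduced a b n R pm pp hm hp)
    (hr' : Reduced a b n R' pm pp hm' hp') (hs : Small w a b n) (hR : ResBound n R)
    (hR' : ResBound n R') (hδ : 0 ≤ δ) (hD : ∀ l, ‖R l - R' l‖ ≤ 0.406 * δ * invDist n l)
    (hpm : ‖pm‖ ≤ 1) (hpp : ‖pp‖ ≤ 1) : ‖hm n - hm' n‖ ≤ 3 / 4 * δ := by
  obtain ⟨h₁, H₁⟩ := Half.exists hs hR pp
  obtain ⟨h₂, H₂⟩ := Half.exists hs.symm hR pm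
  obtain ⟨h₁', H₁'⟩ := Half.exists hs hR' pp
  obtain ⟨h₂', H₂'⟩ := Half.exists hs.symm hR' pm
  rw [hr.unique_left (Reduced.of_half hs hR H₁ H₂) hs hR n,
    hr'.unique_left (Reduced.of_half hs hR' H₁' H₂') hs hR' n, add_sub_add_comm]
  have h1 := H₁.norm_self_lip H₁' hs hR hR' hδ hD
  have h2 := H₂.cross_lip H₂' hs.symm hR hR' hδ hD
  refine (norm_add_le _ _).trans ?_
  nlinarith

/-! ### Resolvents and the passage from the eigenvalue equation to the reduced system. -/

/-- The family `R` of resolvents `(Z - lπ)⁻¹`, `l ≠ n`, of an operator `Z` close to `nπ`. -/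
structure IsResolvent (n : ℤ) (Z : X →L[ℂ] X) (R : ℤ → X →L[ℂ] X) : Prop where
  zero : R n = 0
  left : ∀ l, l ≠ n → ∀ x, R l (Z x - ((l : ℂ) * Real.pi) • x) = x
  right : ∀ l, l ≠ n → ∀ x, Z (R l x) - ((l : ℂ) * Real.pi) • R l x = x
  bound : ResBound n R

/-- Resolvent identity `R - R' = -R (Z - Z') R'`, with `(2/π)² < 0.406`. One of the two reciprocal
distances is kept and the other is estimated by `1`. -/
theorem IsResolvent.norm_sub_le {Z Z' : X →L[ℂ] X} (hR : IsResolvent n Z R)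
    (hR' : IsResolvent n Z' R') (l : ℤ) : ‖R l - R' l‖ ≤ 0.406 * ‖Z - Z'‖ * invDist n l := by
  by_cases hl : l = n
  · subst hl; simp [hR.zero, hR'.zero]
  have e : R l - R' l = -((R l).comp ((Z - Z').comp (R' l))) := by
    ext x
    have h1 := hR.left l hl (R' l x)
    have h2 := hR'.right l hl x
    have h3 : Z (R' l x) - ((l : ℂ) * Real.pi) • R' l x = x + (Z - Z') (R' l x) := by
      have h4 : (Z - Z') (R' l x) = Z (R' l x) - Z' (R' l x) := rfl
      rw [h4]
      linear_combination (norm := module) (1 : ℂ) • h2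
    rw [h3, map_add] at h1
    change R l x - R' l x = -(R l ((Z - Z') (R' l x)))
    linear_combination (norm := module) (1 : ℂ) • h1
  rw [e, norm_neg]
  have d0 := invDist_nonneg n l
  have d1 := invDist_le_one n l
  have hpi := two_div_pi_lt
  have hpi' := two_div_pi_pos
  have := norm_nonneg (Z - Z')
  calc _ ≤ ‖R l‖ * (‖Z - Z'‖ * ‖R' l‖) :=
        (ContinuousLinearMap.opNorm_comp_le _ _).trans
          (mul_le_mul_of_nonneg_left (ContinuousLinearMap.opNorm_comp_le _ _) (norm_nonneg _))
    _ ≤ (2 / Real.pi * 1) * (‖Z - Z'‖ * (2 / Real.pi * invDist n l)) := by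
        gcongr
        · exact (hR.bound l).trans (by gcongr)
        · exact hR'.bound l
    _ = (2 / Real.pi) ^ 2 * (‖Z - Z'‖ * invDist n l) := by ring
    _ ≤ 0.406 * (‖Z - Z'‖ * invDist n l) := by gcongr; nlinarith
    _ = _ := by ring

/-- Neumann series: with `D = Z - nπ` and `μ = (l-n)π` one has `Z - lπ = D - μ` and `‖D‖ ≤ π/2 ≤
|μ|/2`. -/
theorem exists_resolvent {Z : X →L[ℂ] X}
    (hZ : ‖Z - ((n : ℂ) * Real.pi) • ContinuousLinearMap.id ℂ X‖ ≤ Real.pi / 2) :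
    ∃ R, IsResolvent n Z R := by
  have hpi := Real.pi_pos
  have key : ∀ l : ℤ, l ≠ n → ∃ S : X →L[ℂ] X, (∀ x, S (Z x - ((l : ℂ) * Real.pi) • x) = x) ∧
      (∀ x, Z (S x) - ((l : ℂ) * Real.pi) • S x = x) ∧ ‖S‖ ≤ 2 / Real.pi * invDist n l := by
    intro l hl
    have hL := one_le_abs_sub hl
    set μ : ℂ := ((l : ℂ) - n) * Real.pi with hμ
    have hμn : ‖μ‖ = |(l : ℝ) - n| * Real.pi := by
      rw [hμ, norm_mul, Complex.norm_real, Real.norm_of_nonneg hpi.le]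
      congr 1
      rw [show ((l : ℂ) - n) = (((l : ℝ) - n : ℝ) : ℂ) by push_cast; rfl, Complex.norm_real,
        Real.norm_eq_abs]
    have hμ0 : μ ≠ 0 := by
      rw [← norm_pos_iff, hμn]; positivity
    set D := Z - ((n : ℂ) * Real.pi) • ContinuousLinearMap.id ℂ X with hD
    have hZx : ∀ x, Z x - ((l : ℂ) * Real.pi) • x = D x - μ • x := by
      intro x
      simp only [hD, hμ, sub_apply, smul_apply,
        ContinuousLinearMap.id_apply]
      module
    have hlt : ‖μ⁻¹ • D‖ < 1 := by
      rw [norm_smul, norm_inv, hμn, inv_mul_lt_iff₀ (by positivity)]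
      nlinarith
    obtain ⟨U, hU⟩ := isUnit_one_sub_of_norm_lt_one hlt
    have hU' : ∀ x, (U : X →L[ℂ] X) x = x - μ⁻¹ • D x := by intro x; rw [hU]; rfl
    have hZU : ∀ x, D x - μ • x = -μ • (U : X →L[ℂ] X) x := by
      intro x
      rw [hU', smul_sub, smul_smul, neg_mul, mul_inv_cancel₀ hμ0]
      module
    have i1 : ∀ x, ((U⁻¹ : (X →L[ℂ] X)ˣ) : X →L[ℂ] X) ((U : X →L[ℂ] X) x) = x := fun x => by
      have := congrArg (fun T : X →L[ℂ] X => T x) (Units.inv_mul U)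
      exact this
    have i2 : ∀ x, (U : X →L[ℂ] X) (((U⁻¹ : (X →L[ℂ] X)ˣ) : X →L[ℂ] X) x) = x := fun x => by
      have := congrArg (fun T : X →L[ℂ] X => T x) (Units.mul_inv U)
      exact this
    have hr : ∀ x, Z (((-μ⁻¹) • ((U⁻¹ : (X →L[ℂ] X)ˣ) : X →L[ℂ] X)) x) - ((l : ℂ) * Real.pi) •
        ((-μ⁻¹) • ((U⁻¹ : (X →L[ℂ] X)ˣ) : X →L[ℂ] X)) x = x := by
      intro x
      rw [hZx, hZU, smul_apply, map_smul, i2, smul_smul]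
      simp [hμ0]
    refine ⟨(-μ⁻¹) • ((U⁻¹ : (X →L[ℂ] X)ˣ) : X →L[ℂ] X), fun x => ?_, hr, ?_⟩
    · rw [hZx, hZU, smul_apply, map_smul, i1, smul_smul]
      simp [hμ0]
    · refine ContinuousLinearMap.opNorm_le_bound _ (by have := invDist_nonneg n l; positivity)
        fun x => ?_
      set y := ((-μ⁻¹) • ((U⁻¹ : (X →L[ℂ] X)ˣ) : X →L[ℂ] X)) x with hy
      have h1 := hr x
      rw [← hy, hZx] at h1
      have h2 : ‖μ • y‖ ≤ ‖x‖ + ‖D y‖ := by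
        have : μ • y = D y - x := by rw [← h1]; abel
        rw [this, add_comm]
        exact norm_sub_le _ _
      have h3 : ‖D y‖ ≤ Real.pi / 2 * ‖y‖ := (D.le_opNorm y).trans (by gcongr)
      rw [norm_smul, hμn] at h2
      unfold invDist
      rw [show 2 / Real.pi * |(l : ℝ) - n|⁻¹ * ‖x‖ = ‖x‖ / (Real.pi / 2 * |(l : ℝ) - n|) by
        field_simp, le_div_iff₀ (by positivity)]
      have : Real.pi / 2 * ‖y‖ ≤ |(l : ℝ) - n| * (Real.pi / 2 * ‖y‖) :=
        le_mul_of_one_le_left (by positivity) hL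
      nlinarith
  choose! S hS using key
  classical
  refine ⟨fun l => if l = n then 0 else S l, by simp, fun l hl => ?_, fun l hl => ?_, fun l => ?_⟩
  · simpa [hl] using (hS l hl).1
  · simpa [hl] using (hS l hl).2.1
  · by_cases hl : l = n
    · simp [hl]
    · simpa [hl] using (hS l hl).2.2

/-- For scalars only the real part has to be close to `nπ`, so the reduction covers the full
vertical strip, which an operator norm condition on `z - nπ` would not. -/
theorem exists_resolvent_scalar {z : ℂ} (hz : |z.re - n * Real.pi| ≤ Real.pi / 2) :
    IsResolvent n (z • ContinuousLinearMap.id ℂ ℂ)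
      fun l => if l = n then 0 else (z - l * Real.pi)⁻¹ • ContinuousLinearMap.id ℂ ℂ := by
  have hpi := Real.pi_pos
  have key : ∀ l : ℤ, l ≠ n → Real.pi / 2 * |(l : ℝ) - n| ≤ ‖z - l * Real.pi‖ := by
    intro l hl
    have hL := one_le_abs_sub hl
    have h1 := Complex.abs_re_le_norm (z - l * Real.pi)
    have e : (z - l * Real.pi).re = (z.re - n * Real.pi) - (l - n) * Real.pi := by
      simp; ring
    rw [e] at h1
    have h2 := abs_sub_abs_le_abs_sub (((l : ℝ) - n) * Real.pi) (z.re - n * Real.pi)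
    rw [abs_sub_comm (((l : ℝ) - n) * Real.pi), abs_mul, abs_of_pos hpi] at h2
    nlinarith
  have hne : ∀ l : ℤ, l ≠ n → z - l * Real.pi ≠ 0 := by
    intro l hl h
    have := key l hl
    rw [h, norm_zero] at this
    have hL := one_le_abs_sub hl
    nlinarith
  refine ⟨by simp, fun l hl x => ?_, fun l hl x => ?_, fun l => ?_⟩
  · have := hne l hl
    simp [hl]; field_simp
  · have := hne l hl
    simp [hl]; field_simp
  · by_cases hl : l = n
    · simp [hl]
    · have hL := one_le_abs_sub hl
      simp only [hl, if_false]
      refine ContinuousLinearMap.opNorm_le_bound _ (by have := invDist_nonneg n l; positivity)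
        fun x => ?_
      simp only [smul_apply, ContinuousLinearMap.id_apply, norm_smul, norm_inv]
      gcongr
      rw [show 2 / Real.pi * invDist n l = (Real.pi / 2 * |(l : ℝ) - n|)⁻¹ by
        unfold invDist; field_simp]
      exact inv_anti₀ (by positivity) (key l hl)

/-- Sequence form of the equation `L(φ) f = Z f` for sequences with values in `X`. -/
structure SeqSol (a b : ℤ → ℂ) (Z : X →L[ℂ] X) (fm fp : ℤ → X) : Prop where
  summ_m : ∀ k, Summable fun l => a (k + l) • fp l
  summ_p : ∀ k, Summable fun l => b (k + l) • fm l
  bdd : ∃ M, ∀ k : ℤ, ‖Z (fm k) - ((k : ℂ) * Real.pi) • fm k‖ ≤ M ∧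
    ‖Z (fp k) - ((k : ℂ) * Real.pi) • fp k‖ ≤ M
  eqm : ∀ k : ℤ, Z (fm k) - ((k : ℂ) * Real.pi) • fm k = ∑' l, a (k + l) • fp l
  eqp : ∀ k : ℤ, Z (fp k) - ((k : ℂ) * Real.pi) • fp k = ∑' l, b (k + l) • fm l

theorem tsum_eq_critical_add {R : ℤ → X →L[ℂ] X} {f h : ℤ → X} (hz : R n = 0)
    (hf : ∀ l, l ≠ n → R l (h l) = f l) {k : ℤ} (hs : Summable fun l => a (k + l) • f l) :
    ∑' l, a (k + l) • f l = a (k + n) • f n + cv a R h k := by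
  classical
  rw [hs.tsum_eq_add_tsum_ite n]
  congr 1
  refine tsum_congr fun l => ?_
  by_cases hl : l = n
  · subst hl; simp [hz]
  · simp [hl, hf l hl]

theorem SeqSol.reduced {Z : X →L[ℂ] X} {fm fp : ℤ → X} (hf : SeqSol a b Z fm fp)
    (hR : IsResolvent n Z R) : Reduced a b n R (fm n) (fp n)
      (fun k => Z (fm k) - ((k : ℂ) * Real.pi) • fm k)
      (fun k => Z (fp k) - ((k : ℂ) * Real.pi) • fp k) := by
  refine ⟨hf.bdd, fun k => ?_, fun k => ?_⟩
  · rw [hf.eqm k]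
    exact tsum_eq_critical_add hR.zero (fun l hl => hR.left l hl _) (hf.summ_m k)
  · rw [hf.eqp k]
    exact tsum_eq_critical_add hR.zero (fun l hl => hR.left l hl _) (hf.summ_p k)

/-- The critical modes determine a solution: without them the reduced system has no source, so all
residuals `(Z - kπ) f k` vanish, and the resolvents recover `f`. -/
theorem SeqSol.eq_zero {Z : X →L[ℂ] X} {fm fp : ℤ → X} (hf : SeqSol a b Z fm fp)
    (hs : Small w a b n) (hR : IsResolvent n Z R) (hm0 : fm n = 0) (hp0 : fp n = 0) (k : ℤ) :
    fm k = 0 ∧ fp k = 0 := by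
  have hr := hf.reduced hR
  have h0 : Reduced a b n R (fm n) (fp n) (fun _ => 0) (fun _ => 0) := by
    refine ⟨⟨0, by simp⟩, fun k => ?_, fun k => ?_⟩
    · simp [hp0, cv]
    · simp [hm0, cv]
  by_cases hk : k = n
  · subst hk; exact ⟨hm0, hp0⟩
  have e1 := hr.unique_left h0 hs hR.bound k
  have e2 := hr.unique_right h0 hs hR.bound k
  constructor
  · rw [← hR.left k hk (fm k), e1, map_zero]
  · rw [← hR.left k hk (fp k), e2, map_zero]

end reduced

/-! ### The characteristic equation and the gap in one strip. -/

section scalar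

variable {w : ℤ → ℝ} {a b : ℤ → ℂ} {n : ℤ} {M : ℝ} {R R' : ℤ → ℂ →L[ℂ] ℂ} {h₁ h₂ g : ℤ → ℂ}

theorem clm_apply_eq (T : ℂ →L[ℂ] ℂ) (x : ℂ) : T x = x * T 1 := by
  have := T.map_smul x 1
  simpa using this

/-- The solution decays like `1/⟨n+l⟩` and the resolvent like `1/|l-n|`. The resulting absolute
summability justifies the exchange of sums in `tsum_cv_mul`. -/
theorem Half.summable_resolvent_mul (H₁ : Half a b n R 1 h₁) (hs : Small w a b n)
    (hR : ResBound n R) : Summable fun l => ‖h₁ l * R l 1‖ := by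
  have hb := H₁.bound hs hR
  have h2 : Summable fun j : ℤ => (bracket j)⁻¹ ^ 2 := hasSum_bracket_inv_sq.summable
  have h1 := (sum_mul_invDist (β := fun j => (bracket j)⁻¹)
    (fun j => inv_nonneg.2 (bracket_pos _).le) h2 n n).1
  refine Summable.of_nonneg_of_le (fun _ => norm_nonneg _) (fun l => ?_)
    (h1.mul_left (5 / 3 * (coefNorm w a * ‖(1 : ℂ)‖) * (2 / Real.pi)))
  have hbr := bracket_le_of_weightsOne hs.weight (n + l)
  have hp := bracket_pos ((n + l : ℤ) : ℝ)
  have e1 : ‖h₁ l‖ ≤ 5 / 3 * (coefNorm w a * ‖(1 : ℂ)‖) * (bracket ((n + l : ℤ) : ℝ))⁻¹ := by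
    rw [← div_eq_mul_inv, le_div_iff₀ hp]
    refine le_trans ?_ (hb l)
    rw [add_comm l n]
    exact mul_le_mul_of_nonneg_left hbr (norm_nonneg _)
  have e2 : ‖R l 1‖ ≤ 2 / Real.pi * invDist n l := by
    have := (R l).le_opNorm 1
    rw [norm_one, mul_one] at this
    exact this.trans (hR l)
  rw [norm_mul]
  calc _ ≤ _ := mul_le_mul e1 e2 (norm_nonneg _) ((norm_nonneg _).trans e1)
    _ = _ := by ring

/-- The kernel `a (l+m)` is symmetric, so the convolution is its own transpose for the bilinear
pairing weighted by `R`. -/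
theorem tsum_cv_mul (hw : w ∈ weightsOne) (ha : WSummable w a) (hR : ResBound n R)
    (hg : ∀ l, ‖g l‖ ≤ M) {h : ℤ → ℂ} (hu : Summable fun l => ‖h l * R l 1‖) :
    ∑' l, cv a R g l * (h l * R l 1) = ∑' m, g m * R m 1 * cv a R h m := by
  set F : ℤ → ℤ → ℂ := fun l m => a (l + m) * (g m * R m 1) * (h l * R l 1) with hF
  have hM : 0 ≤ M := (norm_nonneg _).trans (hg 0)
  have hA := coefNorm_nonneg w a
  have hin : ∀ l m, ‖F l m‖ ≤ ((w (l + m) * ‖a (l + m)‖) * invDist n m) *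
      (2 / Real.pi * M * ‖h l * R l 1‖) := by
    intro l m
    have e2 : ‖R m 1‖ ≤ 2 / Real.pi * invDist n m := by
      have := (R m).le_opNorm 1
      rw [norm_one, mul_one] at this
      exact this.trans (hR m)
    have e3 := norm_le_weight_mul (a := a) hw (l + m)
    have := weighted_nonneg hw a (l + m)
    have := invDist_nonneg n m
    rw [hF, norm_mul, norm_mul, norm_mul (g m)]
    calc _ ≤ (w (l + m) * ‖a (l + m)‖) * (M * (2 / Real.pi * invDist n m)) * ‖h l * R l 1‖ := by
          gcongr
          exact hg m
      _ = _ := by ring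
  have hsum : Summable (Function.uncurry F) := by
    refine Summable.of_norm ?_
    refine (summable_prod_of_nonneg fun _ => norm_nonneg _).2 ⟨fun l => ?_, ?_⟩
    · exact Summable.of_nonneg_of_le (fun _ => norm_nonneg _) (hin l)
        ((sum_mul_invDist (weighted_nonneg hw a) ha l n).1.mul_right _)
    · refine Summable.of_nonneg_of_le (fun _ => tsum_nonneg fun _ => norm_nonneg _) (fun l => ?_)
        (hu.mul_left (1.82 * coefNorm w a * (2 / Real.pi * M)))
      have hs := sum_mul_invDist (weighted_nonneg hw a) ha l n
      have h1 := Summable.tsum_le_tsum (hin l) (Summable.of_nonneg_of_le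
        (fun _ => norm_nonneg _) (hin l) (hs.1.mul_right _)) (hs.1.mul_right _)
      rw [tsum_mul_right] at h1
      refine h1.trans ?_
      have e : 1.82 * coefNorm w a * (2 / Real.pi * M) * ‖h l * R l 1‖ =
        1.82 * coefNorm w a * (2 / Real.pi * M * ‖h l * R l 1‖) := by ring
      rw [e]
      exact mul_le_mul_of_nonneg_right hs.2 (by positivity)
  have h1 : ∀ l, cv a R g l * (h l * R l 1) = ∑' m, F l m := by
    intro l
    unfold cv
    rw [← tsum_mul_right]
    refine tsum_congr fun m => ?_
    rw [clm_apply_eq (R m) (g m), smul_eq_mul]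
  have h2 : ∀ m, g m * R m 1 * cv a R h m = ∑' l, F l m := by
    intro m
    unfold cv
    rw [← tsum_mul_left]
    refine tsum_congr fun l => ?_
    rw [clm_apply_eq (R l) (h l), smul_eq_mul, hF, add_comm m l]
    ring
  simp_rw [h1, h2]
  exact (hsum.tsum_comm).symm

theorem cv_bounded (hw : w ∈ weightsOne) (ha : WSummable w a) (hR : ResBound n R)
    (hg : ∀ l, ‖g l‖ ≤ M) (l : ℤ) : ‖cv a R g l‖ ≤ 1.82 * coefNorm w a * (2 / Real.pi * M) :=
  NLS.norm_cv_le hw ha hR hg l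

/-- Replace `a (n+l)` by `h₁ l - cv a R (cv b R h₁) l` and transpose the second term. The result is
invariant under exchanging `(a, h₁)` with `(b, h₂)`. -/
theorem diag_eq (H₁ : Half a b n R 1 h₁) (H₂ : Half b a n R 1 h₂) (hs : Small w a b n)
    (hR : ResBound n R) :
    cv a R h₂ n = ∑' l, h₁ l * (h₂ l * R l 1) - ∑' m, cv b R h₁ m * R m 1 * cv a R h₂ m := by
  obtain ⟨M₁, hM₁⟩ := H₁.bdd
  have hu₂ := H₂.summable_resolvent_mul hs.symm hR
  have b1 := cv_bounded hs.weight hs.right hR hM₁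
  have b2 := cv_bounded hs.weight hs.left hR b1
  rw [← tsum_cv_mul hs.weight hs.left hR b1 hu₂, ← Summable.tsum_sub]
  · unfold cv
    refine tsum_congr fun l => ?_
    have e := H₁.eq l
    rw [clm_apply_eq (R l) (h₂ l)]
    have : h₁ l - cv a R (cv b R h₁) l = a (n + l) := by
      rw [e, add_comm l n]; simp
    change a (n + l) • (h₂ l * R l 1) = h₁ l * (h₂ l * R l 1) - cv a R (cv b R h₁) l * (h₂ l * R l 1)
    rw [← sub_mul, this, smul_eq_mul]
  · refine Summable.of_norm_bounded (hu₂.mul_left M₁) fun l => ?_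
    rw [norm_mul]
    gcongr
    exact hM₁ l
  · refine Summable.of_norm_bounded (hu₂.mul_left (1.82 * coefNorm w a * (2 / Real.pi *
      (1.82 * coefNorm w b * (2 / Real.pi * M₁))))) fun l => ?_
    rw [norm_mul]
    exact mul_le_mul_of_nonneg_right (b2 l) (norm_nonneg _)

/-- The two diagonal coefficients of the reduced problem agree. -/
theorem diag_symm (H₁ : Half a b n R 1 h₁) (H₂ : Half b a n R 1 h₂) (hs : Small w a b n)
    (hR : ResBound n R) : cv a R h₂ n = cv b R h₁ n := by
  rw [diag_eq H₁ H₂ hs hR, diag_eq H₂ H₁ hs.symm hR]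
  congr 1
  · exact tsum_congr fun l => by ring
  · exact tsum_congr fun l => by ring

theorem cv_smul (c : ℂ) (k : ℤ) : cv a R (fun l => c * g l) k = c * cv a R g k := by
  unfold cv
  rw [← tsum_mul_left]
  refine tsum_congr fun l => ?_
  rw [clm_apply_eq, clm_apply_eq (R l) (g l)]
  simp only [smul_eq_mul]; ring

theorem Half.smul (H₁ : Half a b n R 1 h₁) (c : ℂ) : Half a b n R c fun l => c * h₁ l := by
  obtain ⟨M, hM⟩ := H₁.bdd
  refine ⟨⟨‖c‖ * M, fun l => ?_⟩, fun k => ?_⟩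
  · rw [norm_mul]; gcongr; exact hM l
  · have : cv b R (fun l => c * h₁ l) = fun l => c * cv b R h₁ l := funext fun l => cv_smul c l
    rw [this, cv_smul]
    nth_rewrite 1 [H₁.eq k]
    simp only [smul_eq_mul]; ring

/-- The characteristic equation of the reduced two dimensional problem. -/
theorem SeqSol.quadratic {z : ℂ} {fm fp : ℤ → ℂ}
    (hf : SeqSol a b (z • ContinuousLinearMap.id ℂ ℂ) fm fp) (hs : Small w a b n)
    (hR : IsResolvent n (z • ContinuousLinearMap.id ℂ ℂ) R) (H₁ : Half a b n R 1 h₁)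
    (H₂ : Half b a n R 1 h₂) (hne : ∃ k, fm k ≠ 0 ∨ fp k ≠ 0) :
    (z - n * Real.pi - cv a R h₂ n) ^ 2 = h₁ n * h₂ n := by
  have hr := hf.reduced hR
  have hr' := Reduced.of_half hs hR.bound (H₁.smul (fp n)) (H₂.smul (fm n))
  have e1 := hr.unique_left hr' hs hR.bound n
  have e2 := hr.unique_right hr' hs hR.bound n
  rw [cv_smul] at e1 e2
  rw [← diag_symm H₁ H₂ hs hR.bound] at e2
  simp only [smul_apply, ContinuousLinearMap.id_apply, smul_eq_mul] at e1 e2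
  -- By `e1` and `e2` the critical modes form a kernel vector of the 2×2 matrix with diagonal
  -- entries `z - nπ - d` and off-diagonal entries `-h₁ n`, `-h₂ n`. Since this vector is nonzero,
  -- the determinant vanishes.
  have h0 : fm n ≠ 0 ∨ fp n ≠ 0 := by
    by_contra! h
    obtain ⟨k, hk⟩ := hne
    have := hf.eq_zero hs hR h.1 h.2 k
    tauto
  set d := cv a R h₂ n
  rcases h0 with h0 | h0
  · refine mul_right_cancel₀ h0 ?_
    linear_combination (z - n * Real.pi - d) * e1 + h₁ n * e2
  · refine mul_right_cancel₀ h0 ?_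
    linear_combination (z - n * Real.pi - d) * e2 + h₂ n * e1

/-- Nontrivial solutions in the strip lie in a small disc. -/
theorem SeqSol.norm_sub_le {z : ℂ} {fm fp : ℤ → ℂ}
    (hf : SeqSol a b (z • ContinuousLinearMap.id ℂ ℂ) fm fp) (hs : Small w a b n)
    (hz : |z.re - n * Real.pi| ≤ Real.pi / 2) (hne : ∃ k, fm k ≠ 0 ∨ fp k ≠ 0) :
    ‖z - n * Real.pi‖ ≤ 3 / 4 := by
  obtain ⟨R, hR⟩ : ∃ R, IsResolvent n (z • ContinuousLinearMap.id ℂ ℂ) R :=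
    ⟨_, exists_resolvent_scalar hz⟩
  obtain ⟨h₁, H₁⟩ := Half.exists hs hR.bound (1 : ℂ)
  obtain ⟨h₂, H₂⟩ := Half.exists hs.symm hR.bound (1 : ℂ)
  have hq := hf.quadratic hs hR H₁ H₂ hne
  have h1 := H₁.norm_self_le hs hR.bound
  have h2 := H₂.norm_self_le hs.symm hR.bound
  have h3 := H₂.cross hs.symm hR.bound
  rw [norm_one, mul_one] at h1 h2 h3
  set d := cv a R h₂ n
  have h4 : ‖z - n * Real.pi - d‖ ≤ 0.6 := by
    refine (pow_le_pow_iff_left₀ (norm_nonneg _) (by norm_num) two_ne_zero).1 ?_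
    rw [← norm_pow, hq, norm_mul, pow_two]
    gcongr
  calc ‖z - n * Real.pi‖ = ‖(z - n * Real.pi - d) + d‖ := by rw [sub_add_cancel]
    _ ≤ 0.6 + 0.11 := (norm_add_le _ _).trans (add_le_add h4 h3)
    _ ≤ _ := by norm_num

theorem mul_mul_add_le {p q : ℝ} (hp : 0 ≤ p) (hq : 0 ≤ q) :
    1024 / 9 * (p * q) * (p + q) ≤ 29 * (p + q) ^ 3 := by
  have h1 : p * q * (p + q) ≤ (p + q) ^ 2 / 4 * (p + q) :=
    mul_le_mul_of_nonneg_right (by linarith [sq_nonneg (p - q)]) (by positivity)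
  have h2 : 0 ≤ (p + q) ^ 3 := by positivity
  linarith

/-- The gap estimate for a single strip. -/
theorem gap_le {z z' : ℂ} {fm fp fm' fp' : ℤ → ℂ} (hs : Small w a b n)
    (hf : SeqSol a b (z • ContinuousLinearMap.id ℂ ℂ) fm fp)
    (hz : |z.re - n * Real.pi| ≤ Real.pi / 2) (hne : ∃ k, fm k ≠ 0 ∨ fp k ≠ 0)
    (hf' : SeqSol a b (z' • ContinuousLinearMap.id ℂ ℂ) fm' fp')
    (hz' : |z'.re - n * Real.pi| ≤ Real.pi / 2) (hne' : ∃ k, fm' k ≠ 0 ∨ fp' k ≠ 0) :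
    w (2 * n) ^ 2 * ‖z - z'‖ ^ 2 ≤ 6 * (w (2 * n) ^ 2 * (‖a (2 * n)‖ ^ 2 + ‖b (2 * n)‖ ^ 2)) +
      288 * (coefNorm w a ^ 2 + coefNorm w b ^ 2) ^ 3 / bracket n ^ 2 := by
  obtain ⟨R, hR⟩ : ∃ R, IsResolvent n (z • ContinuousLinearMap.id ℂ ℂ) R :=
    ⟨_, exists_resolvent_scalar hz⟩
  obtain ⟨R', hR'⟩ : ∃ R, IsResolvent n (z' • ContinuousLinearMap.id ℂ ℂ) R :=
    ⟨_, exists_resolvent_scalar hz'⟩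
  obtain ⟨h₁, H₁⟩ := Half.exists hs hR.bound (1 : ℂ)
  obtain ⟨h₂, H₂⟩ := Half.exists hs.symm hR.bound (1 : ℂ)
  obtain ⟨h₁', H₁'⟩ := Half.exists hs hR'.bound (1 : ℂ)
  obtain ⟨h₂', H₂'⟩ := Half.exists hs.symm hR'.bound (1 : ℂ)
  have hq := hf.quadratic hs hR H₁ H₂ hne
  have hq' := hf'.quadratic hs hR' H₁' H₂' hne'
  have hδ : ‖z • ContinuousLinearMap.id ℂ ℂ - z' • ContinuousLinearMap.id ℂ ℂ‖ = ‖z - z'‖ := by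
    have e : (z • ContinuousLinearMap.id ℂ ℂ - z' • ContinuousLinearMap.id ℂ ℂ : ℂ →L[ℂ] ℂ) =
        (z - z') • ContinuousLinearMap.id ℂ ℂ := (sub_smul _ _ _).symm
    rw [e, norm_smul, ContinuousLinearMap.norm_id, mul_one]
  have hD := hR.norm_sub_le hR'
  rw [hδ] at hD
  have hlip := H₂.cross_lip H₂' hs.symm hR.bound hR'.bound (norm_nonneg _) hD
  have l1 := H₁.lead hs hR.bound
  have l2 := H₂.lead hs.symm hR.bound
  have l1' := H₁'.lead hs hR'.bound
  have l2' := H₂'.lead hs.symm hR'.bound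
  set d := cv a R h₂ n
  set d' := cv a R' h₂' n
  rw [norm_one, mul_one] at hlip l1 l2 l1' l2'
  simp only [smul_eq_mul, mul_one] at l1 l2 l1' l2'
  have hw := weight_pos hs.weight (2 * n)
  have hn := bracket_pos (n : ℝ)
  set A := coefNorm w a
  set B := coefNorm w b
  set W := w (2 * n)
  set ea := 32 / 3 * (A ^ 2 * B) / bracket n
  set eb := 32 / 3 * (B ^ 2 * A) / bracket n
  have key : ∀ c c₀ : ℂ, ∀ e : ℝ, ‖c - c₀‖ * W ≤ e → W ^ 2 * ‖c‖ ^ 2 ≤ 2 * (W ^ 2 * ‖c₀‖ ^ 2) + 2 * e ^ 2 := by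
    intro c c₀ e he
    have h1 : ‖c‖ ≤ ‖c₀‖ + ‖c - c₀‖ := by
      have := norm_add_le c₀ (c - c₀)
      rwa [add_sub_cancel] at this
    have h2 : W * ‖c‖ ≤ W * ‖c₀‖ + e := by nlinarith
    have h3 : (W * ‖c‖) ^ 2 ≤ (W * ‖c₀‖ + e) ^ 2 := by gcongr
    linarith [sq_nonneg (W * ‖c₀‖ - e)]
  have k1 := key _ _ _ l1
  have k2 := key _ _ _ l2
  have k1' := key _ _ _ l1'
  have k2' := key _ _ _ l2'
  have x1 : ‖z - n * Real.pi - d‖ ^ 2 = ‖h₁ n‖ * ‖h₂ n‖ := by rw [← norm_pow, hq, norm_mul]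
  have x2 : ‖z' - n * Real.pi - d'‖ ^ 2 = ‖h₁' n‖ * ‖h₂' n‖ := by rw [← norm_pow, hq', norm_mul]
  set ξ := ‖z - n * Real.pi - d‖
  set ξ' := ‖z' - n * Real.pi - d'‖
  -- `‖d - d'‖ ≤ 0.16 ‖z - z'‖` is absorbed on the left.
  have hγ : 0.84 * ‖z - z'‖ ≤ ξ + ξ' := by
    have : z - z' = (z - n * Real.pi - d) - (z' - n * Real.pi - d') + (d - d') := by ring
    have h1 : ‖z - z'‖ ≤ ξ + ξ' + ‖d - d'‖ := by
      nth_rewrite 1 [this]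
      exact (norm_add_le _ _).trans (add_le_add (norm_sub_le _ _) le_rfl)
    linarith
  have hγ2 : (0.84 * ‖z - z'‖) ^ 2 ≤ (ξ + ξ') ^ 2 := by gcongr
  have hγ3 : 0.7056 * ‖z - z'‖ ^ 2 ≤ ‖h₁ n‖ ^ 2 + ‖h₂ n‖ ^ 2 + ‖h₁' n‖ ^ 2 + ‖h₂' n‖ ^ 2 := by
    linarith [sq_nonneg (ξ - ξ'), sq_nonneg (‖h₁ n‖ - ‖h₂ n‖), sq_nonneg (‖h₁' n‖ - ‖h₂' n‖)]
  have hγ4 := mul_le_mul_of_nonneg_left hγ3 (sq_nonneg W)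
  -- `(32/3)² = 1024/9`, and `pq ≤ (p+q)²/4` leaves `256/9 < 29`.
  have herr : ea ^ 2 + eb ^ 2 ≤ 29 * ((A ^ 2 + B ^ 2) ^ 3 / bracket n ^ 2) := by
    have e : ea ^ 2 + eb ^ 2 = (1024 / 9 * (A ^ 2 * B ^ 2) * (A ^ 2 + B ^ 2)) / bracket n ^ 2 := by
      simp only [ea, eb]; field_simp; ring
    rw [e, mul_div_assoc']
    refine div_le_div_of_nonneg_right ?_ (sq_nonneg _)
    exact mul_mul_add_le (sq_nonneg A) (sq_nonneg B)
  have hpos : 0 ≤ (A ^ 2 + B ^ 2) ^ 3 / bracket n ^ 2 := by positivity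
  have hpos2 : 0 ≤ W ^ 2 * ‖a (2 * n)‖ ^ 2 := by positivity
  have hpos3 : 0 ≤ W ^ 2 * ‖b (2 * n)‖ ^ 2 := by positivity
  -- Four instances of `key` give `4` times the main term and `4 · 29` times the error. Division by
  -- `0.7056 = 0.84²` leaves less than `6` and `288`.
  rw [mul_div_assoc]
  linarith

end scalar

/-! ### An operator on the plane that carries the two eigenvalues of a strip. -/

/-- The plane `ℂ²` with the sum norm. -/
abbrev Plane : Type := WithLp 1 (ℂ × ℂ)

section block

variable {w : ℤ → ℝ} {a b : ℤ → ℂ} {n : ℤ}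

theorem norm_sum_prod {X Y : Type*} [NormedAddCommGroup X] [NormedAddCommGroup Y]
    (x : WithLp 1 (X × Y)) : ‖x‖ = ‖x.fst‖ + ‖x.snd‖ := by
  have := WithLp.prod_norm_eq_of_nat (p := 1) 1 (by simp) x
  simpa using this

/-- The first basis vector. -/
def ebm : Plane := WithLp.toLp 1 (1, 0)

/-- The second basis vector. -/
def ebp : Plane := WithLp.toLp 1 (0, 1)

theorem norm_ebm : ‖ebm‖ = 1 := by simp [ebm]

theorem norm_ebp : ‖ebp‖ = 1 := by simp [ebp]

theorem plane_eq (x : Plane) : x = x.fst • ebm + x.snd • ebp := by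
  apply WithLp.ofLp_injective
  ext <;> simp [ebm, ebp]

/-- The linear operator on the plane with given images of the basis vectors. -/
def planeMap (u v : Plane) : Plane →L[ℂ] Plane :=
  (WithLp.fstL 1 ℂ ℂ ℂ).smulRight u + (WithLp.sndL 1 ℂ ℂ ℂ).smulRight v

theorem planeMap_apply (u v x : Plane) : planeMap u v x = x.fst • u + x.snd • v := rfl

/-- In the sum norm the operator norm is governed by the larger column; hence the choice of this
norm on the plane. -/
theorem norm_planeMap_sub_le {u v u' v' : Plane} {C : ℝ} (hC : 0 ≤ C) (hu : ‖u - u'‖ ≤ C)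
    (hv : ‖v - v'‖ ≤ C) : ‖planeMap u v - planeMap u' v'‖ ≤ C := by
  refine ContinuousLinearMap.opNorm_le_bound _ hC fun x => ?_
  have e : (planeMap u v - planeMap u' v') x = x.fst • (u - u') + x.snd • (v - v') := by
    rw [sub_apply, planeMap_apply, planeMap_apply]; module
  rw [e, norm_sum_prod x, mul_add]
  refine (norm_add_le _ _).trans (add_le_add ?_ ?_)
  · rw [norm_smul, mul_comm]; gcongr
  · rw [norm_smul, mul_comm]; gcongr

theorem planeMap_zero : planeMap 0 0 = 0 := by
  ext x; simp [planeMap]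

/-- There is a two dimensional invariant subspace close to the critical modes: an operator `Z` on
the plane close to `nπ` with a plane-valued solution of `L(φ) f = Z f`. -/
theorem exists_planeMap (hs : Small w a b n) : ∃ (Z : Plane →L[ℂ] Plane)
    (R : ℤ → Plane →L[ℂ] Plane) (hm hp : ℤ → Plane),
    ‖Z - ((n : ℂ) * Real.pi) • ContinuousLinearMap.id ℂ Plane‖ ≤ 3 / 4 ∧ IsResolvent n Z R ∧
    Reduced a b n R ebm ebp hm hp ∧ Z ebm = ((n : ℂ) * Real.pi) • ebm + hm n ∧
    Z ebp = ((n : ℂ) * Real.pi) • ebp + hp n := by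
  set Z₀ : Plane →L[ℂ] Plane := ((n : ℂ) * Real.pi) • ContinuousLinearMap.id ℂ Plane with hZ₀
  have hpi := Real.pi_gt_three
  have hex : ∀ Z : Plane →L[ℂ] Plane, ‖Z - Z₀‖ ≤ 3 / 4 → ∃ (R : ℤ → Plane →L[ℂ] Plane)
      (hm hp : ℤ → Plane), IsResolvent n Z R ∧ Reduced a b n R ebm ebp hm hp := by
    intro Z hZ
    obtain ⟨R, hR⟩ := exists_resolvent (n := n) (Z := Z) (hZ.trans (by linarith))
    obtain ⟨hm, hp, h⟩ := Reduced.exists hs hR.bound ebm ebp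
    exact ⟨R, hm, hp, hR, h⟩
  choose! R hm hp hRes hRed using hex
  let S : Set (Plane →L[ℂ] Plane) := {Z | ‖Z - Z₀‖ ≤ 3 / 4}
  -- A fixed point means `(Z - nπ) ebm = hm n` and `(Z - nπ) ebp = hp n`, which are precisely the
  -- equations at the critical index that the reduced system leaves open.
  let F : (Plane →L[ℂ] Plane) → (Plane →L[ℂ] Plane) := fun Z => Z₀ + planeMap (hm Z n) (hp Z n)
  have hSc : IsClosed S := isClosed_le (by fun_prop) continuous_const
  have hmaps : Set.MapsTo F S S := by
    intro Z hZ
    change ‖Z₀ + planeMap (hm Z n) (hp Z n) - Z₀‖ ≤ 3 / 4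
    rw [add_sub_cancel_left]
    have h1 := (hRed Z hZ).norm_self_le hs (hRes Z hZ).bound norm_ebm.le norm_ebp.le
    have h2 := (hRed Z hZ).symm.norm_self_le hs.symm (hRes Z hZ).bound norm_ebp.le norm_ebm.le
    have := norm_planeMap_sub_le (u := hm Z n) (v := hp Z n) (u' := 0) (v' := 0)
      (by norm_num : (0 : ℝ) ≤ 3 / 4) (by simpa using h1) (by simpa using h2)
    rwa [planeMap_zero, sub_zero] at this
  have hcontr : ContractingWith (3 / 4 : NNReal) (hmaps.restrict F S S) := by
    refine ⟨by rw [← NNReal.coe_lt_coe]; norm_num, LipschitzWith.of_dist_le_mul fun Z Z' => ?_⟩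
    rw [Subtype.dist_eq, Subtype.dist_eq, dist_eq_norm, dist_eq_norm]
    change ‖(Z₀ + planeMap (hm Z n) (hp Z n)) - (Z₀ + planeMap (hm Z' n) (hp Z' n))‖ ≤ _
    rw [add_sub_add_left_eq_sub]
    have hD := (hRes Z Z.2).norm_sub_le (hRes Z' Z'.2)
    have h1 := (hRed Z Z.2).norm_self_lip (hRed Z' Z'.2) hs (hRes Z Z.2).bound (hRes Z' Z'.2).bound
      (norm_nonneg _) hD norm_ebm.le norm_ebp.le
    have h2 := (hRed Z Z.2).symm.norm_self_lip (hRed Z' Z'.2).symm hs.symm (hRes Z Z.2).bound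
      (hRes Z' Z'.2).bound (norm_nonneg _) hD norm_ebp.le norm_ebm.le
    simpa using norm_planeMap_sub_le (by positivity) h1 h2
  obtain ⟨Z, hZS, hZ, -⟩ := ContractingWith.exists_fixedPoint' hSc.isComplete hmaps hcontr
    (x := Z₀) (by simp only [S, Set.mem_ofPred_eq, sub_self, norm_zero]; norm_num) (edist_ne_top _ _)
  refine ⟨Z, R Z, hm Z, hp Z, hZS, hRes Z hZS, hRed Z hZS, ?_, ?_⟩
  · have : Z ebm = F Z ebm := by rw [hZ]
    rw [this]
    simp [F, Z₀, planeMap_apply, ebm]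
  · have : Z ebp = F Z ebp := by rw [hZ]
    rw [this]
    simp [F, Z₀, planeMap_apply, ebp]

end block

/-! ### From the reduced system back to the full equation. -/

section assemble

variable {X : Type*} [NormedAddCommGroup X] [NormedSpace ℂ X] [CompleteSpace X]
  {w : ℤ → ℝ} {a b : ℤ → ℂ} {n : ℤ} {R : ℤ → X →L[ℂ] X} {pm pp : X} {hm hp : ℤ → X}
  {Z : X →L[ℂ] X}

/-- The sequence `(Z - lπ)⁻¹ h_l`, `l ≠ n`, completed by the value `p` at `n`. -/
def complete (n : ℤ) (R : ℤ → X →L[ℂ] X) (p : X) (h : ℤ → X) : ℤ → X :=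
  Function.update (fun l => R l (h l)) n p

theorem complete_self (p : X) (h : ℤ → X) : complete n R p h n = p := by simp [complete]

theorem complete_of_ne (p : X) (h : ℤ → X) {l : ℤ} (hl : l ≠ n) :
    complete n R p h l = R l (h l) := by simp [complete, hl]

theorem summable_smul_complete {w : ℤ → ℝ} (hw : w ∈ weightsOne) (ha : WSummable w a)
    (hR : ResBound n R) {h : ℤ → X} {M : ℝ} (hh : ∀ l, ‖h l‖ ≤ M) (p : X) (k : ℤ) :
    Summable fun l => a (k + l) • complete n R p h l := by
  have h1 := (cv_summable hw ha hR hh k).update n (a (k + n) • p)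
  refine h1.congr fun l => ?_
  by_cases hl : l = n
  · subst hl; simp [complete]
  · simp [complete, hl]

theorem IsResolvent.sub_complete (hR : IsResolvent n Z R) {p : X} {h : ℤ → X}
    (hp : Z p = ((n : ℂ) * Real.pi) • p + h n) (k : ℤ) :
    Z (complete n R p h k) - ((k : ℂ) * Real.pi) • complete n R p h k = h k := by
  by_cases hk : k = n
  · subst hk
    rw [complete_self, hp]; abel
  · rw [complete_of_ne _ _ hk, hR.right k hk]

theorem Reduced.seqSol (hr : Reduced a b n R pm pp hm hp) (hs : Small w a b n)
    (hR : IsResolvent n Z R) (em : Z pm = ((n : ℂ) * Real.pi) • pm + hm n)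
    (ep : Z pp = ((n : ℂ) * Real.pi) • pp + hp n) :
    SeqSol a b Z (complete n R pm hm) (complete n R pp hp) := by
  obtain ⟨M, hM⟩ := hr.bdd
  have s1 := summable_smul_complete hs.weight hs.left hR.bound (fun l => (hM l).2) pp
  have s2 := summable_smul_complete hs.weight hs.right hR.bound (fun l => (hM l).1) pm
  refine ⟨s1, s2, ⟨M, fun k => ?_⟩, fun k => ?_, fun k => ?_⟩
  · rw [hR.sub_complete em, hR.sub_complete ep]; exact hM k
  · rw [hR.sub_complete em, tsum_eq_critical_add (h := hp) hR.zero
      (fun l hl => (complete_of_ne pp hp hl).symm) (s1 k), complete_self, hr.eqm k]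
  · rw [hR.sub_complete ep, tsum_eq_critical_add (h := hm) hR.zero
      (fun l hl => (complete_of_ne pm hm hl).symm) (s2 k), complete_self, hr.eqp k]

/-- Decay of `hm` times decay of the resolvents is absolutely summable, so the Fourier series built
from these coefficients are continuous functions. -/
theorem Reduced.summable_norm_complete (hr : Reduced a b n R pm pp hm hp) (hs : Small w a b n)
    (hR : ResBound n R) : Summable fun l => ‖complete n R pm hm l‖ := by
  obtain ⟨C, hC⟩ := hr.decay hs hR
  have h2 : Summable fun j : ℤ => (bracket j)⁻¹ ^ 2 := hasSum_bracket_inv_sq.summable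
  have h1 := fun k => (sum_mul_invDist (β := fun j => (bracket j)⁻¹)
    (fun j => inv_nonneg.2 (bracket_pos _).le) h2 k n).1
  have h3 : Summable fun l => ‖R l (hm l)‖ := by
    refine Summable.of_nonneg_of_le (fun _ => norm_nonneg _) (fun l => ?_)
      (((h1 n).add (h1 (-n))).mul_left (2 / Real.pi * C))
    have := (R l).le_opNorm_of_le (hC l)
    refine this.trans ?_
    have e : (0 : ℝ) ≤ C * ((bracket (l + n))⁻¹ + (bracket (l - n))⁻¹) :=
      (norm_nonneg _).trans (hC l)
    refine (mul_le_mul_of_nonneg_right (hR l) e).trans (le_of_eq ?_)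
    push_cast
    rw [add_comm (n : ℝ) l, neg_add_eq_sub]
    ring
  refine ((h3.update n ‖pm‖)).congr fun l => ?_
  by_cases hl : l = n
  · subst hl; simp [complete]
  · simp [complete, hl]

end assemble

/-! ### Absence of further root vectors. -/

section augment

variable {w : ℤ → ℝ} {a b : ℤ → ℂ} {n : ℤ} {z : ℂ} {Z : Plane →L[ℂ] Plane} {Fm Fp : ℤ → Plane}
  {y : Plane →L[ℂ] ℂ} {gm gp : ℤ → ℂ}

/-- The plane with an additional dimension. -/
abbrev AugPlane : Type := WithLp 1 (Plane × ℂ)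

/-- The triangular operator `(ξ, η) ↦ (Z ξ, y ξ + z η)`. -/
def augMap (Z : Plane →L[ℂ] Plane) (y : Plane →L[ℂ] ℂ) (z : ℂ) : AugPlane →L[ℂ] AugPlane :=
  (WithLp.prodContinuousLinearEquiv 1 ℂ Plane ℂ).symm.toContinuousLinearMap.comp
    ((Z.comp (WithLp.fstL 1 ℂ Plane ℂ)).prod
      (y.comp (WithLp.fstL 1 ℂ Plane ℂ) + z • WithLp.sndL 1 ℂ Plane ℂ))

theorem norm_augMap_sub_le (hZ : ‖Z - ((n : ℂ) * Real.pi) • ContinuousLinearMap.id ℂ Plane‖ ≤ 3 / 4)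
    (hz : ‖z - n * Real.pi‖ ≤ 3 / 4) (hy : ‖y‖ ≤ 1 / 2) :
    ‖augMap Z y z - ((n : ℂ) * Real.pi) • ContinuousLinearMap.id ℂ AugPlane‖ ≤ Real.pi / 2 := by
  have hpi := Real.pi_gt_three
  refine ContinuousLinearMap.opNorm_le_bound _ (by positivity) fun x => ?_
  have e : (augMap Z y z - ((n : ℂ) * Real.pi) • ContinuousLinearMap.id ℂ AugPlane) x =
      WithLp.toLp 1 ((Z - ((n : ℂ) * Real.pi) • ContinuousLinearMap.id ℂ Plane) x.fst,
        y x.fst + (z - n * Real.pi) * x.snd) := by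
    apply WithLp.ofLp_injective
    refine Prod.ext rfl ?_
    change (y x.fst + z * x.snd) - ((n : ℂ) * Real.pi) * x.snd = _
    ring
  rw [e, norm_sum_prod, norm_sum_prod x]
  change ‖(Z - ((n : ℂ) * Real.pi) • ContinuousLinearMap.id ℂ Plane) x.fst‖ +
    ‖y x.fst + (z - n * Real.pi) * x.snd‖ ≤ _
  have h1 := (Z - ((n : ℂ) * Real.pi) • ContinuousLinearMap.id ℂ Plane).le_of_opNorm_le hZ x.fst
  have h2 := y.le_of_opNorm_le hy x.fst
  have h3 : ‖(z - n * Real.pi) * x.snd‖ ≤ 3 / 4 * ‖x.snd‖ := by rw [norm_mul]; gcongr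
  have h4 := norm_add_le (y x.fst) ((z - n * Real.pi) * x.snd)
  have h5 := norm_nonneg x.fst
  have h6 := norm_nonneg x.snd
  nlinarith

theorem seqSol_augMap (hF : SeqSol a b Z Fm Fp)
    (sm : ∀ k, Summable fun l => a (k + l) • gp l) (sp : ∀ k, Summable fun l => b (k + l) • gm l)
    (hb : ∃ M, ∀ k : ℤ, ‖y (Fm k) + z * gm k - k * Real.pi * gm k‖ ≤ M ∧
      ‖y (Fp k) + z * gp k - k * Real.pi * gp k‖ ≤ M)
    (em : ∀ k : ℤ, y (Fm k) + z * gm k - k * Real.pi * gm k = ∑' l, a (k + l) • gp l)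
    (ep : ∀ k : ℤ, y (Fp k) + z * gp k - k * Real.pi * gp k = ∑' l, b (k + l) • gm l) :
    SeqSol a b (augMap Z y z) (fun k => WithLp.toLp 1 (Fm k, gm k))
      (fun k => WithLp.toLp 1 (Fp k, gp k)) := by
  have hsum : ∀ {c : ℤ → ℂ} {F : ℤ → Plane} {g : ℤ → ℂ} {k : ℤ},
      (Summable fun l => c (k + l) • F l) → (Summable fun l => c (k + l) • g l) →
      HasSum (fun l => c (k + l) • (WithLp.toLp 1 (F l, g l) : AugPlane))
        (WithLp.toLp 1 (∑' l, c (k + l) • F l, ∑' l, c (k + l) • g l)) := by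
    intro c F g k h1 h2
    exact (WithLp.prodContinuousLinearEquiv 1 ℂ Plane ℂ).symm.toContinuousLinearMap.hasSum
      (h1.hasSum.prodMk h2.hasSum)
  have hval : ∀ (k : ℤ) (p : Plane) (q : ℂ), augMap Z y z (WithLp.toLp 1 (p, q)) -
      ((k : ℂ) * Real.pi) • (WithLp.toLp 1 (p, q) : AugPlane) =
      WithLp.toLp 1 (Z p - ((k : ℂ) * Real.pi) • p, y p + z * q - k * Real.pi * q) := by
    intro k p q; rfl
  refine ⟨fun k => (hsum (hF.summ_m k) (sm k)).summable,
    fun k => (hsum (hF.summ_p k) (sp k)).summable, ?_, fun k => ?_, fun k => ?_⟩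
  · obtain ⟨M, hM⟩ := hb
    obtain ⟨M', hM'⟩ := hF.bdd
    refine ⟨M' + M, fun k => ?_⟩
    have hn : ∀ (p : Plane) (q : ℂ), ‖(WithLp.toLp 1 (p, q) : AugPlane)‖ = ‖p‖ + ‖q‖ :=
      fun p q => norm_sum_prod _
    rw [hval, hval, hn, hn]
    exact ⟨add_le_add (hM' k).1 (hM k).1, add_le_add (hM' k).2 (hM k).2⟩
  · rw [hval, hF.eqm k, em k]
    exact (hsum (hF.summ_m k) (sm k)).tsum_eq.symm
  · rw [hval, hF.eqp k, ep k]
    exact (hsum (hF.summ_p k) (sp k)).tsum_eq.symm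

theorem norm_augMap_sub_augMap_le {m : ℝ} (h1 : ‖y ebm‖ ≤ m) (h2 : ‖y ebp‖ ≤ m) :
    ‖augMap Z y z - augMap Z 0 z‖ ≤ m := by
  refine ContinuousLinearMap.opNorm_le_bound _ ((norm_nonneg _).trans h1) fun x => ?_
  have e : (augMap Z y z - augMap Z 0 z) x = WithLp.toLp 1 (0, y x.fst) := by
    apply WithLp.ofLp_injective
    refine Prod.ext (sub_self _) ?_
    change (y x.fst + z * x.snd) - (0 + z * x.snd) = _
    ring
  rw [e, norm_sum_prod, norm_sum_prod x]
  change ‖(0 : Plane)‖ + ‖y x.fst‖ ≤ _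
  have e2 : y x.fst = x.fst.fst * y ebm + x.fst.snd * y ebp := by
    conv_lhs => rw [plane_eq x.fst, map_add, map_smul, map_smul]
    rfl
  rw [norm_zero, zero_add, e2, norm_sum_prod x.fst, mul_add, mul_add]
  have h3 := norm_add_le (x.fst.fst * y ebm) (x.fst.snd * y ebp)
  rw [norm_mul, norm_mul] at h3
  have h4 : ‖x.fst.fst‖ * ‖y ebm‖ ≤ m * ‖x.fst.fst‖ := by rw [mul_comm]; gcongr
  have h5 : ‖x.fst.snd‖ * ‖y ebp‖ ≤ m * ‖x.fst.snd‖ := by rw [mul_comm]; gcongr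
  have h6 := mul_nonneg ((norm_nonneg _).trans h1) (norm_nonneg x.snd)
  linarith

/-- The sequences `(F, g)` and `(F, 0)` solve the equations for the triangular operators with corner
`y` and `0`, and have the same critical modes. Their residuals at `n` differ by `(0, y ebm)` and
`(0, y ebp)`, so the Lipschitz bound gives `m ≤ 3/4 · m` for `m = max ‖y ebm‖ ‖y ebp‖`. -/
theorem dual_eq_zero_of_small (hs : Small w a b n) (hF : SeqSol a b Z Fm Fp) (hFm : Fm n = ebm)
    (hFp : Fp n = ebp)
    (hZ : ‖Z - ((n : ℂ) * Real.pi) • ContinuousLinearMap.id ℂ Plane‖ ≤ 3 / 4)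
    (hz : ‖z - n * Real.pi‖ ≤ 3 / 4) (hy : ‖y‖ ≤ 1 / 2) (gm0 : gm n = 0) (gp0 : gp n = 0)
    (sm : ∀ k, Summable fun l => a (k + l) • gp l) (sp : ∀ k, Summable fun l => b (k + l) • gm l)
    (hb : ∃ M, ∀ k : ℤ, ‖y (Fm k) + z * gm k - k * Real.pi * gm k‖ ≤ M ∧
      ‖y (Fp k) + z * gp k - k * Real.pi * gp k‖ ≤ M)
    (em : ∀ k : ℤ, y (Fm k) + z * gm k - k * Real.pi * gm k = ∑' l, a (k + l) • gp l)
    (ep : ∀ k : ℤ, y (Fp k) + z * gp k - k * Real.pi * gp k = ∑' l, b (k + l) • gm l) :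
    y = 0 := by
  have S1 := seqSol_augMap hF sm sp hb em ep
  have S2 : SeqSol a b (augMap Z 0 z) (fun k => WithLp.toLp 1 (Fm k, 0))
      (fun k => WithLp.toLp 1 (Fp k, 0)) :=
    seqSol_augMap hF (fun k => by simp)
      (fun k => by simp) ⟨0, by simp⟩ (by simp) (by simp)
  obtain ⟨R, hR⟩ := exists_resolvent (norm_augMap_sub_le hZ hz hy)
  obtain ⟨R', hR'⟩ := exists_resolvent (norm_augMap_sub_le (y := 0) hZ hz (by simp))
  have r1 := S1.reduced hR
  have r2 := S2.reduced hR'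
  rw [gm0, gp0, hFm, hFp] at r1
  rw [hFm, hFp] at r2
  have nm : ‖(WithLp.toLp 1 (ebm, 0) : AugPlane)‖ ≤ 1 := by simp [norm_ebm]
  have np : ‖(WithLp.toLp 1 (ebp, 0) : AugPlane)‖ ≤ 1 := by simp [norm_ebp]
  set m := max ‖y ebm‖ ‖y ebp‖ with hm
  have hA := norm_augMap_sub_augMap_le (Z := Z) (z := z) (le_max_left ‖y ebm‖ ‖y ebp‖)
    (le_max_right ‖y ebm‖ ‖y ebp‖)
  have hD := hR.norm_sub_le hR'
  have l1 := r1.norm_self_lip r2 hs hR.bound hR'.bound (norm_nonneg _) hD nm np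
  have l2 := r1.symm.norm_self_lip r2.symm hs.symm hR.bound hR'.bound (norm_nonneg _) hD np nm
  have ev : ∀ p : Plane, ((augMap Z y z) (WithLp.toLp 1 (p, 0)) -
      ((n : ℂ) * Real.pi) • (WithLp.toLp 1 (p, 0) : AugPlane)) -
      ((augMap Z 0 z) (WithLp.toLp 1 (p, 0)) -
      ((n : ℂ) * Real.pi) • (WithLp.toLp 1 (p, 0) : AugPlane)) = WithLp.toLp 1 (0, y p) := by
    intro p
    apply WithLp.ofLp_injective
    refine Prod.ext (sub_self _) ?_
    change ((y p + z * 0) - (n : ℂ) * Real.pi * 0) - ((0 + z * 0) - (n : ℂ) * Real.pi * 0) = _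
    ring
  simp only [gm0, gp0, hFm, hFp] at l1 l2
  rw [ev, norm_sum_prod] at l1 l2
  change ‖(0 : Plane)‖ + ‖y ebm‖ ≤ _ at l1
  change ‖(0 : Plane)‖ + ‖y ebp‖ ≤ _ at l2
  rw [norm_zero, zero_add] at l1 l2
  have hm0 : m ≤ 0 := by
    have : m ≤ 3 / 4 * m := max_le (l1.trans (by gcongr)) (l2.trans (by gcongr))
    linarith
  have z1 : y ebm = 0 := norm_le_zero_iff.1 ((le_max_left _ _).trans hm0)
  have z2 : y ebp = 0 := norm_le_zero_iff.1 ((le_max_right _ _).trans hm0)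
  ext x
  rw [plane_eq x, map_add, map_smul, map_smul, z1, z2]
  simp

/-- There are no further root vectors: a solution `g` of the inhomogeneous equation
`(L(φ) - z) g = y(F)` that vanishes on the critical modes is trivial. -/
theorem dual_eq_zero (hs : Small w a b n) (hF : SeqSol a b Z Fm Fp) (hFm : Fm n = ebm)
    (hFp : Fp n = ebp)
    (hZ : ‖Z - ((n : ℂ) * Real.pi) • ContinuousLinearMap.id ℂ Plane‖ ≤ 3 / 4)
    (hz : ‖z - n * Real.pi‖ ≤ 3 / 4) (gm0 : gm n = 0) (gp0 : gp n = 0)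
    (sm : ∀ k, Summable fun l => a (k + l) • gp l) (sp : ∀ k, Summable fun l => b (k + l) • gm l)
    (hb : ∃ M, ∀ k : ℤ, ‖y (Fm k) + z * gm k - k * Real.pi * gm k‖ ≤ M ∧
      ‖y (Fp k) + z * gp k - k * Real.pi * gp k‖ ≤ M)
    (em : ∀ k : ℤ, y (Fm k) + z * gm k - k * Real.pi * gm k = ∑' l, a (k + l) • gp l)
    (ep : ∀ k : ℤ, y (Fp k) + z * gp k - k * Real.pi * gp k = ∑' l, b (k + l) • gm l) :
    y = 0 ∧ ∀ k, gm k = 0 ∧ gp k = 0 := by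
  have hy0 : y = 0 := by
    -- The equation is linear in `(y, g)`, so rescaling makes `y` as small as the resolvent bound
    -- requires.
    set c : ℂ := (((2 * (1 + ‖y‖))⁻¹ : ℝ) : ℂ) with hc
    have hny := norm_nonneg y
    have hc0 : c ≠ 0 := by
      rw [hc, Complex.ofReal_ne_zero]; positivity
    have hcn : ‖c • y‖ ≤ 1 / 2 := by
      rw [norm_smul, hc, Complex.norm_real, Real.norm_of_nonneg (by positivity),
        inv_mul_le_iff₀ (by positivity)]
      linarith
    obtain ⟨M, hM⟩ := hb
    have key : ∀ (p : Plane) (q : ℂ) (k : ℤ), (c • y) p + z * (c * q) - k * Real.pi * (c * q) =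
        c * (y p + z * q - k * Real.pi * q) := by
      intro p q k
      rw [smul_apply, smul_eq_mul]; ring
    have hs1 : ∀ (d : ℤ → ℂ) (q : ℤ → ℂ) (k : ℤ),
        (fun l => d (k + l) • (c * q l)) = fun l => c * (d (k + l) • q l) := by
      intro d q k; funext l; simp only [smul_eq_mul]; ring
    have := dual_eq_zero_of_small (y := c • y) (gm := fun k => c * gm k) (gp := fun k => c * gp k)
      hs hF hFm hFp hZ hz hcn (by simp [gm0]) (by simp [gp0])
      (fun k => by rw [hs1]; exact (sm k).mul_left c)
      (fun k => by rw [hs1]; exact (sp k).mul_left c)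
      ⟨‖c‖ * M, fun k => by
        rw [key, key, norm_mul, norm_mul]
        exact ⟨mul_le_mul_of_nonneg_left (hM k).1 (norm_nonneg _),
          mul_le_mul_of_nonneg_left (hM k).2 (norm_nonneg _)⟩⟩
      (fun k => by rw [key, em k, hs1, tsum_mul_left])
      (fun k => by rw [key, ep k, hs1, tsum_mul_left])
    exact (smul_eq_zero.1 this).resolve_left hc0
  refine ⟨hy0, ?_⟩
  subst hy0
  have hre : |z.re - n * Real.pi| ≤ Real.pi / 2 := by
    have h1 := Complex.abs_re_le_norm (z - n * Real.pi)
    have e : (z - n * Real.pi).re = z.re - n * Real.pi := by simp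
    rw [e] at h1
    linarith [Real.pi_gt_three]
  have hR := exists_resolvent_scalar hre
  have hval : ∀ (q : ℂ) (k : ℤ), (z • ContinuousLinearMap.id ℂ ℂ) q - ((k : ℂ) * Real.pi) • q =
      (0 : Plane →L[ℂ] ℂ) 0 + z * q - k * Real.pi * q := by
    intro q k; simp
  have hS : SeqSol a b (z • ContinuousLinearMap.id ℂ ℂ) gm gp := by
    refine ⟨sm, sp, ?_, fun k => ?_, fun k => ?_⟩
    · obtain ⟨M, hM⟩ := hb
      refine ⟨M, fun k => ?_⟩
      rw [hval, hval]; exact hM k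
    · rw [hval]; exact em k
    · rw [hval]; exact ep k
  exact hS.eq_zero hs hR gm0 gp0

end augment

/-! ### Absolutely continuous functions with complex values. -/

section absolutelyContinuous

theorem _root_.LipschitzWith.comp_absolutelyContinuousOnInterval {E F : Type*}
    [SeminormedAddCommGroup E] [SeminormedAddCommGroup F] {g : E → F} {K : NNReal}
    (hg : LipschitzWith K g) {f : ℝ → E} {a b : ℝ} (hf : AbsolutelyContinuousOnInterval f a b) :
    AbsolutelyContinuousOnInterval (fun x => g (f x)) a b := by
  refine squeeze_zero (fun t => Finset.sum_nonneg fun i _ => dist_nonneg) (fun t => ?_)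
    (by simpa using Tendsto.const_mul (K : ℝ) hf)
  rw [Finset.mul_sum]
  exact Finset.sum_le_sum fun i _ => hg.dist_le_mul _ _

theorem absolutelyContinuousOnInterval_integral {f : ℝ → ℂ} {a b c : ℝ}
    (h : IntervalIntegrable f volume a b) (hc : c ∈ Set.uIcc a b) :
    AbsolutelyContinuousOnInterval (fun x => ∫ v in c..x, f v) a b := by
  have hre : IntervalIntegrable (fun x => (f x).re) volume a b := ⟨h.1.re, h.2.re⟩
  have him : IntervalIntegrable (fun x => (f x).im) volume a b := ⟨h.1.im, h.2.im⟩
  have e : ∀ x ∈ Set.uIcc a b, ∫ v in c..x, f v = ((∫ v in c..x, (f v).re : ℝ) : ℂ) +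
      Complex.I • ((∫ v in c..x, (f v).im : ℝ) : ℂ) := by
    intro x hx
    have hi : IntervalIntegrable f volume c x :=
      h.mono_set (Set.uIcc_subset_uIcc hc hx)
    have hre : IntervalIntegrable (fun x => ((f x).re : ℂ)) volume c x :=
      ⟨hi.1.re.ofReal, hi.2.re.ofReal⟩
    have him : IntervalIntegrable (fun x => ((f x).im : ℂ)) volume c x :=
      ⟨hi.1.im.ofReal, hi.2.im.ofReal⟩
    rw [smul_eq_mul, ← intervalIntegral.integral_ofReal, ← intervalIntegral.integral_ofReal,
      ← intervalIntegral.integral_const_mul, ← intervalIntegral.integral_add hre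
      (him.const_mul _)]
    refine intervalIntegral.integral_congr fun t _ => ?_
    rw [mul_comm Complex.I, Complex.re_add_im]
  have h1 := Complex.isometry_ofReal.lipschitz.comp_absolutelyContinuousOnInterval
    (hre.absolutelyContinuousOnInterval_intervalIntegral hc)
  have h2 := (Complex.isometry_ofReal.lipschitz.comp_absolutelyContinuousOnInterval
    (him.absolutelyContinuousOnInterval_intervalIntegral hc)).const_smul Complex.I
  have h3 := h1.add h2
  -- The splitting into real and imaginary parts is known only on the interval, so absolute
  -- continuity is transferred through its ε-δ form, which sees no other points.
  refine (absolutelyContinuousOnInterval_iff _ _ _).2 fun ε hε => ?_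
  obtain ⟨δ, hδ, H⟩ := (absolutelyContinuousOnInterval_iff _ _ _).1 h3 ε hε
  refine ⟨δ, hδ, fun E hE hl => ?_⟩
  refine lt_of_eq_of_lt (Finset.sum_congr rfl fun i hi => ?_) (H E hE hl)
  have hE' := hE.1 i hi
  rw [e _ hE'.1, e _ hE'.2]
  rfl

/-- The fundamental theorem of calculus for complex valued absolutely continuous functions. -/
theorem integral_eq_sub_of_ac {f G : ℝ → ℂ} {a b : ℝ} (hf : AbsolutelyContinuousOnInterval f a b)
    (hd : ∀ᵐ x, HasDerivAt f (G x) x) (hG : IntervalIntegrable G volume a b) :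
    ∫ x in a..b, G x = f b - f a := by
  -- `f` minus the primitive of `G` is absolutely continuous with derivative zero almost everywhere,
  -- hence constant.
  have h1 := hf.sub (absolutelyContinuousOnInterval_integral hG (c := a) (by simp))
  obtain ⟨C, hC⟩ := h1.const_of_ae_hasDerivAt_zero (by
    filter_upwards [hd, hG.ae_hasDerivAt_integral] with x h h' hx
    have := h.sub (h' hx a (by simp))
    rwa [sub_self] at this)
  have e1 := hC a (by simp)
  have e2 := hC b (by simp)
  simp only [Pi.sub_apply, intervalIntegral.integral_same, sub_zero] at e1 e2
  rw [e1, ← e2]; ring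

theorem continuous_of_ac {E : Type*} [NormedAddCommGroup E] {f : ℝ → E}
    (hf : ∀ a b, AbsolutelyContinuousOnInterval f a b) : Continuous f := by
  refine continuous_iff_continuousAt.2 fun x => ?_
  refine (hf (x - 1) (x + 1)).continuousOn.continuousAt ?_
  rw [Set.uIcc_of_le (by linarith)]
  exact Icc_mem_nhds (by linarith) (by linarith)

end absolutelyContinuous

/-! ### Fourier coefficients of 2-periodic functions. -/

section coefficients

instance fact_two_pos : Fact ((0 : ℝ) < 2) := ⟨two_pos⟩

/-- The character `x ↦ e^{iπkx}`. -/
def expo (k : ℤ) (x : ℝ) : ℂ := Complex.exp (Real.pi * Complex.I * k * x)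

theorem expo_zero (x : ℝ) : expo 0 x = 1 := by simp [expo]

theorem expo_add (k l : ℤ) (x : ℝ) : expo (k + l) x = expo k x * expo l x := by
  rw [expo, expo, expo, ← Complex.exp_add]
  congr 1; push_cast; ring

theorem expo_eq_fourier (k : ℤ) (x : ℝ) : expo k x = fourier k (x : AddCircle (2 : ℝ)) := by
  rw [fourier_coe_apply, expo]
  congr 1; push_cast; ring

theorem norm_expo (k : ℤ) (x : ℝ) : ‖expo k x‖ = 1 := by
  rw [expo, show (Real.pi : ℂ) * Complex.I * k * x = ((Real.pi * k * x : ℝ) : ℂ) * Complex.I by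
    push_cast; ring]
  exact Complex.norm_exp_ofReal_mul_I _

theorem hasDerivAt_expo (k : ℤ) (x : ℝ) :
    HasDerivAt (expo k) (Real.pi * Complex.I * k * expo k x) x := by
  have h1 : HasDerivAt (fun x : ℝ => (Real.pi : ℂ) * Complex.I * k * x)
      (Real.pi * Complex.I * k * 1) x :=
    (Complex.ofRealCLM.hasDerivAt (x := x)).const_mul _
  have := h1.cexp
  rw [mul_one] at this
  exact this.congr_deriv (mul_comm _ _)

theorem continuous_expo (k : ℤ) : Continuous (expo k) := by
  unfold expo; fun_prop

theorem expo_periodic (k : ℤ) : Function.Periodic (expo k) 2 := by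
  intro x
  rw [expo_eq_fourier, expo_eq_fourier]
  congr 1
  exact AddCircle.coe_add_period 2 x

theorem expo_ac (k : ℤ) (a b : ℝ) : AbsolutelyContinuousOnInterval (expo k) a b := by
  refine ContDiffOn.absolutelyContinuousOnInterval (ContDiff.contDiffOn ?_)
  unfold expo
  exact Complex.contDiff_exp.comp (contDiff_const.mul Complex.ofRealCLM.contDiff)

/-- The Fourier coefficient of a function on `(0, 2]`. -/
def pc (u : ℝ → ℂ) (k : ℤ) : ℂ := 1 / 2 * ∫ x in (0 : ℝ)..2, expo (-k) x * u x

theorem pc_eq_fourierCoeff (u : ℝ → ℂ) (k : ℤ) :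
    pc u k = fourierCoeff (AddCircle.liftIoc 2 0 u) k := by
  rw [fourierCoeff_eq_intervalIntegral _ _ 0, pc, zero_add, Complex.real_smul]
  congr 1
  · norm_num
  · refine intervalIntegral.integral_congr_ae (Eventually.of_forall fun x hx => ?_)
    rw [Set.uIoc_of_le (by norm_num)] at hx
    rw [AddCircle.liftIoc_coe_apply (by simpa using hx), expo_eq_fourier, smul_eq_mul]

theorem intervalIntegrable_expo_mul {u : ℝ → ℂ} {a b : ℝ} (hu : IntervalIntegrable u volume a b)
    (k : ℤ) : IntervalIntegrable (fun x => expo k x * u x) volume a b :=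
  hu.continuousOn_mul (continuous_expo k).continuousOn

theorem pc_add {u v : ℝ → ℂ} (hu : IntervalIntegrable u volume 0 2)
    (hv : IntervalIntegrable v volume 0 2) (k : ℤ) :
    pc (fun x => u x + v x) k = pc u k + pc v k := by
  unfold pc
  rw [← mul_add, ← intervalIntegral.integral_add (intervalIntegrable_expo_mul hu _)
    (intervalIntegrable_expo_mul hv _)]
  simp_rw [mul_add]

theorem pc_const_mul (c : ℂ) (u : ℝ → ℂ) (k : ℤ) : pc (fun x => c * u x) k = c * pc u k := by
  unfold pc
  simp_rw [show ∀ x, expo (-k) x * (c * u x) = c * (expo (-k) x * u x) by intro x; ring]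
  rw [intervalIntegral.integral_const_mul]; ring

theorem pc_sub {u v : ℝ → ℂ} (hu : IntervalIntegrable u volume 0 2)
    (hv : IntervalIntegrable v volume 0 2) (k : ℤ) :
    pc (fun x => u x - v x) k = pc u k - pc v k := by
  unfold pc
  rw [← mul_sub, ← intervalIntegral.integral_sub (intervalIntegrable_expo_mul hu _)
    (intervalIntegrable_expo_mul hv _)]
  simp_rw [mul_sub]

theorem norm_pc_le (u : ℝ → ℂ) (k : ℤ) : ‖pc u k‖ ≤ ∫ x in (0 : ℝ)..2, ‖u x‖ := by
  have h1 := intervalIntegral.norm_integral_le_integral_norm (μ := volume)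
    (f := fun x => expo (-k) x * u x) (a := 0) (b := 2) (by norm_num)
  simp_rw [norm_mul, norm_expo, one_mul] at h1
  have h0 := norm_nonneg (∫ x in (0 : ℝ)..2, expo (-k) x * u x)
  rw [pc, norm_mul]
  norm_num
  linarith

/-- The Fourier coefficients of the derivative of a periodic function. -/
theorem pc_of_hasDerivAt {u G : ℝ → ℂ} (hp : Function.Periodic u 2)
    (hu : AbsolutelyContinuousOnInterval u 0 2) (hd : ∀ᵐ x, HasDerivAt u (G x) x)
    (hG : IntervalIntegrable G volume 0 2) (k : ℤ) : pc G k = Real.pi * Complex.I * k * pc u k := by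
  have hui : IntervalIntegrable u volume 0 2 := hu.continuousOn.intervalIntegrable
  have i1 := intervalIntegrable_expo_mul hG (-k)
  have i2 := (intervalIntegrable_expo_mul hui (-k)).const_mul (Real.pi * Complex.I * k)
  have h1 : ∫ x in (0 : ℝ)..2, (expo (-k) x * G x - Real.pi * Complex.I * k * (expo (-k) x * u x)) =
      0 := by
    rw [integral_eq_sub_of_ac (f := fun x => expo (-k) x • u x) ((expo_ac (-k) 0 2).smul hu) ?_
      (i1.sub i2)]
    · have e1 := hp 0
      have e2 := expo_periodic (-k) 0
      rw [zero_add] at e1 e2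
      rw [e1, e2, sub_self]
    · filter_upwards [hd] with x hx
      have := (hasDerivAt_expo (-k) x).mul hx
      refine this.congr_deriv ?_
      push_cast; ring
  rw [intervalIntegral.integral_sub i1 i2, intervalIntegral.integral_const_mul] at h1
  unfold pc
  linear_combination (1 / 2 : ℂ) * h1

theorem pc_expo (l k : ℤ) : pc (expo l) k = if l = k then 1 else 0 := by
  split_ifs with h
  · subst h
    unfold pc
    simp_rw [← expo_add, neg_add_cancel, expo_zero]
    norm_num
  · have h1 := pc_of_hasDerivAt (expo_periodic l) (expo_ac l 0 2)
      (Eventually.of_forall (hasDerivAt_expo l))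
      ((continuous_const.mul (continuous_expo l)).intervalIntegrable _ _) k
    rw [pc_const_mul] at h1
    have h2 : (Real.pi : ℂ) * Complex.I * ((l : ℂ) - k) * pc (expo l) k = 0 := by
      linear_combination h1
    have h3 : (l : ℂ) - k ≠ 0 := sub_ne_zero.2 (by exact_mod_cast h)
    have h4 : (Real.pi : ℂ) ≠ 0 := by exact_mod_cast Real.pi_ne_zero
    simpa [h3, h4] using h2

/-- A continuous periodic function with vanishing Fourier coefficients is zero. -/
theorem eq_zero_of_pc_eq_zero {u : ℝ → ℂ} (hu : Continuous u) (hp : Function.Periodic u 2)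
    (h : ∀ k, pc u k = 0) : u = 0 := by
  have e : u 0 = u 2 := by
    have := hp 0; rw [zero_add] at this; exact this.symm
  let f : C(AddCircle (2 : ℝ), ℂ) :=
    ⟨AddCircle.liftIoc 2 0 u, AddCircle.liftIoc_zero_continuous e hu.continuousOn⟩
  have hf : fourierCoeff f = 0 := by
    funext k
    exact (pc_eq_fourierCoeff u k).symm.trans (h k)
  have h1 := hasSum_fourier_series_of_summable (f := f) (by rw [hf]; exact summable_zero)
  have h2 : f = 0 := h1.unique (by simp [hf])
  funext x
  obtain ⟨y, hy, hxy⟩ := hp.exists_mem_Ioc two_pos x 0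
  rw [hxy]
  have := congrArg (fun g : C(AddCircle (2 : ℝ), ℂ) => g (y : AddCircle (2 : ℝ))) h2
  change AddCircle.liftIoc 2 0 u y = 0 at this
  rwa [AddCircle.liftIoc_coe_apply hy] at this

theorem eq_of_pc_eq {u v : ℝ → ℂ} (hu : Continuous u) (hp : Function.Periodic u 2)
    (hv : Continuous v) (hq : Function.Periodic v 2) (h : ∀ k, pc u k = pc v k) : u = v := by
  have := eq_zero_of_pc_eq_zero (u := fun x => u x - v x) (hu.sub hv)
    (fun x => by simp only [hp x, hq x]) fun k => by
      rw [pc_sub (hu.intervalIntegrable _ _) (hv.intervalIntegrable _ _), h k, sub_self]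
  funext x
  exact sub_eq_zero.1 (congrFun this x)

/-- Absolute continuity and the derivative can be read off from the Fourier coefficients. -/
theorem hasDerivAt_of_pc {u G : ℝ → ℂ} (hu : Continuous u) (hp : Function.Periodic u 2)
    (hGp : Function.Periodic G 2) (hG : IntervalIntegrable G volume 0 2)
    (h : ∀ k : ℤ, pc G k = Real.pi * Complex.I * k * pc u k) :
    (∀ a b, AbsolutelyContinuousOnInterval u a b) ∧ ∀ᵐ x, HasDerivAt u (G x) x := by
  have hGi : ∀ a b, IntervalIntegrable G volume a b :=
    fun a b => hGp.intervalIntegrable₀ two_ne_zero hG a b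
  set U : ℝ → ℂ := fun x => ∫ t in (0 : ℝ)..x, G t with hU
  have hUac : ∀ a b, AbsolutelyContinuousOnInterval U a b := by
    intro a b
    have := absolutelyContinuousOnInterval_integral (hGi (min a (min b 0)) (max a (max b 0)))
      (c := 0) (by
        rw [Set.uIcc_of_le (by simp)]
        exact ⟨by simp, by simp⟩)
    refine this.mono ?_
    rw [Set.uIcc_of_le (a := min a (min b 0)) (by simp)]
    exact Set.uIcc_subset_Icc ⟨by simp, by simp⟩ ⟨by simp, by simp⟩
  have hUd : ∀ᵐ x, HasDerivAt U (G x) x := by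
    have hl : LocallyIntegrable G volume := by
      intro x
      refine ⟨Set.Icc (x - 1) (x + 1), Icc_mem_nhds (by linarith) (by linarith), ?_⟩
      exact (intervalIntegrable_iff_integrableOn_Icc_of_le (by linarith)).1 (hGi _ _)
    filter_upwards [LocallyIntegrable.ae_hasDerivAt_integral hl] with x hx using hx 0
  -- The coefficient identity at `k = 0` says that `G` has mean zero, so its primitive `U` is
  -- periodic.
  have h0 : ∫ x in (0 : ℝ)..2, G x = 0 := by
    have := h 0
    unfold pc at this
    simpa [expo_zero] using this
  have hUp : Function.Periodic U 2 := by
    intro x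
    have e1 := intervalIntegral.integral_add_adjacent_intervals (hGi 0 x) (hGi x (x + 2))
    have e2 := hGp.intervalIntegral_add_eq x 0
    rw [zero_add, h0] at e2
    rw [hU]
    simp only
    rw [← e1, e2, add_zero]
  have hUc := continuous_of_ac hUac
  have hpc := pc_of_hasDerivAt hUp (hUac 0 2) hUd hG
  set c : ℂ := pc u 0 - pc U 0 with hc
  -- The identity determines every coefficient with `k ≠ 0`; the constant `c` adjusts the remaining
  -- one.
  have huU : u = fun x => U x + c * expo 0 x := by
    refine eq_of_pc_eq hu hp (hUc.add (continuous_const.mul (continuous_expo 0)))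
      (fun x => by simp only [hUp x, expo_periodic 0 x]) fun k => ?_
    rw [pc_add (v := fun x => c * expo 0 x) (hUc.intervalIntegrable _ _)
      ((continuous_const.mul (continuous_expo 0)).intervalIntegrable _ _), pc_const_mul, pc_expo]
    split_ifs with hk
    · rw [← hk, hc]; ring
    · have h1 := (h k).symm.trans (hpc k)
      have h3 : (k : ℂ) ≠ 0 := Int.cast_ne_zero.2 fun h' => hk h'.symm
      have h4 : (Real.pi : ℂ) ≠ 0 := by exact_mod_cast Real.pi_ne_zero
      rw [mul_zero, add_zero]
      exact mul_left_cancel₀ (by simp [h3, h4]) h1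
  have huU' : u = U + fun _ => c := by
    rw [huU]; funext x; simp [expo_zero]
  rw [huU']
  refine ⟨fun a b => (hUac a b).add
    ((LipschitzWith.const c).lipschitzOnWith).absolutelyContinuousOnInterval, ?_⟩
  filter_upwards [hUd] with x hx
  simpa using hx.add (hasDerivAt_const x c)

/-- Fourier coefficients of products of square integrable functions are convolutions. -/
theorem hasSum_pc_mul {u v : ℝ → ℂ} (hu : MemLp u 2 (volume.restrict (Set.Ioc 0 2)))
    (hv : MemLp v 2 (volume.restrict (Set.Ioc 0 2))) (k : ℤ) :
    HasSum (fun l => pc v (k - l) * pc u l) (pc (fun x => v x * u x) k) := by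
  -- Parseval's identity for the pair `conj(v) e_k`, `u`: their inner product is the coefficient of
  -- `v u`.
  have hw : MemLp (fun x => (starRingEnd ℂ) (v x) * expo k x) 2
      (volume.restrict (Set.Ioc 0 2)) := by
    refine hv.star.congr_norm ?_ (Eventually.of_forall fun x => ?_)
    · exact hv.star.1.mul (continuous_expo k).aestronglyMeasurable
    · rw [norm_mul, norm_expo, mul_one]; rfl
  have lift : ∀ {f : ℝ → ℂ}, MemLp f 2 (volume.restrict (Set.Ioc 0 2)) →
      MemLp (AddCircle.liftIoc 2 0 f) 2 (AddCircle.haarAddCircle (T := (2 : ℝ))) := by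
    intro f hf
    rw [← zero_add (2 : ℝ)] at hf
    exact hf.memLp_liftIoc.haarAddCircle
  have hs := (fourierBasis (T := (2 : ℝ))).hasSum_inner_mul_inner (lift hw).toLp (lift hu).toLp
  have e1 : ∀ (f : Lp ℂ 2 (AddCircle.haarAddCircle (T := (2 : ℝ)))) l,
      inner ℂ (fourierBasis (T := (2 : ℝ)) l) f = fourierCoeff f l := fun f l => by
    rw [← fourierBasis.repr_apply_apply, fourierBasis_repr]
  have e2 : ∀ {f : ℝ → ℂ} (hf : MemLp f 2 (volume.restrict (Set.Ioc 0 2))) l,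
      fourierCoeff ((lift hf).toLp : AddCircle (2 : ℝ) → ℂ) l = pc f l := fun {f} hf l => by
    rw [fourierCoeff_congr_ae (lift hf).coeFn_toLp, pc_eq_fourierCoeff]
  have e3 : ∀ l, (starRingEnd ℂ) (pc (fun x => (starRingEnd ℂ) (v x) * expo k x) l) =
      pc v (k - l) := by
    intro l
    unfold pc
    rw [map_mul, intervalIntegral.integral_of_le two_pos.le, ← integral_conj,
      ← intervalIntegral.integral_of_le two_pos.le]
    congr 1
    · rw [map_div₀, map_one, Complex.conj_ofNat]
    · refine intervalIntegral.integral_congr fun x _ => ?_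
      have hc : ∀ j x, (starRingEnd ℂ) (expo j x) = expo (-j) x := by
        intro j x
        rw [expo_eq_fourier, expo_eq_fourier, fourier_neg]
      simp only [map_mul, Complex.conj_conj, hc, neg_neg]
      rw [neg_sub, sub_eq_add_neg, expo_add]
      ring
  have e4 : inner ℂ (lift hw).toLp (lift hu).toLp = pc (fun x => v x * u x) k := by
    rw [L2.inner_def, pc_eq_fourierCoeff, fourierCoeff]
    refine integral_congr_ae ?_
    filter_upwards [(lift hw).coeFn_toLp, (lift hu).coeFn_toLp] with x h1 h2
    rw [h1, h2]
    obtain ⟨y, hy, rfl⟩ := AddCircle.eq_coe_Ioc (p := (2 : ℝ)) x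
    have hy' : y ∈ Set.Ioc (0 : ℝ) (0 + 2) := by simpa using hy
    rw [AddCircle.liftIoc_coe_apply hy', AddCircle.liftIoc_coe_apply hy',
      AddCircle.liftIoc_coe_apply hy', RCLike.inner_apply']
    rw [map_mul, Complex.conj_conj, ← expo_eq_fourier, smul_eq_mul]
    have : (starRingEnd ℂ) (expo k y) = expo (-k) y := by
      rw [expo_eq_fourier, expo_eq_fourier, fourier_neg]
    rw [this]; ring
  rw [e4] at hs
  refine hs.congr_fun fun l => ?_
  rw [← inner_conj_symm, e1, e1, e2 hw, e2 hu, e3]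

/-- The coefficients of an absolutely convergent Fourier series. -/
theorem pc_tsum {c : ℤ → ℂ} (hc : Summable fun k => ‖c k‖) (k : ℤ) :
    pc (fun x => ∑' l, c l * expo l x) k = c k := by
  have h1 := intervalIntegral.hasSum_integral_of_dominated_convergence (μ := volume)
    (a := (0 : ℝ)) (b := 2) (F := fun l x => expo (-k) x * (c l * expo l x))
    (f := fun x => expo (-k) x * ∑' l, c l * expo l x) (fun l _ => ‖c l‖)
    (fun l => ((continuous_expo _).mul
      (continuous_const.mul (continuous_expo l))).aestronglyMeasurable)
    (fun l => Eventually.of_forall fun x _ => by rw [norm_mul, norm_mul, norm_expo, norm_expo]; simp)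
    (Eventually.of_forall fun x _ => hc) (by simp) (Eventually.of_forall fun x _ => by
      refine HasSum.mul_left _ (Summable.hasSum ?_)
      refine Summable.of_norm ?_
      simpa [norm_mul, norm_expo] using hc)
  have h2 := (h1.mul_left (1 / 2))
  have h3 : ∀ l, 1 / 2 * ∫ x in (0 : ℝ)..2, expo (-k) x * (c l * expo l x) =
      if l = k then c k else 0 := by
    intro l
    have := pc_const_mul (c l) (expo l) k
    rw [pc_expo] at this
    unfold pc at this
    rw [this]
    split_ifs with h
    · rw [h, mul_one]
    · rw [mul_zero]
  simp_rw [h3] at h2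
  exact h2.unique (hasSum_ite_eq k (c k))

theorem continuous_tsum_expo {c : ℤ → ℂ} (hc : Summable fun k => ‖c k‖) :
    Continuous fun x => ∑' l, c l * expo l x :=
  continuous_tsum (fun l => continuous_const.mul (continuous_expo l)) hc
    fun l x => by rw [norm_mul, norm_expo, mul_one]

theorem periodic_tsum_expo (c : ℤ → ℂ) : Function.Periodic (fun x => ∑' l, c l * expo l x) 2 :=
  fun x => tsum_congr fun l => by rw [expo_periodic]

end coefficients

/-! ### The operator `L(φ)` in Fourier coefficients. -/

section bridge

/-- A square integrable function on the circle of length one, read as a function on the line. -/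
def pull (f : Lp ℂ 2 (AddCircle.haarAddCircle (T := (1 : ℝ)))) (x : ℝ) : ℂ :=
  f (x : AddCircle (1 : ℝ))

variable {f : Lp ℂ 2 (AddCircle.haarAddCircle (T := (1 : ℝ)))}

theorem pull_periodic_one (f : Lp ℂ 2 (AddCircle.haarAddCircle (T := (1 : ℝ)))) :
    Function.Periodic (pull f) 1 := by
  intro x
  simp only [pull]
  congr 1
  exact AddCircle.coe_add_period 1 x

theorem pull_periodic (f : Lp ℂ 2 (AddCircle.haarAddCircle (T := (1 : ℝ)))) :
    Function.Periodic (pull f) 2 := by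
  have := (pull_periodic_one f).nat_mul 2
  simpa using this

theorem memLp_pull (f : Lp ℂ 2 (AddCircle.haarAddCircle (T := (1 : ℝ)))) :
    MemLp (pull f) 2 (volume.restrict (Set.Ioc 0 2)) := by
  have h : ∀ t : ℝ, MemLp (pull f) 2 (volume.restrict (Set.Ioc t (t + 1))) := fun t =>
    (memLp_haarAddCircle_iff.1 (Lp.memLp f)).comp_measurePreserving
      (AddCircle.measurePreserving_mk 1 t)
  have e : Set.Ioc (0 : ℝ) 2 = Set.Ioc 0 (0 + 1) ∪ Set.Ioc 1 (1 + 1) := by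
    rw [zero_add, Set.Ioc_union_Ioc_eq_Ioc (by norm_num) (by norm_num)]; norm_num
  have hm : AEStronglyMeasurable (pull f) (volume.restrict (Set.Ioc 0 2)) := by
    rw [e]
    exact aestronglyMeasurable_union_iff.2 ⟨(h 0).1, (h 1).1⟩
  rw [memLp_two_iff_integrable_sq_norm hm]
  have h' := fun t => (memLp_two_iff_integrable_sq_norm (h t).1).1 (h t)
  have := IntegrableOn.union (h' 0) (h' 1)
  rwa [← e] at this

theorem memLp_of_continuous {u : ℝ → ℂ} (hu : Continuous u) :
    MemLp u 2 (volume.restrict (Set.Ioc 0 2)) := by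
  obtain ⟨C, hC⟩ := (isCompact_Icc (a := (0 : ℝ)) (b := 2)).exists_bound_of_continuousOn
    hu.continuousOn
  refine MemLp.of_bound hu.aestronglyMeasurable C ?_
  filter_upwards [ae_restrict_mem measurableSet_Ioc] with x hx using hC x ⟨hx.1.le, hx.2⟩

theorem intervalIntegrable_pull_mul {u : ℝ → ℂ} (hu : Continuous u) :
    IntervalIntegrable (fun x => pull f x * u x) volume 0 2 := by
  rw [intervalIntegrable_iff_integrableOn_Ioc_of_le two_pos.le]
  exact (memLp_pull f).integrable_mul (memLp_of_continuous hu)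

/-- A 1-periodic function seen over two periods: the second period repeats the first with the sign
`(-1)^k`, so odd coefficients cancel and even ones are those on the unit circle. -/
theorem pc_pull (k : ℤ) : pc (pull f) k =
    1 / 2 * (1 + expo (-k) 1) * ∫ x in (0 : ℝ)..1, expo (-k) x * pull f x := by
  have hi : IntervalIntegrable (pull f) volume 0 2 := by
    have := intervalIntegrable_pull_mul (f := f) (u := fun _ => 1) continuous_const
    simpa using this
  have hp := fun a b => (pull_periodic f).intervalIntegrable₀ two_ne_zero hi a b
  have h1 := intervalIntegral.integral_add_adjacent_intervals
    (intervalIntegrable_expo_mul (hp 0 1) (-k)) (intervalIntegrable_expo_mul (hp 1 2) (-k))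
  have h2 := intervalIntegral.integral_comp_add_right (a := 0) (b := 1)
    (fun x => expo (-k) x * pull f x) 1
  have h3 : ∀ x : ℝ, expo (-k) (x + 1) = expo (-k) 1 * expo (-k) x := by
    intro x
    rw [expo, expo, expo, ← Complex.exp_add]
    congr 1; push_cast; ring
  simp_rw [h3, (pull_periodic_one f) _, mul_assoc] at h2
  rw [intervalIntegral.integral_const_mul, zero_add, one_add_one_eq_two] at h2
  rw [pc, ← h1, ← h2]
  ring

theorem expo_one (k : ℤ) : expo k 1 = (-1) ^ k := by
  rw [expo, show (Real.pi : ℂ) * Complex.I * k * (1 : ℝ) = k * (Real.pi * Complex.I) by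
    push_cast; ring, Complex.exp_int_mul, Complex.exp_pi_mul_I]

theorem pc_pull_two_mul (n : ℤ) : pc (pull f) (2 * n) = fourierCoeff f n := by
  have h : ∫ x in (0 : ℝ)..1, expo (-(2 * n)) x * pull f x =
      ∫ x in (0 : ℝ)..1, fourier (-n) (x : AddCircle (1 : ℝ)) • f (x : AddCircle (1 : ℝ)) := by
    refine intervalIntegral.integral_congr fun x _ => ?_
    simp only [pull, smul_eq_mul]
    congr 1
    rw [fourier_coe_apply, expo]
    congr 1; push_cast; ring
  rw [pc_pull, expo_one, fourierCoeff_eq_intervalIntegral _ _ 0, Even.neg_one_zpow (by simp),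
    zero_add, h, Complex.real_smul]
  push_cast
  ring

theorem pc_pull_of_odd {k : ℤ} (hk : Odd k) : pc (pull f) k = 0 := by
  rw [pc_pull, expo_one, Odd.neg_one_zpow (by simpa using hk)]
  simp

/-- The coefficients of `φ₋` with respect to the characters `e^{-iπjx}`. -/
def coeffA (φ : L2c) (j : ℤ) : ℂ := pc (pull φ.1) (-j)

/-- The coefficients of `φ₊` with respect to the characters `e^{iπjx}`. -/
def coeffB (φ : L2c) (j : ℤ) : ℂ := pc (pull φ.2) j

/-- The coefficients of the first component with respect to the characters `e^{-iπkx}`. -/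
def cm (f : ℝ → ℂ × ℂ) (k : ℤ) : ℂ := pc (fun x => (f x).1) (-k)

/-- The coefficients of the second component with respect to the characters `e^{iπkx}`. -/
def cp (f : ℝ → ℂ × ℂ) (k : ℤ) : ℂ := pc (fun x => (f x).2) k

/-- The sign `σ = ±1` treats both rows of the operator together. -/
theorem pc_of_ode {u q g : ℝ → ℂ} {σ : ℂ} (hσ : σ * σ = 1) (hp : Function.Periodic u 2)
    (hu : AbsolutelyContinuousOnInterval u 0 2)
    (hd : ∀ᵐ x, ∃ u', HasDerivAt u u' x ∧ σ * Complex.I * u' + q x = g x)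
    (hq : IntervalIntegrable q volume 0 2) (hg : IntervalIntegrable g volume 0 2) (k : ℤ) :
    pc q k = pc g k + σ * Real.pi * k * pc u k := by
  have h1 := pc_of_hasDerivAt (G := fun x => -(σ * Complex.I) * (g x - q x)) hp hu (by
    filter_upwards [hd] with x ⟨u', h, e⟩
    refine h.congr_deriv ?_
    rw [← e]
    linear_combination (u' * Complex.I * Complex.I) * hσ + u' * Complex.I_mul_I)
    ((hg.sub hq).const_mul _) k
  rw [pc_const_mul, pc_sub hg hq] at h1
  linear_combination (-σ * Complex.I) * h1 - (pc g k - pc q k) * (Complex.I * Complex.I) * hσ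
    + (pc q k - pc g k - σ * Real.pi * k * pc u k) * Complex.I_mul_I

theorem ode_of_pc {u q g : ℝ → ℂ} {σ : ℂ} (hσ : σ * σ = 1) (hu : Continuous u)
    (hp : Function.Periodic u 2) (hqp : Function.Periodic q 2) (hgp : Function.Periodic g 2)
    (hq : IntervalIntegrable q volume 0 2) (hg : IntervalIntegrable g volume 0 2)
    (h : ∀ k : ℤ, pc q k = pc g k + σ * Real.pi * k * pc u k) :
    (∀ a b, AbsolutelyContinuousOnInterval u a b) ∧
      ∀ᵐ x, ∃ u', HasDerivAt u u' x ∧ σ * Complex.I * u' + q x = g x := by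
  have h1 := hasDerivAt_of_pc (G := fun x => -(σ * Complex.I) * (g x - q x)) hu hp
    (fun x => by simp only [hqp x, hgp x]) ((hg.sub hq).const_mul _) (fun k => by
      rw [pc_const_mul, pc_sub hg hq, h k]
      linear_combination (Real.pi * k * pc u k * Complex.I) * hσ)
  refine ⟨h1.1, ?_⟩
  filter_upwards [h1.2] with x hx
  refine ⟨_, hx, ?_⟩
  linear_combination (-(g x - q x) * Complex.I * Complex.I) * hσ - (g x - q x) * Complex.I_mul_I

variable {φ : L2c} {f g : ℝ → ℂ × ℂ}

theorem ZSMaps.continuous (h : ZSMaps φ f g) : Continuous f := continuous_of_ac h.ac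

theorem hasSum_coeffA (hf : Continuous f) (k : ℤ) :
    HasSum (fun l => coeffA φ (k + l) * cp f l) (pc (fun x => pull φ.1 x * (f x).2) (-k)) := by
  have := hasSum_pc_mul (memLp_of_continuous hf.snd) (memLp_pull φ.1) (-k)
  refine this.congr_fun fun l => ?_
  rw [coeffA, cp, neg_add, sub_eq_add_neg]

theorem hasSum_coeffB (hf : Continuous f) (k : ℤ) :
    HasSum (fun l => coeffB φ (k + l) * cm f l) (pc (fun x => pull φ.2 x * (f x).1) k) := by
  have h := hasSum_pc_mul (memLp_of_continuous hf.fst) (memLp_pull φ.2) k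
  have := ((Equiv.neg ℤ).hasSum_iff (f := fun l => pc (pull φ.2) (k - l) *
    pc (fun x => (f x).1) l)).2 h
  refine this.congr_fun fun l => ?_
  simp [coeffB, cm]

/-- The Fourier form of `L(φ) f = g`. -/
theorem ZSMaps.hasSum (h : ZSMaps φ f g) (hp : Function.Periodic f 2) (hg : Continuous g)
    (k : ℤ) :
    HasSum (fun l => coeffA φ (k + l) * cp f l) (cm g k - k * Real.pi * cm f k) ∧
    HasSum (fun l => coeffB φ (k + l) * cm f l) (cp g k - k * Real.pi * cp f k) := by
  have hc := h.continuous
  have e1 := pc_of_ode (u := fun x => (f x).1) (q := fun x => pull φ.1 x * (f x).2)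
    (g := fun x => (g x).1) (σ := 1) (by ring) (fun x => by simp only [hp x])
    (LipschitzWith.prod_fst.comp_absolutelyContinuousOnInterval (h.ac 0 2)) (by
      filter_upwards [h.eq] with x ⟨f', hd, e, _⟩
      exact ⟨f'.1, hd.fst, by rw [one_mul]; exact e⟩)
    (intervalIntegrable_pull_mul hc.snd) (hg.fst.intervalIntegrable _ _) (-k)
  have e2 := pc_of_ode (u := fun x => (f x).2) (q := fun x => pull φ.2 x * (f x).1)
    (g := fun x => (g x).2) (σ := -1) (by ring) (fun x => by simp only [hp x])
    (LipschitzWith.prod_snd.comp_absolutelyContinuousOnInterval (h.ac 0 2)) (by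
      filter_upwards [h.eq] with x ⟨f', hd, _, e⟩
      exact ⟨f'.2, hd.snd, by rw [neg_one_mul]; exact e⟩)
    (intervalIntegrable_pull_mul hc.fst) (hg.snd.intervalIntegrable _ _) k
  have s1 := hasSum_coeffA (φ := φ) hc k
  have s2 := hasSum_coeffB (φ := φ) hc k
  rw [e1] at s1
  rw [e2] at s2
  refine ⟨?_, ?_⟩
  · convert s1 using 1
    simp only [cm]; push_cast; ring
  · convert s2 using 1
    simp only [cp]; ring

/-- The converse direction: for continuous `f` and `g` the coefficient equations already force
absolute continuity of `f`. -/
theorem zsMaps_of_hasSum (hf : Continuous f) (hp : Function.Periodic f 2) (hg : Continuous g)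
    (hgp : Function.Periodic g 2) (h : ∀ k : ℤ,
      HasSum (fun l => coeffA φ (k + l) * cp f l) (cm g k - k * Real.pi * cm f k) ∧
      HasSum (fun l => coeffB φ (k + l) * cm f l) (cp g k - k * Real.pi * cp f k)) :
    ZSMaps φ f g := by
  have e1 := ode_of_pc (u := fun x => (f x).1) (q := fun x => pull φ.1 x * (f x).2)
    (g := fun x => (g x).1) (σ := 1) (by ring) hf.fst (fun x => by simp only [hp x])
    (fun x => by simp only [hp x, pull_periodic φ.1 x]) (fun x => by simp only [hgp x])
    (intervalIntegrable_pull_mul hf.snd) (hg.fst.intervalIntegrable _ _) (fun k => by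
      have := (hasSum_coeffA (φ := φ) hf (-k)).unique (h (-k)).1
      simp only [cm, neg_neg] at this
      rw [this]; push_cast; ring)
  have e2 := ode_of_pc (u := fun x => (f x).2) (q := fun x => pull φ.2 x * (f x).1)
    (g := fun x => (g x).2) (σ := -1) (by ring) hf.snd (fun x => by simp only [hp x])
    (fun x => by simp only [hp x, pull_periodic φ.2 x]) (fun x => by simp only [hgp x])
    (intervalIntegrable_pull_mul hf.fst) (hg.snd.intervalIntegrable _ _) (fun k => by
      have := (hasSum_coeffB (φ := φ) hf k).unique (h k).2
      simp only [cp] at this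
      rw [this]; ring)
  refine ⟨fun a b => ?_, ?_⟩
  · have i1 : LipschitzWith 1 (fun z : ℂ => (z, (0 : ℂ))) :=
      LipschitzWith.of_dist_le_mul fun x y => by simp [Prod.dist_eq]
    have i2 : LipschitzWith 1 (fun z : ℂ => ((0 : ℂ), z)) :=
      LipschitzWith.of_dist_le_mul fun x y => by simp [Prod.dist_eq]
    have := (i1.comp_absolutelyContinuousOnInterval (e1.1 a b)).add
      (i2.comp_absolutelyContinuousOnInterval (e2.1 a b))
    have e : f = (fun x => ((f x).1, (0 : ℂ))) + fun x => ((0 : ℂ), (f x).2) := by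
      funext x; simp
    rw [e]
    exact this
  · filter_upwards [e1.2, e2.2] with x ⟨u', hu, eu⟩ ⟨v', hv, ev⟩
    refine ⟨(u', v'), hu.prodMk hv, ?_, ?_⟩
    · simpa [pull] using eu
    · simpa [pull] using ev

end bridge

/-! ### The norm of the potential in terms of its coefficients. -/

section norms

variable {w : ℤ → ℝ} {φ : L2c}

theorem coeffA_two_mul (n : ℤ) : coeffA φ (2 * n) = coeffMinus φ n := by
  rw [coeffA, coeffMinus, ← mul_neg, pc_pull_two_mul]

theorem coeffB_two_mul (n : ℤ) : coeffB φ (2 * n) = coeffPlus φ n := by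
  rw [coeffB, coeffPlus, pc_pull_two_mul]

theorem coeffA_of_odd {j : ℤ} (hj : Odd j) : coeffA φ j = 0 := pc_pull_of_odd hj.neg

theorem coeffB_of_odd {j : ℤ} (hj : Odd j) : coeffB φ j = 0 := pc_pull_of_odd hj

theorem hasSum_even {F : ℤ → ℝ} (h0 : ∀ j, Odd j → F j = 0) {s : ℝ} :
    HasSum F s ↔ HasSum (fun n => F (2 * n)) s := by
  have hinj : Function.Injective (fun n : ℤ => 2 * n) := fun a b h => by simpa using h
  refine (hinj.hasSum_iff fun j hj => h0 j ?_).symm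
  by_contra hodd
  rw [Int.not_odd_iff_even] at hodd
  obtain ⟨m, rfl⟩ := hodd
  exact hj ⟨m, by simp only; ring⟩

theorem wSummable_coeff (hφ : φ ∈ Hw w) : WSummable w (coeffA φ) ∧ WSummable w (coeffB φ) ∧
    coefNorm w (coeffA φ) ^ 2 + coefNorm w (coeffB φ) ^ 2 = wNorm w φ ^ 2 := by
  have hs : Summable (wTerm w φ) := hφ
  have hA : Summable fun n : ℤ => (w (2 * n) * ‖coeffA φ (2 * n)‖) ^ 2 := by
    refine Summable.of_nonneg_of_le (fun _ => sq_nonneg _) (fun n => ?_) hs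
    rw [coeffA_two_mul, wTerm, mul_pow, mul_add]
    linarith [mul_nonneg (sq_nonneg (w (2 * n))) (sq_nonneg ‖coeffPlus φ n‖)]
  have hB : Summable fun n : ℤ => (w (2 * n) * ‖coeffB φ (2 * n)‖) ^ 2 := by
    refine Summable.of_nonneg_of_le (fun _ => sq_nonneg _) (fun n => ?_) hs
    rw [coeffB_two_mul, wTerm, mul_pow, mul_add]
    linarith [mul_nonneg (sq_nonneg (w (2 * n))) (sq_nonneg ‖coeffMinus φ n‖)]
  have hA' := (hasSum_even (F := fun j => (w j * ‖coeffA φ j‖) ^ 2)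
    fun j hj => by simp [coeffA_of_odd hj]).2 hA.hasSum
  have hB' := (hasSum_even (F := fun j => (w j * ‖coeffB φ j‖) ^ 2)
    fun j hj => by simp [coeffB_of_odd hj]).2 hB.hasSum
  refine ⟨hA'.summable, hB'.summable, ?_⟩
  rw [coefNorm, coefNorm, wNorm, Real.sq_sqrt (tsum_nonneg fun _ => sq_nonneg _),
    Real.sq_sqrt (tsum_nonneg fun _ => sq_nonneg _), Real.sq_sqrt, hA'.tsum_eq, hB'.tsum_eq,
    ← hA.tsum_add hB]
  · refine tsum_congr fun n => ?_
    rw [coeffA_two_mul, coeffB_two_mul, wTerm]; ring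
  · exact tsum_nonneg fun n => by unfold wTerm; positivity

theorem small_coeff (hw : w ∈ weightsOne) (hφ : φ ∈ Hw w) {n : ℤ}
    (h : 8 * wNorm w φ ^ 2 ≤ bracket n) : Small w (coeffA φ) (coeffB φ) n := by
  obtain ⟨h1, h2, h3⟩ := wSummable_coeff hφ
  exact ⟨hw, h1, h2, by rw [h3]; exact h⟩

end norms

/-! ### Functions obtained from the plane-valued solution. -/

section planeSol

variable {w : ℤ → ℝ} {a b : ℤ → ℂ} {n : ℤ} {Z : Plane →L[ℂ] Plane} {Fm Fp : ℤ → Plane}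

/-- A plane-valued solution of `L(φ) F = Z F` that is normalised on the critical modes. -/
structure PlaneSol (a b : ℤ → ℂ) (n : ℤ) (Z : Plane →L[ℂ] Plane) (Fm Fp : ℤ → Plane) : Prop where
  sol : SeqSol a b Z Fm Fp
  summ_m : Summable fun l => ‖Fm l‖
  summ_p : Summable fun l => ‖Fp l‖
  self_m : Fm n = ebm
  self_p : Fp n = ebp
  norm_le : ‖Z - ((n : ℂ) * Real.pi) • ContinuousLinearMap.id ℂ Plane‖ ≤ 3 / 4

theorem Small.exists_planeSol (hs : Small w a b n) : ∃ Z Fm Fp, PlaneSol a b n Z Fm Fp := by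
  obtain ⟨Z, R, hm, hp, hZ, hR, hr, em, ep⟩ := exists_planeMap hs
  exact ⟨Z, _, _, hr.seqSol hs hR em ep, hr.summable_norm_complete hs hR.bound,
    hr.symm.summable_norm_complete hs.symm hR.bound, complete_self _ _, complete_self _ _, hZ⟩

section dual

variable {X : Type*} [NormedAddCommGroup X] [NormedSpace ℂ X]

theorem summable_norm_dual {F : ℤ → X} (hF : Summable fun l => ‖F l‖) (y : X →L[ℂ] ℂ) :
    Summable fun l => ‖y (F l)‖ :=
  Summable.of_nonneg_of_le (fun _ => norm_nonneg _) (fun _ => y.le_opNorm _) (hF.mul_left ‖y‖)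

theorem summable_norm_neg {F : ℤ → X} (hF : Summable fun l => ‖F l‖) :
    Summable fun l => ‖F (-l)‖ :=
  ((Equiv.neg ℤ).summable_iff (f := fun l => ‖F l‖)).2 hF

theorem summable_dual_expo {F : ℤ → X} (hF : Summable fun l => ‖F l‖) (y : X →L[ℂ] ℂ)
    (x : ℝ) : Summable fun l => y (F l) * expo l x := by
  refine Summable.of_norm ?_
  simpa [norm_mul, norm_expo] using summable_norm_dual hF y

theorem tsum_dual_add {F : ℤ → X} (hF : Summable fun l => ‖F l‖) (y y' : X →L[ℂ] ℂ)
    (x : ℝ) : ∑' l, (y + y') (F l) * expo l x =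
      ∑' l, y (F l) * expo l x + ∑' l, y' (F l) * expo l x := by
  rw [← (summable_dual_expo hF y x).tsum_add (summable_dual_expo hF y' x)]
  exact tsum_congr fun l => by rw [add_apply]; ring

theorem tsum_dual_smul (F : ℤ → X) (c : ℂ) (y : X →L[ℂ] ℂ) (x : ℝ) :
    ∑' l, (c • y) (F l) * expo l x = c * ∑' l, y (F l) * expo l x := by
  rw [← tsum_mul_left]
  exact tsum_congr fun l => by rw [smul_apply, smul_eq_mul]; ring

/-- The functions obtained from a vector-valued sequence by applying functionals. -/
def dualFun (Fm Fp : ℤ → X) (hm : Summable fun l => ‖Fm l‖) (hp : Summable fun l => ‖Fp l‖) :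
    (X →L[ℂ] ℂ) →ₗ[ℂ] (ℝ → ℂ × ℂ) where
  toFun y := fun x => (∑' l, y (Fm l) * expo l x, ∑' l, y (Fp l) * expo l x)
  map_add' y y' := funext fun x => congrArg₂ Prod.mk
    (tsum_dual_add hm y y' x) (tsum_dual_add hp y y' x)
  map_smul' c y := funext fun x => congrArg₂ Prod.mk
    (tsum_dual_smul Fm c y x) (tsum_dual_smul Fp c y x)

end dual

/-- The functions obtained from a plane-valued solution by applying functionals. -/
def planeFun (hF : PlaneSol a b n Z Fm Fp) : (Plane →L[ℂ] ℂ) →ₗ[ℂ] (ℝ → ℂ × ℂ) :=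
  -- The reflection reflects the convention that the first component is expanded in `e^{-iπlx}`.
  dualFun (fun l => Fm (-l)) Fp (summable_norm_neg hF.summ_m) hF.summ_p

theorem continuous_planeFun (hF : PlaneSol a b n Z Fm Fp) (y : Plane →L[ℂ] ℂ) :
    Continuous (planeFun hF y) :=
  (continuous_tsum_expo (summable_norm_dual (summable_norm_neg hF.summ_m) y)).prodMk
    (continuous_tsum_expo (summable_norm_dual hF.summ_p y))

theorem periodic_planeFun (hF : PlaneSol a b n Z Fm Fp) (y : Plane →L[ℂ] ℂ) :
    Function.Periodic (planeFun hF y) 2 := fun x =>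
  Prod.ext (periodic_tsum_expo _ x) (periodic_tsum_expo _ x)

theorem cm_planeFun (hF : PlaneSol a b n Z Fm Fp) (y : Plane →L[ℂ] ℂ) (k : ℤ) :
    cm (planeFun hF y) k = y (Fm k) := by
  have := pc_tsum (summable_norm_dual (summable_norm_neg hF.summ_m) y) (-k)
  rwa [neg_neg] at this

theorem cp_planeFun (hF : PlaneSol a b n Z Fm Fp) (y : Plane →L[ℂ] ℂ) (k : ℤ) :
    cp (planeFun hF y) k = y (Fp k) := pc_tsum (summable_norm_dual hF.summ_p y) k

theorem dual_ext {y y' : Plane →L[ℂ] ℂ} (h1 : y ebm = y' ebm) (h2 : y ebp = y' ebp) : y = y' := by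
  ext x
  rw [plane_eq x, map_add, map_add, map_smul, map_smul, map_smul, map_smul, h1, h2]

/-- The normalisation on the critical modes recovers `y` on the basis from the Fourier coefficients
with index `n`. -/
theorem planeFun_injective (hF : PlaneSol a b n Z Fm Fp) : Function.Injective (planeFun hF) := by
  intro y y' h
  refine dual_ext ?_ ?_
  · rw [← hF.self_m, ← cm_planeFun hF, ← cm_planeFun hF, h]
  · rw [← hF.self_p, ← cp_planeFun hF, ← cp_planeFun hF, h]

/-- The transpose of `Z`. -/
def transpose (Z : Plane →L[ℂ] Plane) : Module.End ℂ (Plane →L[ℂ] ℂ) where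
  toFun y := y.comp Z
  map_add' _ _ := rfl
  map_smul' _ _ := rfl

theorem transpose_apply (y : Plane →L[ℂ] ℂ) (x : Plane) : transpose Z y x = y (Z x) := rfl

theorem finrank_dual : Module.finrank ℂ (Plane →L[ℂ] ℂ) = 2 := by
  rw [← (LinearMap.toContinuousLinearMap (𝕜 := ℂ) (E := Plane) (F' := ℂ)).finrank_eq]
  have : Module.finrank ℂ (Plane →ₗ[ℂ] ℂ) = Module.finrank ℂ Plane :=
    Subspace.dual_finrank_eq
  rw [this, (WithLp.linearEquiv 1 ℂ (ℂ × ℂ)).finrank_eq]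
  simp

end planeSol

/-! ### Root spaces and algebraic multiplicities in a strip. -/

section roots

variable {w : ℤ → ℝ} {φ : L2c} {n : ℤ} {z : ℂ} {Z : Plane →L[ℂ] Plane} {Fm Fp : ℤ → Plane}
  {f g : ℝ → ℂ × ℂ}

/-- `planeFun` intertwines the transpose of `Z` with `L(φ)`: apply `y` to `L(φ) F = Z F`. -/
theorem zsMaps_planeFun (hF : PlaneSol (coeffA φ) (coeffB φ) n Z Fm Fp) (y : Plane →L[ℂ] ℂ) :
    ZSMaps φ (planeFun hF y) (planeFun hF (transpose Z y)) := by
  refine zsMaps_of_hasSum (continuous_planeFun hF y) (periodic_planeFun hF y)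
    (continuous_planeFun hF _) (periodic_planeFun hF _) fun k => ?_
  have h1 := (hF.sol.summ_m k).hasSum.mapL y
  have h2 := (hF.sol.summ_p k).hasSum.mapL y
  rw [← hF.sol.eqm k] at h1
  rw [← hF.sol.eqp k] at h2
  simp only [map_smul, map_sub, smul_eq_mul] at h1 h2
  simp only [cm_planeFun, cp_planeFun, transpose_apply]
  exact ⟨h1, h2⟩

theorem cm_smul_add (hf : Continuous f) (hg : Continuous g) (z : ℂ) (k : ℤ) :
    cm (z • f + g) k = z * cm f k + cm g k := by
  have := pc_add (u := fun x => z * (f x).1) (v := fun x => (g x).1)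
    ((continuous_const.mul hf.fst).intervalIntegrable _ _) (hg.fst.intervalIntegrable _ _) (-k)
  rw [pc_const_mul] at this
  exact this

theorem cp_smul_add (hf : Continuous f) (hg : Continuous g) (z : ℂ) (k : ℤ) :
    cp (z • f + g) k = z * cp f k + cp g k := by
  have := pc_add (u := fun x => z * (f x).2) (v := fun x => (g x).2)
    ((continuous_const.mul hf.snd).intervalIntegrable _ _) (hg.snd.intervalIntegrable _ _) k
  rw [pc_const_mul] at this
  exact this

/-- The inhomogeneous eigenvalue equation in Fourier form. -/
theorem ZSMaps.seq (h : ZSMaps φ f (z • f + g)) (hp : Function.Periodic f 2) (hg : Continuous g) :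
    (∀ k, Summable fun l => coeffA φ (k + l) • cp f l) ∧
    (∀ k, Summable fun l => coeffB φ (k + l) • cm f l) ∧
    (∃ M, ∀ k : ℤ, ‖cm g k + z * cm f k - k * Real.pi * cm f k‖ ≤ M ∧
      ‖cp g k + z * cp f k - k * Real.pi * cp f k‖ ≤ M) ∧
    (∀ k : ℤ, cm g k + z * cm f k - k * Real.pi * cm f k = ∑' l, coeffA φ (k + l) • cp f l) ∧
    (∀ k : ℤ, cp g k + z * cp f k - k * Real.pi * cp f k = ∑' l, coeffB φ (k + l) • cm f l) := by
  have hc := h.continuous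
  have hs := fun k => h.hasSum hp ((hc.const_smul z).add hg) k
  simp_rw [cm_smul_add hc hg, cp_smul_add hc hg] at hs
  refine ⟨fun k => (hs k).1.summable, fun k => (hs k).2.summable, ⟨max (∫ x in (0 : ℝ)..2, ‖pull φ.1 x * (f x).2‖)
    (∫ x in (0 : ℝ)..2, ‖pull φ.2 x * (f x).1‖), fun k => ⟨?_, ?_⟩⟩, fun k => ?_, fun k => ?_⟩
  rotate_left 2
  · rw [add_comm (cm g k)]; exact (hs k).1.tsum_eq.symm
  · rw [add_comm (cp g k)]; exact (hs k).2.tsum_eq.symm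
  · rw [add_comm (cm g k), (hs k).1.unique (hasSum_coeffA hc k)]
    exact (norm_pc_le _ _).trans (le_max_left _ _)
  · rw [add_comm (cp g k), (hs k).2.unique (hasSum_coeffB hc k)]
    exact (norm_pc_le _ _).trans (le_max_right _ _)

theorem ZSMaps.seqSol (h : ZSMaps φ f (z • f)) (hp : Function.Periodic f 2) :
    SeqSol (coeffA φ) (coeffB φ) (z • ContinuousLinearMap.id ℂ ℂ) (cm f) (cp f) := by
  have h' : ZSMaps φ f (z • f + 0) := by rwa [add_zero]
  obtain ⟨h1, h2, ⟨M, hM⟩, h4, h5⟩ := h'.seq hp continuous_zero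
  have e1 : ∀ k, cm (0 : ℝ → ℂ × ℂ) k = 0 := fun k => by simp [cm, pc]
  have e2 : ∀ k, cp (0 : ℝ → ℂ × ℂ) k = 0 := fun k => by simp [cp, pc]
  simp only [e1, e2, zero_add] at hM h4 h5
  exact ⟨h1, h2, ⟨M, hM⟩, h4, h5⟩

theorem eq_zero_of_coeff (hf : Continuous f) (hp : Function.Periodic f 2)
    (h : ∀ k, cm f k = 0 ∧ cp f k = 0) : f = 0 := by
  have h1 := eq_zero_of_pc_eq_zero hf.fst (fun x => by simp only [hp x]) fun k => by
    have := (h (-k)).1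
    rwa [cm, neg_neg] at this
  have h2 := eq_zero_of_pc_eq_zero hf.snd (fun x => by simp only [hp x]) fun k => (h k).2
  funext x
  exact Prod.ext (congrFun h1 x) (congrFun h2 x)

/-- A nontrivial eigenfunction in Fourier form. -/
def IsEigen (φ : L2c) (z : ℂ) : Prop :=
  ∃ fm fp, SeqSol (coeffA φ) (coeffB φ) (z • ContinuousLinearMap.id ℂ ℂ) fm fp ∧
    ∃ k, fm k ≠ 0 ∨ fp k ≠ 0

/-- A nontrivial chain of root vectors would end in an eigenfunction. -/
theorem rootSpace_eq_bot (h : ¬ IsEigen φ z) : ∀ k, rootSpace φ z k = ⊥ := by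
  intro k
  induction k with
  | zero => rfl
  | succ k ih =>
    refine (Submodule.eq_bot_iff _).2 fun f hf => ?_
    obtain ⟨hp, g, hg, hz⟩ := hf
    rw [ih, Submodule.mem_bot] at hg
    rw [hg, add_zero] at hz
    refine eq_zero_of_coeff hz.continuous hp fun k => ?_
    by_contra hne
    exact h ⟨_, _, hz.seqSol hp, k, by tauto⟩

theorem isEigen_of_algMult (h : algMult φ z ≠ 0) : IsEigen φ z := by
  by_contra hne
  refine h ?_
  rw [algMult]
  have : (⨆ k, rootSpace φ z k) = ⊥ := by simp [rootSpace_eq_bot hne]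
  rw [this]
  simp

theorem map_ker_le_rootSpace (hF : PlaneSol (coeffA φ) (coeffB φ) n Z Fm Fp) (k : ℕ) :
    (LinearMap.ker ((transpose Z - z • (1 : Module.End ℂ (Plane →L[ℂ] ℂ))) ^ k)).map (planeFun hF) ≤
      rootSpace φ z k := by
  have hS : ∀ y, transpose Z y =
      z • y + (transpose Z - z • (1 : Module.End ℂ (Plane →L[ℂ] ℂ))) y := fun y => by simp
  generalize transpose Z - z • (1 : Module.End ℂ (Plane →L[ℂ] ℂ)) = S at hS ⊢
  induction k with
  | zero =>
    rw [Submodule.map_le_iff_le_comap]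
    intro y hy
    rw [LinearMap.mem_ker, pow_zero, Module.End.one_apply] at hy
    rw [hy]
    exact Submodule.zero_mem _
  | succ k ih =>
    rw [Submodule.map_le_iff_le_comap] at ih ⊢
    intro y hy
    rw [LinearMap.mem_ker, pow_succ, Module.End.mul_apply] at hy
    have h1 := ih (LinearMap.mem_ker.2 hy)
    have h2 := zsMaps_planeFun hF y
    rw [hS y, map_add, map_smul] at h2
    exact ⟨periodic_planeFun hF y, _, h1, h2⟩

/-- Subtract from a root vector `f` the function of the functional `y₀` with the same critical
modes. By induction the source of `f` comes from a functional, so the difference solves an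
inhomogeneous equation to which `dual_eq_zero` applies. That `h` vanishes identifies `f`; that `y`
vanishes says that `transpose Z - z` maps `y₀` to `y'`. -/
theorem rootSpace_le_map_ker (hs : Small w (coeffA φ) (coeffB φ) n)
    (hF : PlaneSol (coeffA φ) (coeffB φ) n Z Fm Fp) (hz : ‖z - n * Real.pi‖ ≤ 3 / 4) (k : ℕ) :
    rootSpace φ z k ≤
    (LinearMap.ker ((transpose Z - z • (1 : Module.End ℂ (Plane →L[ℂ] ℂ))) ^ k)).map (planeFun hF) := by
  induction k with
  | zero => exact bot_le
  | succ k ih =>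
    rintro f ⟨hp, g, hg, hzs⟩
    obtain ⟨y', hy', rfl⟩ := Submodule.mem_map.1 (ih hg)
    have hc := hzs.continuous
    obtain ⟨y₀, v1, v2⟩ : ∃ y₀ : Plane →L[ℂ] ℂ, y₀ ebm = cm f n ∧ y₀ ebp = cp f n :=
      ⟨cm f n • WithLp.fstL 1 ℂ ℂ ℂ + cp f n • WithLp.sndL 1 ℂ ℂ ℂ, by simp [ebm], by simp [ebp]⟩
    set h := f + (-1 : ℂ) • planeFun hF y₀ with hh
    have hhp : Function.Periodic h 2 := hp.add ((periodic_planeFun hF y₀).smul _)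
    set y := y' + (z • y₀ - transpose Z y₀) with hy
    have hzh : ZSMaps φ h (z • h + planeFun hF y) := by
      have := hzs.add ((zsMaps_planeFun hF y₀).smul (-1))
      have e : z • f + planeFun hF y' + (-1 : ℂ) • planeFun hF (transpose Z y₀) =
          z • h + planeFun hF y := by
        rw [hh, hy, map_add (planeFun hF), map_sub (planeFun hF), map_smul (planeFun hF)]
        module
      rwa [e] at this
    obtain ⟨h1, h2, h3, h4, h5⟩ := hzh.seq hhp (continuous_planeFun hF y)
    have c1 : ∀ k, cm h k = cm f k - y₀ (Fm k) := fun k => by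
      rw [hh, add_comm, cm_smul_add (continuous_planeFun hF y₀) hc, cm_planeFun]; ring
    have c2 : ∀ k, cp h k = cp f k - y₀ (Fp k) := fun k => by
      rw [hh, add_comm, cp_smul_add (continuous_planeFun hF y₀) hc, cp_planeFun]; ring
    simp only [cm_planeFun, cp_planeFun] at h3 h4 h5
    obtain ⟨hy0, hh0⟩ := dual_eq_zero hs hF.sol hF.self_m hF.self_p hF.norm_le hz
      (by rw [c1, hF.self_m, v1, sub_self]) (by rw [c2, hF.self_p, v2, sub_self]) h1 h2 h3 h4 h5
    have hf0 : h = 0 := eq_zero_of_coeff hzh.continuous hhp hh0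
    have hfe : f = planeFun hF y₀ := by
      rw [hh] at hf0
      have := eq_neg_of_add_eq_zero_left hf0
      rw [this]; simp
    have e : (transpose Z - z • (1 : Module.End ℂ (Plane →L[ℂ] ℂ))) y₀ = y' := by
      have : y' = transpose Z y₀ - z • y₀ := by
        rw [hy] at hy0
        rw [eq_neg_of_add_eq_zero_left hy0]; abel
      rw [this]; simp
    refine Submodule.mem_map.2 ⟨y₀, ?_, hfe.symm⟩
    rw [LinearMap.mem_ker, pow_succ, Module.End.mul_apply, e]
    exact LinearMap.mem_ker.1 hy'

theorem iSup_rootSpace (hs : Small w (coeffA φ) (coeffB φ) n)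
    (hF : PlaneSol (coeffA φ) (coeffB φ) n Z Fm Fp) (hz : |z.re - n * Real.pi| ≤ Real.pi / 2) :
    ⨆ k, rootSpace φ z k = ((transpose Z).maxGenEigenspace z).map (planeFun hF) := by
  have hk : ∀ k, rootSpace φ z k = (LinearMap.ker
      ((transpose Z - z • (1 : Module.End ℂ (Plane →L[ℂ] ℂ))) ^ k)).map (planeFun hF) := by
    intro k
    refine le_antisymm ?_ (map_ker_le_rootSpace hF k)
    -- The comparison above requires `z` in the disc of radius `3/4`. Eigenvalues in the strip lie
    -- there, and at all other points the root spaces are trivial.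
    by_cases h : IsEigen φ z
    · obtain ⟨fm, fp, hf, hne⟩ := h
      exact rootSpace_le_map_ker hs hF (hf.norm_sub_le hs hz hne) k
    · rw [rootSpace_eq_bot h]; exact bot_le
  simp_rw [hk]
  rw [← Submodule.map_iSup, ← Module.End.iSup_genEigenspace_eq]
  simp_rw [Module.End.genEigenspace_nat]

theorem algMult_eq_rootMultiplicity (hs : Small w (coeffA φ) (coeffB φ) n)
    (hF : PlaneSol (coeffA φ) (coeffB φ) n Z Fm Fp) (hz : |z.re - n * Real.pi| ≤ Real.pi / 2) :
    algMult φ z = (transpose Z).charpoly.roots.count z := by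
  rw [algMult, iSup_rootSpace hs hF hz, Polynomial.count_roots,
    ← LinearMap.finrank_maxGenEigenspace_eq,
    ← (Submodule.equivMapOfInjective (planeFun hF) (planeFun_injective hF) _).rank_eq,
    ← Module.finrank_eq_rank]
  simp

/-- Each strip contains two eigenvalues, and these are close to its centre. -/
theorem exists_pair (hs : Small w (coeffA φ) (coeffB φ) n) : ∃ z₁ z₂ : ℂ,
    ‖z₁ - n * Real.pi‖ ≤ 3 / 4 ∧ ‖z₂ - n * Real.pi‖ ≤ 3 / 4 ∧
    ∀ z : ℂ, |z.re - n * Real.pi| ≤ Real.pi / 2 → algMult φ z = ({z₁, z₂} : Multiset ℂ).count z := by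
  obtain ⟨Z, Fm, Fp, hF⟩ := hs.exists_planeSol
  have hcard : (transpose Z).charpoly.roots.card = 2 := by
    rw [IsAlgClosed.card_roots_eq_natDegree, LinearMap.charpoly_natDegree, finrank_dual]
  obtain ⟨z₁, z₂, hz⟩ := Multiset.card_eq_two.1 hcard
  have hroot : ∀ z ∈ (transpose Z).charpoly.roots, ‖z - n * Real.pi‖ ≤ 3 / 4 := by
    intro z hz
    have hev : (transpose Z).HasEigenvalue z :=
      (Module.End.hasEigenvalue_iff_isRoot_charpoly _ _).2 (Polynomial.isRoot_of_mem_roots hz)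
    obtain ⟨y, hy⟩ := hev.exists_hasEigenvector
    have e := hy.apply_eq_smul
    have e2 : (z - n * Real.pi) • y =
        y.comp (Z - ((n : ℂ) * Real.pi) • ContinuousLinearMap.id ℂ Plane) := by
      ext x
      have := congrArg (fun T : Plane →L[ℂ] ℂ => T x) e
      simp only [transpose_apply] at this
      simp only [smul_apply, ContinuousLinearMap.comp_apply, sub_apply,
        ContinuousLinearMap.id_apply, map_sub, map_smul, this]
      simp only [smul_eq_mul]; ring
    have h1 : ‖z - n * Real.pi‖ * ‖y‖ ≤ 3 / 4 * ‖y‖ := by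
      rw [← norm_smul, e2]
      refine (ContinuousLinearMap.opNorm_comp_le _ _).trans ?_
      rw [mul_comm]
      exact mul_le_mul_of_nonneg_right hF.norm_le (norm_nonneg _)
    exact le_of_mul_le_mul_right h1 (norm_pos_iff.2 hy.2)
  refine ⟨z₁, z₂, hroot _ (by simp [hz]), hroot _ (by simp [hz]), fun z hz' => ?_⟩
  rw [algMult_eq_rootMultiplicity hs hF hz', hz]

end roots

/-! ### Numbering: which members of the sequences lie in which strip. -/

section index

/-- Two interlacing real sequences with two members in each far out strip. -/
structure Interlaced (α β : ℤ → ℝ) (N : ℕ) : Prop where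
  le : ∀ i, α i ≤ β i
  le_succ : ∀ i, β i ≤ α (i + 1)
  count : ∀ n : ℤ, (N : ℤ) ≤ |n| → {i | |α i - n * Real.pi| ≤ Real.pi / 2}.encard +
    {i | |β i - n * Real.pi| ≤ Real.pi / 2}.encard = 2
  close_left : ∀ n : ℤ, (N : ℤ) ≤ |n| → ∀ i, |α i - n * Real.pi| ≤ Real.pi / 2 →
    |α i - n * Real.pi| ≤ 3 / 4
  close_right : ∀ n : ℤ, (N : ℤ) ≤ |n| → ∀ i, |β i - n * Real.pi| ≤ Real.pi / 2 →
    |β i - n * Real.pi| ≤ 3 / 4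
  asymp : ∃ K : ℕ, ∀ i : ℤ, (K : ℤ) ≤ |i| → |α i - i * Real.pi| ≤ 1 ∧ |β i - i * Real.pi| ≤ 1

variable {α β : ℤ → ℝ} {N : ℕ}

/-- Reflection at the origin exchanges the two sequences and reduces negative strips to positive
ones. -/
theorem Interlaced.reflect (h : Interlaced α β N) :
    Interlaced (fun i => -β (-i)) (fun i => -α (-i)) N := by
  have e : ∀ (x : ℝ) (n : ℤ), |-x - n * Real.pi| = |x - ((-n : ℤ) : ℝ) * Real.pi| := by
    intro x n
    rw [← abs_neg]; congr 1; push_cast; ring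
  have c : ∀ (γ : ℤ → ℝ) (n : ℤ), {i | |-γ (-i) - n * Real.pi| ≤ Real.pi / 2}.encard =
      {i | |γ i - ((-n : ℤ) : ℝ) * Real.pi| ≤ Real.pi / 2}.encard := by
    intro γ n
    rw [← Function.Injective.encard_image neg_injective {i | |γ i - ((-n : ℤ) : ℝ) * Real.pi| ≤ _}]
    congr 1
    ext i
    simp only [e, Set.mem_ofPred_eq, Set.image_neg_eq_neg, Set.mem_neg]
  refine ⟨fun i => neg_le_neg (h.le _), fun i => ?_, fun n hn => ?_, fun n hn i hi => ?_,
    fun n hn i hi => ?_, ?_⟩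
  · have := h.le_succ (-(i + 1))
    rw [neg_add, neg_add_cancel_right] at this
    rw [neg_add]
    exact neg_le_neg this
  · rw [c, c, add_comm]
    exact h.count (-n) (by rwa [abs_neg])
  · rw [e] at hi ⊢
    exact h.close_right (-n) (by rwa [abs_neg]) _ hi
  · rw [e] at hi ⊢
    exact h.close_left (-n) (by rwa [abs_neg]) _ hi
  · obtain ⟨K, hK⟩ := h.asymp
    refine ⟨K, fun i hi => ?_⟩
    rw [e, e]
    exact (hK (-i) (by rwa [abs_neg])).symm

theorem Interlaced.mono_left (h : Interlaced α β N) : Monotone α :=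
  monotone_int_of_le_succ fun i => (h.le i).trans (h.le_succ i)

theorem Interlaced.mono_right (h : Interlaced α β N) : Monotone β :=
  monotone_int_of_le_succ fun i => (h.le_succ i).trans (h.le (i + 1))

/-- Inward induction. If everything from index `n + 1` on lies above strip `n`, its two members can
only be `α n` and `β n`: were `α n` below it, at most `β n` would remain; were `β (n-1)` not below
it, there would be three. -/
theorem Interlaced.separated_step (h : Interlaced α β N) {n : ℤ} (hn : (N : ℤ) ≤ n)
    (h1 : (n + 1 / 2) * Real.pi ≤ α (n + 1)) (h2 : β n < (n + 1 / 2) * Real.pi) :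
    (n - 1 / 2) * Real.pi ≤ α n ∧ β (n - 1) < (n - 1 / 2) * Real.pi := by
  have hpi := Real.pi_gt_three
  have hN : (N : ℤ) ≤ |n| := hn.trans (le_abs_self n)
  have hc := h.count n hN
  -- Adjacent closed strips share their boundary; the bound `3/4 < π/2` excludes members on it.
  have inA : ∀ i, |α i - n * Real.pi| ≤ Real.pi / 2 → i ≤ n := by
    intro i hi
    by_contra hlt
    have := h.mono_left (show n + 1 ≤ i by lia)
    have h3 := (abs_le.1 (h.close_left n hN i hi)).2
    nlinarith
  have inB : ∀ i, |β i - n * Real.pi| ≤ Real.pi / 2 → i ≤ n := by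
    intro i hi
    by_contra hlt
    have := h.mono_left (show n + 1 ≤ i by lia)
    have h3 := (abs_le.1 (h.close_right n hN i hi)).2
    have h4 := h.le i
    nlinarith
  have hlow : (n - 1 / 2) * Real.pi ≤ α n := by
    by_contra hlt
    push Not at hlt
    have hA : {i | |α i - n * Real.pi| ≤ Real.pi / 2} = ∅ := by
      refine Set.eq_empty_iff_forall_notMem.2 fun i hi => ?_
      have h3 := h.mono_left (inA i hi)
      have h4 := (abs_le.1 (show |α i - n * Real.pi| ≤ Real.pi / 2 from hi)).1
      linarith
    have hB : {i | |β i - n * Real.pi| ≤ Real.pi / 2} ⊆ {n} := by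
      intro i hi
      have h3 := inB i hi
      by_contra hne
      have h5 := h.mono_left (show i + 1 ≤ n by
        have : i ≠ n := hne
        lia)
      have h6 := h.le_succ i
      have h4 := (abs_le.1 (show |β i - n * Real.pi| ≤ Real.pi / 2 from hi)).1
      linarith
    have h5 := Set.encard_le_encard hB
    rw [Set.encard_singleton] at h5
    rw [hA, Set.encard_empty, zero_add] at hc
    rw [hc] at h5
    exact absurd h5 (by norm_num)
  refine ⟨hlow, ?_⟩
  by_contra hge
  push Not at hge
  have hle := h.le n
  have hA : {n} ⊆ {i | |α i - n * Real.pi| ≤ Real.pi / 2} := by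
    refine Set.singleton_subset_iff.2 ?_
    change |α n - n * Real.pi| ≤ Real.pi / 2
    refine abs_le.2 ⟨?_, ?_⟩ <;> linarith
  have hB : {n - 1, n} ⊆ {i | |β i - n * Real.pi| ≤ Real.pi / 2} := by
    refine Set.insert_subset_iff.2 ⟨?_, Set.singleton_subset_iff.2 ?_⟩
    · change |β (n - 1) - n * Real.pi| ≤ Real.pi / 2
      have := h.mono_right (show n - 1 ≤ n by lia)
      refine abs_le.2 ⟨?_, ?_⟩ <;> linarith
    · change |β n - n * Real.pi| ≤ Real.pi / 2
      refine abs_le.2 ⟨?_, ?_⟩ <;> linarith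
  have h5 := add_le_add (Set.encard_le_encard hA) (Set.encard_le_encard hB)
  rw [hc, Set.encard_singleton, Set.encard_pair (by lia)] at h5
  exact absurd h5 (by norm_num)

theorem Interlaced.separated (h : Interlaced α β N) {n : ℤ} (hn : (N : ℤ) ≤ n) :
    (n - 1 / 2) * Real.pi ≤ α n ∧ β (n - 1) < (n - 1 / 2) * Real.pi := by
  have hpi := Real.pi_gt_three
  obtain ⟨K, hK⟩ := h.asymp
  -- The asymptotics start the induction, since `1 < π/2`; the shift by one is there because `β (m -
  -- 1)` is involved.
  have hbase : ∀ m : ℤ, (K : ℤ) + 1 ≤ m →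
      (m - 1 / 2) * Real.pi ≤ α m ∧ β (m - 1) < (m - 1 / 2) * Real.pi := by
    intro m hm
    have h1 := (abs_le.1 (hK m ((by lia : (K : ℤ) ≤ m).trans (le_abs_self m))).1).1
    have h2 := (abs_le.1 (hK (m - 1) ((by lia : (K : ℤ) ≤ m - 1).trans (le_abs_self _))).2).2
    push_cast at h2
    constructor <;> linarith
  have hdown : ∀ d : ℕ, ∀ m : ℤ, (N : ℤ) ≤ m → (K : ℤ) + 1 ≤ m + d →
      (m - 1 / 2) * Real.pi ≤ α m ∧ β (m - 1) < (m - 1 / 2) * Real.pi := by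
    intro d
    induction d with
    | zero => intro m _ hm; exact hbase m (by simpa using hm)
    | succ d ih =>
      intro m hm hd
      have := ih (m + 1) (by lia) (by push_cast at hd; lia)
      push_cast at this
      rw [add_sub_cancel_right] at this
      refine h.separated_step hm ?_ ?_
      · linarith [this.1]
      · linarith [this.2]
  exact hdown (K + 1) n hn (by push_cast; lia)

theorem Interlaced.close_of_le (h : Interlaced α β N) {n : ℤ} (hn : (N : ℤ) ≤ n) :
    |α n - n * Real.pi| ≤ Real.pi / 2 ∧ |β n - n * Real.pi| ≤ Real.pi / 2 := by
  have h1 := (h.separated hn).1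
  have h2 := (h.separated (n := n + 1) (by lia)).2
  rw [add_sub_cancel_right] at h2
  push_cast at h2
  have h3 := h.le n
  constructor <;> refine abs_le.2 ⟨?_, ?_⟩ <;> linarith

theorem Interlaced.close (h : Interlaced α β N) {n : ℤ} (hn : (N : ℤ) ≤ |n|) :
    |α n - n * Real.pi| ≤ Real.pi / 2 ∧ |β n - n * Real.pi| ≤ Real.pi / 2 := by
  rcases le_abs.1 hn with hn | hn
  · exact h.close_of_le hn
  · have := h.reflect.close_of_le hn
    simp only [neg_neg] at this
    have e : ∀ x : ℝ, |-x - ((-n : ℤ) : ℝ) * Real.pi| = |x - n * Real.pi| := by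
      intro x
      rw [← abs_neg]; congr 1; push_cast; ring
    rw [e, e] at this
    exact this.symm

end index

/-! ### The periodic spectrum far from the origin. -/

section spectrum

variable {w : ℤ → ℝ} {φ : L2c} {lm lp : ℤ → ℂ} {N : ℕ}

theorem IsPeriodicSpectrum.algMult_left (h : IsPeriodicSpectrum φ lm lp) (i : ℤ) :
    algMult φ (lm i) ≠ 0 := by
  rw [← h.mult]
  have : {n | lm n = lm i}.encard ≠ 0 := Set.encard_ne_zero.2 ⟨i, rfl⟩
  exact fun h => this (add_eq_zero.1 h).1

theorem IsPeriodicSpectrum.algMult_right (h : IsPeriodicSpectrum φ lm lp) (i : ℤ) :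
    algMult φ (lp i) ≠ 0 := by
  rw [← h.mult]
  have : {n | lp n = lp i}.encard ≠ 0 := Set.encard_ne_zero.2 ⟨i, rfl⟩
  exact fun h => this (add_eq_zero.1 h).2

theorem LexLE.re_le {a b : ℂ} (h : LexLE a b) : a.re ≤ b.re := by
  rcases h with h | h
  · exact h.le
  · exact h.1.le

theorem sub_re_eq (z : ℂ) (n : ℤ) : (z - n * Real.pi).re = z.re - n * Real.pi := by simp

theorem abs_re_sub_le (z : ℂ) (n : ℤ) : |z.re - n * Real.pi| ≤ ‖z - n * Real.pi‖ := by
  rw [← sub_re_eq]; exact Complex.abs_re_le_norm _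

theorem eventually_close {l : ℤ → ℂ} (h : Summable fun n : ℤ => ‖l n - n * Real.pi‖ ^ 2) :
    ∀ᶠ n in cofinite, |(l n).re - n * Real.pi| ≤ 1 := by
  have := h.tendsto_cofinite_zero
  filter_upwards [this.eventually (gt_mem_nhds one_pos)] with n hn
  refine (abs_re_sub_le _ _).trans ?_
  exact ((sq_lt_one_iff₀ (norm_nonneg _)).1 hn).le

theorem exists_bound_of_cofinite {p : ℤ → Prop} (h : ∀ᶠ n in cofinite, p n) :
    ∃ K : ℕ, ∀ i : ℤ, (K : ℤ) ≤ |i| → p i := by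
  have hf : {n | ¬ p n}.Finite := h
  obtain ⟨C, hC⟩ := (hf.image Int.natAbs).bddAbove
  refine ⟨C + 1, fun i hi => ?_⟩
  by_contra hne
  have := hC ⟨i, hne, rfl⟩
  rw [Int.abs_eq_natAbs] at hi
  omega

theorem IsPeriodicSpectrum.interlaced (h : IsPeriodicSpectrum φ lm lp)
    (hs : ∀ n : ℤ, (N : ℤ) ≤ |n| → Small w (coeffA φ) (coeffB φ) n) :
    Interlaced (fun i => (lm i).re) (fun i => (lp i).re) N := by
  have hpi := Real.pi_gt_three
  have hclose : ∀ n : ℤ, (N : ℤ) ≤ |n| → ∀ z, algMult φ z ≠ 0 →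
      |z.re - n * Real.pi| ≤ Real.pi / 2 → |z.re - n * Real.pi| ≤ 3 / 4 := by
    intro n hn z hz hstrip
    obtain ⟨fm, fp, hf, hne⟩ := isEigen_of_algMult hz
    exact (abs_re_sub_le z n).trans (hf.norm_sub_le (hs n hn) hstrip hne)
  refine ⟨fun i => (h.lex_gap i).re_le, fun i => (h.lex_next i).re_le, fun n hn => ?_,
    fun n hn i hi => hclose n hn _ (h.algMult_left i) hi,
    fun n hn i hi => hclose n hn _ (h.algMult_right i) hi,
    exists_bound_of_cofinite ((eventually_close h.asymp_minus).and (eventually_close h.asymp_plus))⟩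
  obtain ⟨z₁, z₂, hz₁, hz₂, hm⟩ := exists_pair (hs n hn)
  have s₁ : |z₁.re - n * Real.pi| ≤ Real.pi / 2 := (abs_re_sub_le _ _).trans (by linarith)
  have s₂ : |z₂.re - n * Real.pi| ≤ Real.pi / 2 := (abs_re_sub_le _ _).trans (by linarith)
  have hset : ∀ l : ℤ → ℂ, (∀ i, algMult φ (l i) ≠ 0) →
      {i | |(l i).re - n * Real.pi| ≤ Real.pi / 2} = {i | l i = z₁} ∪ {i | l i = z₂} := by
    intro l hl
    ext i
    constructor
    · intro hi
      have := hl i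
      rw [hm _ hi, Ne, Nat.cast_eq_zero, Multiset.count_eq_zero, not_not] at this
      simpa using this
    · rintro (hi | hi)
      · change |(l i).re - _| ≤ _
        rw [show l i = z₁ from hi]; exact s₁
      · change |(l i).re - _| ≤ _
        rw [show l i = z₂ from hi]; exact s₂
  rw [hset lm h.algMult_left, hset lp h.algMult_right]
  -- A double eigenvalue is counted twice at one point; otherwise two simple ones are counted at
  -- different points.
  by_cases he : z₁ = z₂
  · subst he
    rw [Set.union_self, Set.union_self, h.mult, hm _ s₁]
    simp
  · have hd : ∀ l : ℤ → ℂ, Disjoint {i | l i = z₁} {i | l i = z₂} := by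
      intro l
      refine Set.disjoint_left.2 fun i h1 h2 => he ?_
      exact (show l i = z₁ from h1).symm.trans h2
    rw [Set.encard_union_eq (hd lm), Set.encard_union_eq (hd lp), add_add_add_comm, h.mult, h.mult,
      hm _ s₁, hm _ s₂]
    simp [he, Ne.symm he]
    norm_num

/-- The far out eigenvalues are close to the unperturbed ones. -/
theorem IsPeriodicSpectrum.close (h : IsPeriodicSpectrum φ lm lp)
    (hs : ∀ n : ℤ, (N : ℤ) ≤ |n| → Small w (coeffA φ) (coeffB φ) n) {n : ℤ} (hn : (N : ℤ) ≤ |n|) :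
    (|(lm n).re - n * Real.pi| ≤ Real.pi / 2 ∧ |(lp n).re - n * Real.pi| ≤ Real.pi / 2) ∧
    ‖lm n - n * Real.pi‖ ≤ 3 / 4 ∧ ‖lp n - n * Real.pi‖ ≤ 3 / 4 := by
  have h1 := (h.interlaced hs).close hn
  refine ⟨h1, ?_, ?_⟩
  · obtain ⟨fm, fp, hf, hne⟩ := isEigen_of_algMult (h.algMult_left n)
    exact hf.norm_sub_le (hs n hn) h1.1 hne
  · obtain ⟨fm, fp, hf, hne⟩ := isEigen_of_algMult (h.algMult_right n)
    exact hf.norm_sub_le (hs n hn) h1.2 hne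

theorem IsPeriodicSpectrum.gap_le (h : IsPeriodicSpectrum φ lm lp) (hφ : φ ∈ Hw w)
    (hs : ∀ n : ℤ, (N : ℤ) ≤ |n| → Small w (coeffA φ) (coeffB φ) n) {n : ℤ} (hn : (N : ℤ) ≤ |n|) :
    w (2 * n) ^ 2 * ‖lp n - lm n‖ ^ 2 ≤
      6 * wTerm w φ n + 288 * wNorm w φ ^ 6 * (bracket n)⁻¹ ^ 2 := by
  obtain ⟨⟨h1, h2⟩, -⟩ := h.close hs hn
  obtain ⟨fm, fp, hf, hne⟩ := isEigen_of_algMult (h.algMult_left n)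
  obtain ⟨fm', fp', hf', hne'⟩ := isEigen_of_algMult (h.algMult_right n)
  have := NLS.gap_le (hs n hn) hf' h2 hne' hf h1 hne
  rw [(wSummable_coeff hφ).2.2, coeffA_two_mul, coeffB_two_mul] at this
  refine this.trans (le_of_eq ?_)
  rw [wTerm, inv_pow, div_eq_mul_inv]
  ring

end spectrum

/-! ### Tails of the norm and of `∑ ⟨n⟩⁻²`. -/

section tailsum

variable {N : ℕ}

theorem bracket_mono {n : ℤ} (h : (N : ℤ) ≤ |n|) : bracket N ≤ bracket n := by
  have : ((N : ℤ) : ℝ) ≤ ((|n| : ℤ) : ℝ) := Int.cast_le.2 h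
  push_cast at this
  rw [bracket, bracket, Nat.abs_cast]
  linarith

theorem hasSum_telescope (N : ℕ) :
    HasSum (fun k : ℕ => 2 / ((N : ℝ) + k + 1) - 2 / ((N : ℝ) + (k + 1 : ℕ) + 1)) (2 / (N + 1)) := by
  have hnn : ∀ k : ℕ, 0 ≤ 2 / ((N : ℝ) + k + 1) - 2 / ((N : ℝ) + (k + 1 : ℕ) + 1) := by
    intro k
    rw [sub_nonneg]
    gcongr
    simp
  rw [hasSum_iff_tendsto_nat_of_nonneg hnn]
  simp_rw [Finset.sum_range_sub' (fun k : ℕ => 2 / ((N : ℝ) + k + 1))]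
  have h0 : Tendsto (fun k : ℕ => 2 / ((N : ℝ) + k + 1)) atTop (𝓝 0) := by
    refine Tendsto.div_atTop tendsto_const_nhds ?_
    refine tendsto_atTop_add_const_right _ _ ?_
    exact tendsto_atTop_add_const_left _ _ tendsto_natCast_atTop_atTop
  simpa using tendsto_const_nhds.sub h0

/-- The tails of `∑ (1 + |n|)⁻²`. -/
theorem tsum_bracket_inv_sq_le (N : ℕ) :
    ∑' n : {n : ℤ // (N : ℤ) ≤ |n|}, (bracket (n : ℤ))⁻¹ ^ 2 ≤ 4 / bracket N := by
  set g : ℕ → ℝ := fun k => 2 / ((N : ℝ) + k + 1) - 2 / ((N : ℝ) + (k + 1 : ℕ) + 1) with hg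
  have hgnn : ∀ k, 0 ≤ g k := by
    intro k
    rw [hg, sub_nonneg]
    gcongr
    simp
  have hinj : Function.Injective fun k : ℕ => (N : ℤ) + k := fun a b h => by simpa using h
  set G : ℤ → ℝ := Function.extend (fun k : ℕ => (N : ℤ) + k) g 0 with hG
  have hGs : HasSum G (2 / (N + 1)) := (hasSum_extend_zero hinj).2 (hasSum_telescope N)
  have hGs' : HasSum (fun n => G (-n)) (2 / (N + 1)) :=
    ((Equiv.neg ℤ).hasSum_iff (f := G)).2 hGs
  have hGnn : ∀ n, 0 ≤ G n := by
    intro n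
    by_cases h : ∃ k : ℕ, (N : ℤ) + k = n
    · obtain ⟨k, rfl⟩ := h
      rw [hG, hinj.extend_apply]
      exact hgnn k
    · rw [hG, Function.extend_apply' _ _ _ h]
      rfl
  have hGle : ∀ n : ℤ, (N : ℤ) ≤ n → (bracket n)⁻¹ ^ 2 ≤ G n := by
    intro n hn
    obtain ⟨k, rfl⟩ := Int.le.dest hn
    rw [hG, hinj.extend_apply, hg]
    have h1 : bracket (((N : ℤ) + k : ℤ) : ℝ) = N + k + 1 := by
      rw [bracket, abs_of_nonneg (by push_cast; positivity)]
      push_cast; ring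
    rw [h1]
    have h0 : (0 : ℝ) < N + k + 1 := by positivity
    -- Comparison with a telescoping series: `1/x² ≤ 2/(x(x+1))` for `x ≥ 1`. Each sign of `n`
    -- contributes `2/⟨N⟩`.
    have h2 : 2 / ((N : ℝ) + k + 1) - 2 / ((N : ℝ) + (k + 1 : ℕ) + 1) =
        2 / (((N : ℝ) + k + 1) * (N + k + 1 + 1)) := by
      push_cast; field_simp; ring
    simp only [h2]
    rw [inv_pow, inv_eq_one_div, div_le_div_iff₀ (by positivity) (by positivity)]
    have : (0 : ℝ) ≤ N + k := by positivity
    nlinarith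
  have hle : ∀ n : {n : ℤ // (N : ℤ) ≤ |n|}, (bracket (n : ℤ))⁻¹ ^ 2 ≤ G n + G (-n) := by
    rintro ⟨n, hn⟩
    rcases le_abs.1 hn with h | h
    · exact (hGle n h).trans (le_add_of_nonneg_right (hGnn _))
    · have := hGle (-n) h
      rw [bracket, Int.cast_neg, abs_neg] at this
      exact this.trans (le_add_of_nonneg_left (hGnn _))
  have hsum := hGs.add hGs'
  have hS : Summable fun n : {n : ℤ // (N : ℤ) ≤ |n|} => G n + G (-n) :=
    hsum.summable.comp_injective Subtype.val_injective
  calc _ ≤ ∑' n : {n : ℤ // (N : ℤ) ≤ |n|}, (G n + G (-n)) :=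
        (hasSum_bracket_inv_sq.summable.comp_injective Subtype.val_injective).tsum_le_tsum hle hS
    _ ≤ ∑' n : ℤ, (G n + G (-n)) :=
        Summable.tsum_subtype_le (fun n => G n + G (-n)) {n : ℤ | (N : ℤ) ≤ |n|}
          (fun n => add_nonneg (hGnn _) (hGnn _)) hsum.summable
    _ = 4 / bracket N := by
        rw [hsum.tsum_eq, bracket, Nat.abs_cast]; ring

theorem fourierCoeff_tsum {ι : Type*} {e : ι → ℤ} (he : Function.Injective e)
    (f : Lp ℂ 2 (AddCircle.haarAddCircle (T := (1 : ℝ)))) (m : ℤ) :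
    fourierCoeff (∑' i, fourierCoeff f (e i) • fourierLp 2 (e i) :
        Lp ℂ 2 (AddCircle.haarAddCircle (T := (1 : ℝ)))) m =
      ∑' i, if e i = m then fourierCoeff f m else 0 := by
  have hs : Summable fun i => fourierCoeff f (e i) •
      (fourierLp 2 (e i) : Lp ℂ 2 (AddCircle.haarAddCircle (T := (1 : ℝ)))) :=
    (hasSum_fourier_series_L2 f).summable.comp_injective he
  have hr : ∀ g : Lp ℂ 2 (AddCircle.haarAddCircle (T := (1 : ℝ))),
      fourierCoeff g m = innerSL ℂ (fourierLp 2 m) g := by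
    intro g
    rw [← fourierBasis_repr, HilbertBasis.repr_apply_apply, coe_fourierBasis, innerSL_apply_apply]
  rw [hr, (innerSL ℂ _).map_tsum hs]
  refine tsum_congr fun i => ?_
  rw [map_smul, innerSL_apply_apply, orthonormal_iff_ite.1 orthonormal_fourier m (e i)]
  by_cases h : e i = m
  · simp [h]
  · simp [h, Ne.symm h]

theorem tsum_subtype_ite {p : ℤ → Prop} [DecidablePred p] (m : ℤ) (c : ℂ) :
    ∑' i : {n // p n}, (if (i : ℤ) = m then c else 0) = if p m then c else 0 := by
  split_ifs with h
  · rw [tsum_eq_single ⟨m, h⟩ fun i hi => if_neg fun e => hi (Subtype.ext e)]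
    simp
  · have hne : ∀ i : {n // p n}, (i : ℤ) ≠ m := fun i e => h (e ▸ i.2)
    simp [hne]

theorem coeffPlus_tail (φ : L2c) (n : ℤ) :
    coeffPlus (tail N φ) n = if (N : ℤ) ≤ |n| then coeffPlus φ n else 0 := by
  rw [← tsum_subtype_ite (p := fun n => (N : ℤ) ≤ |n|)]
  exact fourierCoeff_tsum (e := fun i : {n : ℤ // (N : ℤ) ≤ |n|} => (i : ℤ))
    Subtype.val_injective φ.2 n

theorem coeffMinus_tail (φ : L2c) (n : ℤ) :
    coeffMinus (tail N φ) n = if (N : ℤ) ≤ |n| then coeffMinus φ n else 0 := by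
  rw [← tsum_subtype_ite (p := fun n => (N : ℤ) ≤ |n|)]
  refine (fourierCoeff_tsum (e := fun i : {n : ℤ // (N : ℤ) ≤ |n|} => -(i : ℤ))
    (neg_injective.comp Subtype.val_injective) φ.1 (-n)).trans ?_
  simp only [neg_inj]
  rfl

theorem wTerm_tail (w : ℤ → ℝ) (φ : L2c) (n : ℤ) :
    wTerm w (tail N φ) n = {n : ℤ | (N : ℤ) ≤ |n|}.indicator (wTerm w φ) n := by
  rw [wTerm, coeffPlus_tail, coeffMinus_tail, Set.indicator_apply]
  simp only [Set.mem_ofPred_eq]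
  split_ifs <;> simp [wTerm]

theorem wTerm_nonneg (w : ℤ → ℝ) (φ : L2c) (n : ℤ) : 0 ≤ wTerm w φ n := by
  rw [wTerm]; positivity

theorem wNorm_sq (w : ℤ → ℝ) (φ : L2c) : wNorm w φ ^ 2 = ∑' n, wTerm w φ n :=
  Real.sq_sqrt (tsum_nonneg (wTerm_nonneg w φ))

theorem wNorm_tail_sq (w : ℤ → ℝ) (φ : L2c) :
    wNorm w (tail N φ) ^ 2 = ∑' n : {n : ℤ // (N : ℤ) ≤ |n|}, wTerm w φ n := by
  rw [wNorm_sq]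
  refine (tsum_congr (wTerm_tail w φ)).trans ?_
  exact (tsum_subtype {n : ℤ | (N : ℤ) ≤ |n|} (wTerm w φ)).symm

theorem wNorm_tail_sq_le {w : ℤ → ℝ} {φ : L2c} (hφ : φ ∈ Hw w) :
    wNorm w (tail N φ) ^ 2 ≤ wNorm w φ ^ 2 := by
  rw [wNorm_tail_sq, wNorm_sq]
  exact Summable.tsum_subtype_le (wTerm w φ) {n : ℤ | (N : ℤ) ≤ |n|} (wTerm_nonneg w φ) hφ

end tailsum

/-! ### The first estimate. -/

section gaps

variable {w : ℤ → ℝ} {φ : L2c} {lm lp : ℤ → ℂ} {N : ℕ}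

theorem small_of_le_abs (hw : w ∈ weightsOne) (hφ : φ ∈ Hw w)
    (hN : 8 * wNorm w φ ^ 2 ≤ bracket N) (n : ℤ) (hn : (N : ℤ) ≤ |n|) :
    Small w (coeffA φ) (coeffB φ) n :=
  small_coeff hw hφ (hN.trans (bracket_mono hn))

/-- The far out gap lengths. -/
theorem IsPeriodicSpectrum.tail_gaps (h : IsPeriodicSpectrum φ lm lp) (hw : w ∈ weightsOne)
    (hφ : φ ∈ Hw w) (hN : 8 * wNorm w φ ^ 2 ≤ bracket N) :
    Summable (fun n : {n : ℤ // (N : ℤ) ≤ |n|} => w (2 * (n : ℤ)) ^ 2 * ‖lp n - lm n‖ ^ 2) ∧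
      ∑' n : {n : ℤ // (N : ℤ) ≤ |n|}, w (2 * (n : ℤ)) ^ 2 * ‖lp n - lm n‖ ^ 2
        ≤ 6 * wNorm w (tail N φ) ^ 2 + 1152 / bracket N * wNorm w φ ^ 6 := by
  have hle : ∀ n : {n : ℤ // (N : ℤ) ≤ |n|}, w (2 * (n : ℤ)) ^ 2 * ‖lp n - lm n‖ ^ 2 ≤
      6 * wTerm w φ n + 288 * wNorm w φ ^ 6 * (bracket (n : ℤ))⁻¹ ^ 2 := fun n =>
    h.gap_le hφ (small_of_le_abs hw hφ hN) n.2
  have s1 : Summable fun n : {n : ℤ // (N : ℤ) ≤ |n|} => 6 * wTerm w φ n :=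
    (hφ.comp_injective Subtype.val_injective).mul_left 6
  have s2 : Summable fun n : {n : ℤ // (N : ℤ) ≤ |n|} =>
      288 * wNorm w φ ^ 6 * (bracket (n : ℤ))⁻¹ ^ 2 :=
    (hasSum_bracket_inv_sq.summable.comp_injective Subtype.val_injective).mul_left _
  have s := Summable.of_nonneg_of_le (fun n => by positivity) hle (s1.add s2)
  refine ⟨s, (s.tsum_le_tsum hle (s1.add s2)).trans ?_⟩
  rw [s1.tsum_add s2, tsum_mul_left, tsum_mul_left, ← wNorm_tail_sq]
  have h6 : 0 ≤ wNorm w φ ^ 6 := by positivity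
  -- `288 · 4 = 1152`.
  have := mul_le_mul_of_nonneg_left (tsum_bracket_inv_sq_le N)
    (show 0 ≤ 288 * wNorm w φ ^ 6 by positivity)
  refine add_le_add_right (this.trans (le_of_eq ?_)) _
  ring

end gaps

/-! ### The piecewise linear extension of a weight. -/

section weightext

variable {w : ℤ → ℝ}

theorem weight_le_of_abs_le (hw : w ∈ weights) {k m : ℤ} (h : |k| ≤ m) : w k ≤ w m := by
  have hmono : Monotone fun j : ℕ => w j := by
    refine monotone_nat_of_le_succ fun j => ?_
    simpa using hw.2.2.2 j
  have habs : w |k| = w k := by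
    rcases abs_choice k with h | h
    · rw [h]
    · rw [h, ← hw.2.1]
  rw [← habs]
  lift m to ℕ using (abs_nonneg k).trans h
  rw [Int.abs_eq_natAbs] at h ⊢
  exact hmono (by exact_mod_cast h)

/-- Lower bound for the piecewise linear extension. -/
theorem weight_le_weightExt (hw : w ∈ weights) {k : ℤ} {t : ℝ} (h : |(k : ℝ)| ≤ t) :
    w k ≤ weightExt w t := by
  have hk : |k| ≤ ⌊t⌋ := Int.le_floor.2 (by push_cast; exact h)
  have h0 : 0 ≤ ⌊t⌋ := (abs_nonneg k).trans hk
  have h1 : w ⌊t⌋ ≤ w (⌊t⌋ + 1) := weight_le_of_abs_le hw (by rw [abs_of_nonneg h0]; lia)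
  refine (weight_le_of_abs_le hw hk).trans ?_
  rw [weightExt]
  exact le_add_of_nonneg_right (mul_nonneg (sub_nonneg.2 (Int.floor_le t)) (sub_nonneg.2 h1))

end weightext

/-! ### Gaps near the origin and the second estimate. -/

section discs

theorem separated_of_disjoint {c d r s : ℝ} (hr : 0 ≤ r) (hs : 0 ≤ s)
    (h : Disjoint (Metric.closedBall (c : ℂ) r) (Metric.closedBall (d : ℂ) s)) :
    c + r < d - s ∨ d + s < c - r := by
  by_contra! hne
  obtain ⟨h1, h2⟩ := hne
  have hp : ∀ (x e ρ : ℝ), e - ρ ≤ x → x ≤ e + ρ → (x : ℂ) ∈ Metric.closedBall (e : ℂ) ρ := by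
    intro x e ρ h1 h2
    rw [mem_closedBall_iff_norm, ← Complex.ofReal_sub, Complex.norm_real, Real.norm_eq_abs]
    exact abs_le.2 ⟨by linarith, by linarith⟩
  -- If the real traces of the discs overlap, the larger of their left endpoints belongs to both.
  refine Set.not_disjoint_iff.2 ⟨((max (c - r) (d - s) : ℝ) : ℂ), ?_, ?_⟩ h
  · exact hp _ _ _ (le_max_left _ _) (max_le (by linarith) h1)
  · exact hp _ _ _ (le_max_right _ _) (max_le h2 (by linarith))

/-- Consecutive intervals `[a j, b j]` do not overlap, so those strictly between two given ones fit
into the space that separates these two. -/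
theorem sum_diam_le {a b : ℤ → ℝ} (h : ∀ n, b n ≤ a (n + 1)) (m : ℤ) (k : ℕ) :
    ∑ j ∈ Finset.range k, (b (m + j + 1) - a (m + j + 1)) ≤ a (m + k + 1) - b m := by
  induction k with
  | zero => simpa using h m
  | succ k ih =>
    rw [Finset.sum_range_succ]
    have := h (m + k + 1)
    push_cast
    rw [← add_assoc]
    linarith

end discs

section near

variable {w : ℤ → ℝ} {φ : L2c} {lm lp : ℤ → ℂ} {N : ℕ}

/-- The gap lengths near the origin. -/
theorem IsPeriodicSpectrum.near_gaps (h : IsPeriodicSpectrum φ lm lp) (hφ : φ ∈ W)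
    (hN : ∀ n : ℤ, (N : ℤ) ≤ |n| → ‖lm n - n * Real.pi‖ ≤ 3 / 4) :
    ∑ n ∈ Finset.Ioo (-(N : ℤ)) N, ‖lp n - lm n‖ ^ 2 ≤ (2 * N + 1 / 2) ^ 2 * Real.pi ^ 2 := by
  have hpi := Real.pi_gt_three
  obtain ⟨-, -, V, -, -, ⟨ctr, rad, U, hU, hdisj, hV, -, -⟩, hφV⟩ := hφ
  have hmem : ∀ n, lm n ∈ Metric.closedBall (ctr n : ℂ) (rad n) ∧
      lp n ∈ Metric.closedBall (ctr n : ℂ) (rad n) := by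
    intro n
    rw [← (hU n).2]
    exact ((hV φ hφV).1 lm lp h n).imp (fun h => interior_subset h) (fun h => interior_subset h)
  have hre : ∀ {z : ℂ} {c r : ℝ}, z ∈ Metric.closedBall (c : ℂ) r → |z.re - c| ≤ r := by
    intro z c r hz
    rw [mem_closedBall_iff_norm] at hz
    exact (Complex.abs_re_le_norm (z - c)).trans' (by simp) |>.trans hz
  -- Disjointness leaves two orders for neighbouring discs; the lexicographic order of the
  -- eigenvalues inside them excludes the reversed one.
  have hstep : ∀ n, ctr n + rad n ≤ ctr (n + 1) - rad (n + 1) := by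
    intro n
    have hd := hdisj n (n + 1) (by lia)
    rw [(hU n).2, (hU (n + 1)).2] at hd
    rcases separated_of_disjoint (hU n).1.le (hU (n + 1)).1.le hd with h1 | h1
    · exact h1.le
    · have h2 := abs_le.1 (hre (hmem n).1)
      have h3 := abs_le.1 (hre (hmem (n + 1)).1)
      have h4 := (h.lex_gap n).re_le.trans (h.lex_next n).re_le
      linarith
  have hgap : ∀ n, ‖lp n - lm n‖ ≤ (ctr n + rad n) - (ctr n - rad n) := by
    intro n
    have h1 := mem_closedBall_iff_norm.1 (hmem n).1
    have h2 := mem_closedBall_iff_norm.1 (hmem n).2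
    have := norm_sub_le (lp n - ctr n) (lm n - ctr n)
    rw [sub_sub_sub_cancel_right] at this
    linarith
  rcases Nat.eq_zero_or_pos N with rfl | hpos
  · simp
    positivity
  have hidx : Finset.Ioo (-(N : ℤ)) N =
      (Finset.range (2 * N - 1)).image fun j : ℕ => -(N : ℤ) + j + 1 := by
    ext n
    simp only [Finset.mem_Ioo, Finset.mem_image, Finset.mem_range]
    constructor
    · rintro ⟨h1, h2⟩
      exact ⟨(n + N - 1).toNat, by omega, by omega⟩
    · rintro ⟨j, h1, rfl⟩
      omega
  have hinj : Function.Injective fun j : ℕ => -(N : ℤ) + j + 1 := fun i j h => by simpa using h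
  -- The discs strictly between those with index `±N` lie between the real parts of `lm (-N)` and
  -- `lm N`, whose distance is at most `2Nπ + 2 · 3/4`; and `3/2 ≤ π/2`.
  have hsum : ∑ n ∈ Finset.Ioo (-(N : ℤ)) N, ‖lp n - lm n‖ ≤ (2 * N + 1 / 2) * Real.pi := by
    refine (Finset.sum_le_sum fun n _ => hgap n).trans ?_
    rw [hidx, Finset.sum_image hinj.injOn]
    refine (sum_diam_le (a := fun n => ctr n - rad n) (b := fun n => ctr n + rad n) hstep _ _).trans ?_
    rw [show -(N : ℤ) + ((2 * N - 1 : ℕ) : ℤ) + 1 = N by omega]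
    have h1 := abs_le.1 (hre (hmem N).1)
    have h2 := abs_le.1 (hre (hmem (-N)).1)
    have h3 := abs_le.1 ((abs_re_sub_le _ _).trans (hN N (by simp)))
    have h4 := abs_le.1 ((abs_re_sub_le _ _).trans (hN (-N) (by simp)))
    push_cast at h3 h4
    linarith
  calc _ ≤ (∑ n ∈ Finset.Ioo (-(N : ℤ)) N, ‖lp n - lm n‖) ^ 2 :=
        Finset.sum_sq_le_sq_sum_of_nonneg fun n _ => norm_nonneg _
    _ ≤ _ := by
        rw [← mul_pow]
        exact pow_le_pow_left₀ (Finset.sum_nonneg fun n _ => norm_nonneg _) hsum 2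

theorem hasSum_of_tail {f : ℤ → ℝ} {a : ℝ}
    (h : HasSum (fun n : {n : ℤ // (N : ℤ) ≤ |n|} => f n) a) :
    HasSum f (a + ∑ n ∈ Finset.Ioo (-(N : ℤ)) N, f n) := by
  refine (Finset.hasSum_compl_iff (Finset.Ioo (-(N : ℤ)) N)).1 ?_
  have e : ∀ n : ℤ, n ∉ Finset.Ioo (-(N : ℤ)) N ↔ (N : ℤ) ≤ |n| := by
    intro n
    rw [Finset.mem_Ioo, ← abs_lt, not_lt]
  exact ((Equiv.subtypeEquivRight e).hasSum_iff).2 h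

/-- Here `x = ‖φ‖²`, `E = w[16x]`, `p = π`, and `T`, `S` are the far and near sums. If `N = 0` then
`8x ≤ 1` and `T` alone is at most `24x`. Otherwise `p²E² ≥ 81` absorbs the far terms, and `256 +
144/81 < 265`. -/
theorem total_bound {x E p S T : ℝ} {N : ℕ} (hx : 0 ≤ x) (hE : 1 ≤ E) (hp : 3 < p)
    (hN0 : 8 * x ≤ N + 1) (hN1 : N ≠ 0 → N ≤ 8 * x ∧ 1 ≤ 8 * x ∧ 3 ≤ E)
    (hT : T ≤ 6 * x + 1152 / (N + 1) * x ^ 3)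
    (hS : S ≤ if N = 0 then 0 else E ^ 2 * ((2 * N + 1 / 2) ^ 2 * p ^ 2)) :
    T + S ≤ 265 * p ^ 2 * E ^ 2 * (1 + x) * x := by
  have hp2 : 9 ≤ p ^ 2 := by nlinarith
  have hE2 : 1 ≤ E ^ 2 := by nlinarith
  have hq : 9 ≤ p ^ 2 * E ^ 2 := by nlinarith
  have hT' : T ≤ 6 * x + 144 * x ^ 2 := by
    refine hT.trans (add_le_add_right ?_ _)
    rw [div_mul_eq_mul_div, div_le_iff₀ (by positivity)]
    nlinarith [mul_le_mul_of_nonneg_left hN0 (sq_nonneg x)]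
  split_ifs at hS with hN
  · subst hN
    have hx8 : 8 * x ≤ 1 := by simpa using hN0
    have h1 : T + S ≤ 24 * x := by nlinarith
    have h2 : 0 ≤ p ^ 2 * E ^ 2 * x ^ 2 := by positivity
    nlinarith [mul_le_mul_of_nonneg_right hq hx]
  · obtain ⟨h1, h2, h3⟩ := hN1 hN
    have hE9 : 9 ≤ E ^ 2 := by nlinarith
    have hq' : 81 ≤ p ^ 2 * E ^ 2 := by nlinarith
    -- From `N ≤ 8x`; the constant `1/4` of the square is at most `2x` because `8x ≥ 1`.
    have hsq : (2 * (N : ℝ) + 1 / 2) ^ 2 ≤ 256 * x ^ 2 + 18 * x := by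
      have : (2 * (N : ℝ) + 1 / 2) ^ 2 ≤ (16 * x + 1 / 2) ^ 2 :=
        pow_le_pow_left₀ (by positivity) (by linarith) 2
      nlinarith
    have hS' : S ≤ p ^ 2 * E ^ 2 * (256 * x ^ 2 + 18 * x) := by
      refine hS.trans ?_
      rw [mul_comm _ (p ^ 2), mul_left_comm, ← mul_assoc]
      exact mul_le_mul_of_nonneg_left hsq (by positivity)
    have h4 := mul_le_mul_of_nonneg_right hq' hx
    have h5 := mul_le_mul_of_nonneg_right hq' (sq_nonneg x)
    nlinarith

/-- All gap lengths of a potential that has isolating neighbourhoods. -/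
theorem IsPeriodicSpectrum.all_gaps (h : IsPeriodicSpectrum φ lm lp) (hw : w ∈ weightsOne)
    (hφ : φ ∈ Hw w) (hW : φ ∈ W) :
    Summable (fun n : ℤ => w (2 * n) ^ 2 * ‖lp n - lm n‖ ^ 2) ∧
      ∑' n : ℤ, w (2 * n) ^ 2 * ‖lp n - lm n‖ ^ 2
        ≤ 265 * Real.pi ^ 2 * weightExt w (16 * wNorm w φ ^ 2) ^ 2
          * (1 + wNorm w φ ^ 2) * wNorm w φ ^ 2 := by
  set x := wNorm w φ ^ 2 with hx
  have hx0 : 0 ≤ x := sq_nonneg _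
  -- The least `N` with `⟨N⟩ ≥ 8x`. If it is positive then `N ≤ 8x`, so `|2n| ≤ 16x` for all near
  -- indices, which is where the argument of the weight comes from.
  set N := ⌈8 * x - 1⌉₊ with hNdef
  have hN0 : 8 * x ≤ N + 1 := by linarith [Nat.le_ceil (8 * x - 1)]
  have hb : bracket N = N + 1 := by rw [bracket, Nat.abs_cast, add_comm]
  have hNb : 8 * wNorm w φ ^ 2 ≤ bracket N := by rw [hb]; exact hN0
  have hN1 : N ≠ 0 → (N : ℝ) ≤ 8 * x ∧ 1 ≤ 8 * x := by
    intro hne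
    have h1 : 0 < 8 * x - 1 := Nat.ceil_pos.1 (Nat.pos_of_ne_zero hne)
    exact ⟨by linarith [Nat.ceil_lt_add_one h1.le], by linarith⟩
  have hE1 : 1 ≤ weightExt w (16 * x) :=
    (hw.1.1 0).trans (weight_le_weightExt hw.1 (by simpa using hx0))
  -- For `N ≠ 0` one has `16x ≥ 2`, and `w 2 ≥ ⟨2⟩ = 3`.
  have hE3 : N ≠ 0 → 3 ≤ weightExt w (16 * x) := by
    intro hne
    refine le_trans ?_ (weight_le_weightExt hw.1 (k := 2) (t := 16 * x) ?_)
    · refine le_trans ?_ (bracket_le_of_weightsOne hw 2)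
      norm_num [bracket]
    · norm_num
      linarith [(hN1 hne).2]
  obtain ⟨hs, hle⟩ := h.tail_gaps hw hφ hNb
  have hsum := hasSum_of_tail (N := N) (f := fun n => w (2 * n) ^ 2 * ‖lp n - lm n‖ ^ 2) hs.hasSum
  refine ⟨hsum.summable, ?_⟩
  rw [hsum.tsum_eq]
  refine total_bound (N := N) hx0 hE1 Real.pi_gt_three hN0
    (fun hne => ⟨(hN1 hne).1, (hN1 hne).2, hE3 hne⟩) ?_ ?_
  · refine hle.trans ?_
    rw [hb, show wNorm w φ ^ 6 = x ^ 3 by rw [hx]; ring]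
    gcongr
    exact wNorm_tail_sq_le hφ
  · split_ifs with hne
    · rw [hne]; simp
    · refine le_trans (Finset.sum_le_sum fun n hn => ?_) ((Finset.mul_sum _ _ _).symm.trans_le
        (mul_le_mul_of_nonneg_left (h.near_gaps (N := N) hW fun n hn =>
          (h.close (small_of_le_abs hw hφ hNb) hn).2.1) (sq_nonneg _)))
      refine mul_le_mul_of_nonneg_right (pow_le_pow_left₀ (weight_pos hw _).le
        (weight_le_weightExt hw.1 ?_) 2) (sq_nonneg _)
      have h1 : |n| ≤ N := (abs_lt.2 (Finset.mem_Ioo.1 hn)).le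
      have h2 : |(n : ℝ)| ≤ N := by exact_mod_cast h1
      push_cast
      rw [abs_mul, abs_two]
      linarith [(hN1 hne).1]

end near

end NLS

end

theorem proposition5 (w : ℤ → ℝ) (hw : w ∈ NLS.weightsOne) (φ : NLS.L2c) (hφ : φ ∈ NLS.Hw w)
    (lm lp : ℤ → ℂ) (hspec : NLS.IsPeriodicSpectrum φ lm lp) :
    (∀ N : ℕ, 8 * NLS.wNorm w φ ^ 2 ≤ NLS.bracket N →
      Summable (fun n : {n : ℤ // (N : ℤ) ≤ |n|} =>
        w (2 * (n : ℤ)) ^ 2 * ‖lp n - lm n‖ ^ 2) ∧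
      ∑' n : {n : ℤ // (N : ℤ) ≤ |n|}, w (2 * (n : ℤ)) ^ 2 * ‖lp n - lm n‖ ^ 2
        ≤ 6 * NLS.wNorm w (NLS.tail N φ) ^ 2
          + 1152 / NLS.bracket N * NLS.wNorm w φ ^ 6) ∧
    (φ ∈ NLS.W →
      Summable (fun n : ℤ => w (2 * n) ^ 2 * ‖lp n - lm n‖ ^ 2) ∧
      ∑' n : ℤ, w (2 * n) ^ 2 * ‖lp n - lm n‖ ^ 2
        ≤ 265 * Real.pi ^ 2 * NLS.weightExt w (16 * NLS.wNorm w φ ^ 2) ^ 2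
          * (1 + NLS.wNorm w φ ^ 2) * NLS.wNorm w φ ^ 2) := by
  exact ⟨fun N hN => hspec.tail_gaps hw hφ hN, fun hW => hspec.all_gaps hw hφ hW⟩
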